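/- Assume $2^{\omega_1}=\omega_2$. For an uncountable regular cardinal $\kappa$ let $H(\kappa)$ be the set of all sets whose transitive closure has size less than $\kappa$, and for a set $X$ let $P_{\omega_1}(X)$ be the set of countable subsets of $X$. Fix a bijection $\pi:\omega_2\to H(\omega_2)$ and a stationary set $\mathcal Y\subseteq P_{\omega_1}(\omega_2)$ which is thin, i.e. $|\{a\cap\beta : a\in\mathcal Y\}|\le\omega_1$ for all $\beta<\omega_2$, and closed under initial segments, i.e. $a\cap\beta\in\mathcal Y$ for all $a\in\mathcal Y$ and $\beta<\omega_2$. Let $\mathcal A=(H(\omega_2),\in,\pi,\mathcal Y)$, and for $a\subseteq H(\omega_2)$ let $Sk(a)$ be the closure of $a$ under the definable Skolem functions of $\mathcal A$ given by the well-ordering of $H(\omega_2)$ induced by $\pi$. Put $$C=\{\beta<\omega_2 : Sk(\beta)\cap\omega_2=\beta\},\qquad \Lambda=\{\beta<\omega_2 : \mathrm{cf}(\beta)=\omega_1,\ \beta \text{ is a limit point of } C\},$$ and let $\mathcal X$ be the set of $M\in\mathcal Y$ such that $Sk(M)\cap\omega_2=M$ and $\sup(C\cap\gamma)\in M$ for all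 $\gamma\in M$. Fix a set $\Gamma\subseteq\Lambda$ which is stationary in $\omega_2$. For $M\in\mathcal X$ let $\Gamma_M$ be the set of $\beta\in\Gamma$ with $\beta=\min(\Gamma\setminus\sup(M\cap\beta))$, and for $M,N\in\mathcal X$ let $\beta_{M,N}$ be the largest element of $\Gamma_M\cap\Gamma_N$. A set $A\subseteq\mathcal X$ is adequate if for all $M,N\in A$, either $M\cap\beta_{M,N}=N\cap\beta_{M,N}$, or $M\cap\beta_{M,N}\in Sk(N)$, or $N\cap\beta_{M,N}\in Sk(M)$. A finite tree on $\omega_1$ is a pair $T=(|T|,<_T)$, where $|T|$ is a finite subset of $\omega_1$ and $<_T$ is an irreflexive, transitive relation on $|T|$ such that $a,b<_T c$ implies $a=b$, $a<_T b$ or $b<_T a$, and $a<_T b$ implies $a<b$. Such a tree $U$ end-extends $T$ if $|T|\subseteq|U|$ and ${<_U}\cap(|T|\times|T|)={<_T}$. Let $\mathbb P$ be the forcing poset of all triples $(T,F,A)$ such that (1) $T$ is a finite tree on $\omega_1$; (2) $F$ is an injective function from the set of maximal nodes of $T$ into $\omega_2$; (3) $A$ is a finite adequate set; (4) if $M\in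 A$, $a$ and $b$ are distinct maximal nodes of $T$, and $F(a),F(b)\in M$, then every $c$ with $c<_T a$ and $c<_T b$ is in $M$. The order is: $(U,G,B)\le(T,F,A)$ if $U$ end-extends $T$, $A\subseteq B$, and for every maximal node $a$ of $T$ there is a maximal node $b$ of $U$ with $a\le_U b$ and $F(a)=G(b)$. Then $\mathbb P$ is strongly proper on a stationary set: for every sufficiently large regular cardinal $\theta$ with $\mathbb P\subseteq H(\theta)$, the set of countable $N\prec H(\theta)$ such that every $p\in N\cap\mathbb P$ has an extension $q\le p$ which is strongly $(N,\mathbb P)$-generic is stationary in $P_{\omega_1}(H(\theta))$. Here $q\in\mathbb P$ is strongly $(N,\mathbb P)$-generic if every dense subset $D$ of the poset $N\cap\mathbb P$ is predense in $\mathbb P$ below $q$, i.e. every $r\le q$ in $\mathbb P$ is compatible in $\mathbb P$ with some element of $D$. -/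

import Mathlib

open Cardinal Ordinal

universe u

namespace AdequateForcing

/-! ### Hereditarily small sets and stationary sets of countable sets -/

/-- `H(κ)`: the sets whose transitive closure has cardinality less than `κ`
(equivalently, which are included in a transitive set of cardinality less than `κ`). -/
def H (κ : Cardinal.{u}) : Set ZFSet.{u} :=
  {x | ∃ t : ZFSet.{u}, t.IsTransitive ∧ x ⊆ t ∧ t.card < κ}

/-- `P_{ω₁}(X)`: the countable subsets of `X`. -/
def countableSubsets {α : Type*} (X : Set α) : Set (Set α) :=
  {a | a ⊆ X ∧ a.Countable}

/-- Closed unbounded subsets of `P_{ω₁}(X)`. -/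
structure IsClubCountable {α : Type*} (X : Set α) (C : Set (Set α)) : Prop where
  subset : C ⊆ countableSubsets X
  unbounded : ∀ a ∈ countableSubsets X, ∃ b ∈ C, a ⊆ b
  closed : ∀ f : ℕ → Set α, Monotone f → (∀ n, f n ∈ C) → (⋃ n, f n) ∈ C

/-- Stationary subsets of `P_{ω₁}(X)`. -/
def IsStationaryCountable {α : Type*} (X : Set α) (S : Set (Set α)) : Prop :=
  S ⊆ countableSubsets X ∧ ∀ C, IsClubCountable X C → (S ∩ C).Nonempty

/-! ### Forcing posets and strong properness -/

/-- A forcing poset whose conditions are sets: a set of conditions preordered by `le`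
(`le q p` means that `q` extends `p`). -/
structure ForcingPoset where
  carrier : Set ZFSet.{u}
  le : ZFSet.{u} → ZFSet.{u} → Prop
  le_refl : ∀ p ∈ carrier, le p p
  le_trans : ∀ p ∈ carrier, ∀ q ∈ carrier, ∀ r ∈ carrier, le r q → le q p → le r p

/-- Two conditions are compatible if they have a common extension. -/
def ForcingPoset.Compatible (Q : ForcingPoset.{u}) (p q : ZFSet.{u}) : Prop :=
  ∃ r ∈ Q.carrier, Q.le r p ∧ Q.le r q

/-- `D` is a dense subset of the suborder `N ∩ Q`. -/
def ForcingPoset.IsDenseIn (Q : ForcingPoset.{u}) (N D : Set ZFSet.{u}) : Prop :=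
  D ⊆ N ∩ Q.carrier ∧ ∀ p ∈ N ∩ Q.carrier, ∃ d ∈ D, Q.le d p

/-- `D` is predense in `Q` below `q`. -/
def ForcingPoset.IsPredenseBelow (Q : ForcingPoset.{u}) (D : Set ZFSet.{u})
    (q : ZFSet.{u}) : Prop :=
  ∀ r ∈ Q.carrier, Q.le r q → ∃ d ∈ D, Q.Compatible d r

/-- `q` is a strongly `(N, Q)`-generic condition. -/
def ForcingPoset.IsStronglyGeneric (Q : ForcingPoset.{u}) (N : Set ZFSet.{u})
    (q : ZFSet.{u}) : Prop :=
  q ∈ Q.carrier ∧ ∀ D : Set ZFSet.{u}, Q.IsDenseIn N D → Q.IsPredenseBelow D q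

/-- The only symbol of the language of set theory. -/
inductive SetRel : ℕ → Type
  | mem : SetRel 2

/-- The first-order language of set theory. -/
def langSet : FirstOrder.Language.{0, 0} := ⟨fun _ => Empty, SetRel⟩

/-- The structure `(H(θ), ∈)`. -/
instance structureH (θ : Cardinal.{u}) : langSet.Structure ↥(H θ) where
  funMap := fun f => Empty.elim f
  RelMap := fun {_} r => match r with
    | SetRel.mem => fun v => (v 0 : ZFSet.{u}) ∈ (v 1 : ZFSet.{u})

/-- `N ≺ H(θ)`. -/
def IsElementaryInH (θ : Cardinal.{u}) (N : Set ZFSet.{u}) : Prop :=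
  ∃ S : langSet.ElementarySubstructure ↥(H θ), N = Subtype.val '' (S : Set ↥(H θ))

/-- `Q` is strongly proper on a stationary set: for every sufficiently large regular cardinal `θ`
with `Q ⊆ H(θ)` there are stationarily many countable `N ≺ H(θ)` such that every condition in
`N ∩ Q` has a strongly `(N, Q)`-generic extension. -/
def ForcingPoset.StronglyProperOnStationarySet (Q : ForcingPoset.{u}) : Prop :=
  ∃ κ : Cardinal.{u}, ∀ θ : Cardinal.{u}, κ ≤ θ → θ.IsRegular → Q.carrier ⊆ H θ →
    IsStationaryCountable (H θ)
      {N | N ∈ countableSubsets (H θ) ∧ IsElementaryInH θ N ∧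
        ∀ p ∈ N ∩ Q.carrier, ∃ q, Q.le q p ∧ Q.IsStronglyGeneric N q}

/-! ### The structure `(H(ω₂), ∈, π, 𝒴)` and Skolem hulls -/

/-- `𝒴` is thin: for all `β < ω₂` there are at most `ω₁` many sets `a ∩ β` with `a ∈ 𝒴`. -/
def IsThin (Y : Set ZFSet.{u}) : Prop :=
  ∀ β < ω_ 2, #{b : ZFSet.{u} | ∃ a ∈ Y, b = a ∩ β.toZFSet} ≤ ℵ₁

/-- The symbols of the language of `(H(ω₂), ∈, π, 𝒴)`: membership, the graph of `π`, and a
predicate for `𝒴`. -/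
inductive ARel : ℕ → Type
  | mem : ARel 2
  | graph : ARel 2
  | inY : ARel 1

/-- The language of `(H(ω₂), ∈, π, 𝒴)`. -/
def langA : FirstOrder.Language.{0, 0} := ⟨fun _ => Empty, ARel⟩

variable (π : Ordinal.{u} → ZFSet.{u}) (Y : Set ZFSet.{u}) (Γ : Set Ordinal.{u})

/-- The structure `𝒜 = (H(ω₂), ∈, π, 𝒴)`. Only the values of `π` on ordinals below `ω₂` are
used. -/
@[reducible]
def structureA : langA.Structure ↥(H.{u} (ℵ_ 2)) where
  funMap := fun f => Empty.elim f
  RelMap := fun {_} r => match r with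
    | ARel.mem => fun v => (v 0 : ZFSet.{u}) ∈ (v 1 : ZFSet.{u})
    | ARel.graph => fun v => ∃ α < ω_ 2, (v 0 : ZFSet.{u}) = α.toZFSet ∧ (v 1 : ZFSet.{u}) = π α
    | ARel.inY => fun v => (v 0 : ZFSet.{u}) ∈ Y

/-- `𝒜 ⊨ φ(v₀, …, vₙ₋₁, x)`. -/
def Sat {n : ℕ} (φ : langA.BoundedFormula Empty (n + 1)) (v : Fin n → ↥(H.{u} (ℵ_ 2)))
    (x : ↥(H.{u} (ℵ_ 2))) : Prop :=
  letI := structureA π Y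
  φ.Realize default (Fin.snoc v x : Fin (n + 1) → ↥(H.{u} (ℵ_ 2)))

/-- The definable Skolem function of `φ` given by the well-ordering of `H(ω₂)` that `π` induces:
its value at `v` is the least `x` in this well-ordering with `𝒜 ⊨ φ(v, x)`, and the least element
`π 0` of `H(ω₂)` if there is no such `x` (the infimum of the empty set of ordinals is `0`). -/
noncomputable def skolemFun {n : ℕ} (φ : langA.BoundedFormula Empty (n + 1))
    (v : Fin n → ↥(H.{u} (ℵ_ 2))) : ZFSet.{u} :=
  π (sInf {α | α < ω_ 2 ∧ ∃ x : ↥(H.{u} (ℵ_ 2)), (x : ZFSet.{u}) = π α ∧ Sat π Y φ v x})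

/-- Membership in the closure of `a` under the Skolem functions. -/
inductive MemSk (a : Set ZFSet.{u}) : ZFSet.{u} → Prop
  | base (x : ZFSet.{u}) (hx : x ∈ a) : MemSk a x
  | step (n : ℕ) (φ : langA.BoundedFormula Empty (n + 1)) (v : Fin n → ↥(H.{u} (ℵ_ 2)))
      (hv : ∀ i, MemSk a (v i : ZFSet.{u})) : MemSk a (skolemFun π Y φ v)

/-- `Sk(a)`: the closure of `a ⊆ H(ω₂)` under the definable Skolem functions of `𝒜`. -/
def Sk (a : ZFSet.{u}) : Set ZFSet.{u} := {x | MemSk π Y (a : Set ZFSet.{u}) x}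

/-- `Sk(a) ∩ ω₂ = a`. -/
def IsSkClosed (a : ZFSet.{u}) : Prop :=
  Sk π Y a ∩ ((ω_ 2).toZFSet : Set ZFSet.{u}) = (a : Set ZFSet.{u})

/-- `C`: the set of `β < ω₂` with `Sk(β) ∩ ω₂ = β`. -/
def clubC : Set Ordinal.{u} := {β | β < ω_ 2 ∧ IsSkClosed π Y β.toZFSet}

/-- `Λ`: the set of `β < ω₂` of cofinality `ω₁` which are limit points of `C`. -/
def Lam : Set Ordinal.{u} :=
  {β | β < ω_ 2 ∧ β.cof = ℵ₁ ∧ ∀ α < β, ∃ γ ∈ clubC π Y, α < γ ∧ γ < β}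

/-- `𝒳`: the set of `M ∈ 𝒴` such that `Sk(M) ∩ ω₂ = M` and `sup(C ∩ γ) ∈ M` for all `γ ∈ M`. -/
def models : Set ZFSet.{u} :=
  {M | M ∈ Y ∧ IsSkClosed π Y M ∧
    ∀ γ : Ordinal.{u}, γ.toZFSet ∈ M → (sSup (clubC π Y ∩ Set.Iio γ)).toZFSet ∈ M}

/-! ### Comparison points and adequate sets -/

/-- `Γ_M`: the set of `β ∈ Γ` with `β = min (Γ \ sup(M ∩ β))`. -/
def gammaOf (M : ZFSet.{u}) : Set Ordinal.{u} :=
  {β | IsLeast {γ | γ ∈ Γ ∧ sSup {α | α.toZFSet ∈ M ∧ α < β} ≤ γ} β}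

/-- `A` is adequate: `A ⊆ 𝒳`, and for all `M, N ∈ A`, where `β = β_{M,N}` is the largest element of
`Γ_M ∩ Γ_N`, either `M ∩ β = N ∩ β`, or `M ∩ β ∈ Sk(N)`, or `N ∩ β ∈ Sk(M)`. -/
def IsAdequate (A : Set ZFSet.{u}) : Prop :=
  A ⊆ models π Y ∧ ∀ M ∈ A, ∀ N ∈ A, ∃ β, IsGreatest (gammaOf Γ M ∩ gammaOf Γ N) β ∧
    (M ∩ β.toZFSet = N ∩ β.toZFSet ∨ M ∩ β.toZFSet ∈ Sk π Y N ∨ N ∩ β.toZFSet ∈ Sk π Y M)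

/-! ### The forcing poset -/

/-- A pair `T = (|T|, <_T)` of a set of nodes and a set of ordered pairs. -/
structure TreeData where
  nodes : ZFSet.{u}
  rel : ZFSet.{u}

/-- `a <_T b`. -/
def TreeData.Lt (T : TreeData.{u}) (a b : ZFSet.{u}) : Prop := ZFSet.pair a b ∈ T.rel

/-- `a ≤_T b`. -/
def TreeData.Le (T : TreeData.{u}) (a b : ZFSet.{u}) : Prop := a = b ∨ T.Lt a b

/-- `T` is a finite tree on `ω₁`. -/
structure TreeData.IsFiniteTree (T : TreeData.{u}) : Prop where
  nodes_subset : T.nodes ⊆ (ω_ 1).toZFSet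
  nodes_finite : (T.nodes : Set ZFSet.{u}).Finite
  rel_subset : T.rel ⊆ T.nodes.prod T.nodes
  irrefl : ∀ a, ¬ T.Lt a a
  trans : ∀ a b c, T.Lt a b → T.Lt b c → T.Lt a c
  tree : ∀ a b c, T.Lt a c → T.Lt b c → a = b ∨ T.Lt a b ∨ T.Lt b a
  lt_of_lt : ∀ a b, T.Lt a b → a ∈ b

/-- `U` end-extends `T`. -/
def TreeData.EndExtends (U T : TreeData.{u}) : Prop :=
  T.nodes ⊆ U.nodes ∧ ∀ a ∈ T.nodes, ∀ b ∈ T.nodes, U.Lt a b ↔ T.Lt a b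

/-- The set of maximal nodes of `T`. -/
def TreeData.maxNodes (T : TreeData.{u}) : ZFSet.{u} :=
  T.nodes.sep fun a => ∀ b, ¬ T.Lt a b

/-- A triple `(T, F, A)`. -/
structure Triple where
  T : TreeData.{u}
  F : ZFSet.{u}
  A : ZFSet.{u}

/-- The set `((|T|, <_T), (F, A))` which a triple `(T, F, A)` is. -/
def Triple.toSet (p : Triple.{u}) : ZFSet.{u} :=
  ZFSet.pair (ZFSet.pair p.T.nodes p.T.rel) (ZFSet.pair p.F p.A)

/-- The triple `(T, F, A)` is a condition. The function `F` is a set of ordered pairs. -/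
structure Triple.IsCondition (p : Triple.{u}) : Prop where
  tree : p.T.IsFiniteTree
  func : ZFSet.IsFunc p.T.maxNodes (ω_ 2).toZFSet p.F
  inj : ∀ a b x, ZFSet.pair a x ∈ p.F → ZFSet.pair b x ∈ p.F → a = b
  finite : (p.A : Set ZFSet.{u}).Finite
  adequate : IsAdequate π Y Γ (p.A : Set ZFSet.{u})
  meet : ∀ M ∈ p.A, ∀ a ∈ p.T.maxNodes, ∀ b ∈ p.T.maxNodes, a ≠ b →
    ∀ x ∈ M, ∀ y ∈ M, ZFSet.pair a x ∈ p.F → ZFSet.pair b y ∈ p.F →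
      ∀ c, p.T.Lt c a → p.T.Lt c b → c ∈ M

/-- `(U, G, B) ≤ (T, F, A)`. -/
structure Triple.Extends (q p : Triple.{u}) : Prop where
  endExtends : q.T.EndExtends p.T
  subset : p.A ⊆ q.A
  maximal : ∀ a ∈ p.T.maxNodes, ∃ b ∈ q.T.maxNodes, q.T.Le a b ∧
    ∃ x, ZFSet.pair a x ∈ p.F ∧ ZFSet.pair b x ∈ q.F

theorem Triple.toSet_injective {p q : Triple.{u}} (h : p.toSet = q.toSet) : p = q := by
  obtain ⟨⟨n, r⟩, F, A⟩ := p
  obtain ⟨⟨n', r'⟩, F', A'⟩ := q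
  simp only [Triple.toSet, ZFSet.pair_inj] at h
  obtain ⟨⟨rfl, rfl⟩, rfl, rfl⟩ := h
  rfl

theorem Triple.IsCondition.extends_refl {p : Triple.{u}} (hp : p.IsCondition π Y Γ) :
    p.Extends p := by
  refine ⟨⟨fun _ h => h, fun _ _ _ _ => Iff.rfl⟩, fun _ h => h, fun a ha => ?_⟩
  obtain ⟨x, hx, -⟩ := hp.func.2 a ha
  exact ⟨a, ha, Or.inl rfl, x, hx, hx⟩

theorem Triple.Extends.trans {p q r : Triple.{u}} (hq : q.IsCondition π Y Γ)
    (hr : r.IsCondition π Y Γ) (hrq : r.Extends q) (hqp : q.Extends p) : r.Extends p := by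
  have hnode : ∀ a b, q.T.Lt a b → a ∈ q.T.nodes ∧ b ∈ q.T.nodes := fun a b h =>
    ZFSet.pair_mem_prod.1 (hq.tree.rel_subset h)
  refine ⟨⟨fun _ h => hrq.endExtends.1 (hqp.endExtends.1 h), fun a ha b hb => ?_⟩,
    fun _ h => hrq.subset (hqp.subset h), fun a ha => ?_⟩
  · rw [hrq.endExtends.2 a (hqp.endExtends.1 ha) b (hqp.endExtends.1 hb),
      hqp.endExtends.2 a ha b hb]
  · obtain ⟨b, hb, hab, x, hax, hbx⟩ := hqp.maximal a ha
    obtain ⟨c, hc, hbc, y, hby, hcy⟩ := hrq.maximal b hb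
    obtain ⟨z, -, hz⟩ := hq.func.2 b hb
    obtain rfl : x = y := (hz x hbx).trans (hz y hby).symm
    refine ⟨c, hc, ?_, x, hax, hcy⟩
    have hab' : r.T.Le a b := hab.imp id fun h =>
      (hrq.endExtends.2 a (hnode a b h).1 b (hnode a b h).2).2 h
    rcases hab' with rfl | h1
    · exact hbc
    · rcases hbc with rfl | h2
      · exact Or.inr h1
      · exact Or.inr (hr.tree.trans a b c h1 h2)

/-- The forcing poset of all conditions `(T, F, A)`. -/
def kurepaPoset : ForcingPoset.{u} where
  carrier := {x | ∃ p : Triple.{u}, p.IsCondition π Y Γ ∧ x = p.toSet}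
  le := fun x y => ∃ q p : Triple.{u}, x = q.toSet ∧ y = p.toSet ∧ q.Extends p
  le_refl := by
    rintro _ ⟨p, hp, rfl⟩
    exact ⟨p, p, rfl, rfl, hp.extends_refl⟩
  le_trans := by
    rintro _ ⟨p, hp, rfl⟩ _ ⟨q, hq, rfl⟩ _ ⟨r, hr, rfl⟩ ⟨r', q', h1, h2, h3⟩ ⟨q'', p', h4, h5, h6⟩
    obtain rfl := Triple.toSet_injective h1
    obtain rfl := Triple.toSet_injective h2
    obtain rfl := Triple.toSet_injective h4
    obtain rfl := Triple.toSet_injective h5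
    exact ⟨r, p, rfl, rfl, h3.trans π Y Γ hq hr h6⟩

end AdequateForcing

namespace AdequateForcing

/-! ### Hereditarily small sets -/

/-! Let `K` be a countable elementary submodel whose trace `N` on `ω₂` lies in `𝒳` and for which
`Sk(N) = K ∩ H(ω₂)`. Every condition that has `N` among its models is strongly `K`-generic, and `N`
can be added to any condition in `K`. Such `K` meet every club: since `𝒴` is stationary, a countable
set closed under countably many relations can be chosen with trace in `𝒴` (`exists_isWitnessed`,
`exists_isSuitable`).

For genericity, let `r` have `N` as a model and let `D` be dense in `K ∩ ℙ`. New tops move the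
maximal nodes of `r` out of `N`. The pattern of `r` over `N` is finite: the tree, the nodes and
values in `N`, the models below `N` and their traces on `N`. Its parameters lie in `K`, so `K`
contains a condition `s` with the same pattern (`exists_reflects`). Take `w ∈ D` below `s`; it
remains to amalgamate `r` and `w`.

The models are handled by `isAdequate_union`. By thinness, a trace `M ∩ β` with `β ∈ Λ` already
belongs to `Sk(β)` (`inter_mem_Sk_toZFSet`), and a set lying in the hulls of two closed sets lies in
the hull of their intersection (`mem_Sk_inter`). Hence membership in hulls survives truncation at
points of `Γ`.

In the tree, `w` keeps its order inside `N`, and the part of `r` outside `N` is placed on top, so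
that branches of `r` and `w` with the same value are joined. Clause (4) for the model `N` says that
at most one branch of `r` through a given node outside `N` has its value in `N`; this makes the
result a tree (`eq_of_val_mem`, `anchor_le`). Clause (4) for the amalgamation is pulled back to `w`:
a model `M` is replaced by a model of `w`, and branches with values in `M` by distinct branches of
`w` (`exists_standsFor`, `branchFor_ne`, `not_lt_common`). The only models without a replacement
contain every countable ordinal of `N`, and for them nodes in `N` cause no trouble. -/

theorem isRegular_aleph_two : (ℵ_ 2 : Cardinal.{u}).IsRegular := by
  have := isRegular_aleph_add_one (1 : Ordinal.{u})
  rwa [one_add_one_eq_two] at this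

theorem lt_omega_two_iff {α : Ordinal.{u}} : α < ω_ 2 ↔ α.card < ℵ_ 2 := by
  rw [← ord_aleph, lt_ord]

theorem lt_omega_one_iff {α : Ordinal.{u}} : α < ω_ 1 ↔ α.card ≤ ℵ₀ := by
  rw [← ord_aleph, lt_ord, ← Order.lt_succ_iff, succ_aleph0]

theorem mem_H_of_mem {κ : Cardinal.{u}} {x y : ZFSet.{u}} (hx : x ∈ H κ) (hy : y ∈ x) :
    y ∈ H κ := by
  obtain ⟨t, ht, hxt, hc⟩ := hx
  exact ⟨t, ht, ht y (hxt hy), hc⟩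

theorem H_mono {κ θ : Cardinal.{u}} (h : κ ≤ θ) : H κ ⊆ H θ := by
  rintro x ⟨t, ht, hxt, hc⟩
  exact ⟨t, ht, hxt, hc.trans_le h⟩

/-- The union of `x` with transitive sets chosen around its elements is transitive, and regularity
of `κ` keeps it small. -/
theorem mem_H_of_forall_mem {κ : Cardinal.{u}} (hκ : κ.IsRegular) {x : ZFSet.{u}}
    (hx : ∀ y ∈ x, y ∈ H κ) (hc : x.card < κ) : x ∈ H κ := by
  choose! t ht hxt htc using hx
  let f : Shrink.{u} x → ZFSet.{u} := fun i => t ((equivShrink x).symm i : ZFSet.{u})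
  have hf : ∀ i, ((equivShrink x).symm i : ZFSet.{u}) ∈ x := fun i => ((equivShrink x).symm i).2
  refine ⟨x ∪ ZFSet.iUnion f, ?_, fun y hy => ZFSet.mem_union.2 (Or.inl hy), ?_⟩
  · intro y hy z hz
    rw [ZFSet.mem_union, ZFSet.mem_iUnion] at hy ⊢
    right
    rcases hy with hy | ⟨i, hi⟩
    · refine ⟨equivShrink x ⟨y, hy⟩, ?_⟩
      simpa [f] using hxt y hy hz
    · exact ⟨i, ht _ (hf i) y hi hz⟩
  · refine ZFSet.card_union_le.trans_lt (add_lt_of_lt hκ.aleph0_le hc ?_)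
    have h1 := ZFSet.lift_card_iUnion_le_sum_card (f := f)
    rw [Cardinal.lift_id] at h1
    exact h1.trans_lt (sum_lt_of_isRegular hκ hc fun i => htc _ (hf i))

theorem card_le_aleph0_of_countable {x : ZFSet.{u}} (hx : (x : Set ZFSet.{u}).Countable) :
    x.card ≤ ℵ₀ := by
  have : #(x : Set ZFSet.{u}) ≤ ℵ₀ := mk_le_aleph0_iff.2 hx.to_subtype
  have h2 := ZFSet.cardinalMk_coe_sort (x := x)
  rw [← Cardinal.lift_le.{u + 1}, ← h2, lift_aleph0]
  exact this

theorem countable_of_card_le_aleph0 {x : ZFSet.{u}} (hx : x.card ≤ ℵ₀) :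
    (x : Set ZFSet.{u}).Countable := by
  have h2 := ZFSet.cardinalMk_coe_sort (x := x)
  rw [← Cardinal.lift_le.{u + 1}, ← h2, lift_aleph0] at hx
  exact mk_le_aleph0_iff.1 hx

theorem aleph0_lt_aleph_two : (ℵ₀ : Cardinal.{u}) < ℵ_ 2 := by
  rw [← aleph_zero]; exact aleph_lt_aleph.2 (by norm_num)

theorem aleph_one_lt_aleph_two : (ℵ₁ : Cardinal.{u}) < ℵ_ 2 :=
  aleph_lt_aleph.2 (by norm_num)

theorem omega_one_lt_omega_two : (ω_ 1 : Ordinal.{u}) < ω_ 2 :=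
  omega_lt_omega.2 (by norm_num)

theorem toZFSet_mem_H {α : Ordinal.{u}} (hα : α < ω_ 2) : α.toZFSet ∈ H (ℵ_ 2) :=
  ⟨α.toZFSet, (ZFSet.isOrdinal_toZFSet α).isTransitive, fun _ h => h, by
    rw [card_toZFSet]; exact lt_omega_two_iff.1 hα⟩

theorem mem_H_of_mem_omega_two {x : ZFSet.{u}} (hx : x ∈ (ω_ 2 : Ordinal.{u}).toZFSet) :
    x ∈ H (ℵ_ 2) := by
  obtain ⟨α, hα, rfl⟩ := mem_toZFSet_iff.1 hx
  exact toZFSet_mem_H hα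

theorem mem_H_of_countable {x : ZFSet.{u}} (hx : ∀ y ∈ x, y ∈ H (ℵ_ 2))
    (hc : (x : Set ZFSet.{u}).Countable) : x ∈ H (ℵ_ 2) :=
  mem_H_of_forall_mem isRegular_aleph_two hx
    ((card_le_aleph0_of_countable hc).trans_lt aleph0_lt_aleph_two)

theorem singleton_mem_H {x : ZFSet.{u}} (hx : x ∈ H (ℵ_ 2)) : ({x} : ZFSet.{u}) ∈ H (ℵ_ 2) :=
  mem_H_of_countable (by simpa using hx) (by simp)

theorem upair_mem_H {x y : ZFSet.{u}} (hx : x ∈ H (ℵ_ 2)) (hy : y ∈ H (ℵ_ 2)) :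
    ({x, y} : ZFSet.{u}) ∈ H (ℵ_ 2) :=
  mem_H_of_countable (by
    intro z hz
    rcases ZFSet.mem_pair.1 hz with rfl | rfl <;> assumption) (by simp)

theorem pair_mem_H {x y : ZFSet.{u}} (hx : x ∈ H (ℵ_ 2)) (hy : y ∈ H (ℵ_ 2)) :
    ZFSet.pair x y ∈ H (ℵ_ 2) :=
  upair_mem_H (singleton_mem_H hx) (upair_mem_H hx hy)

end AdequateForcing

namespace AdequateForcing

/-! ### Definability in `(H(ω₂), ∈, π, 𝒴)` -/

/-- A map selecting one of the variables. -/
def IsVar {n : ℕ} (t : (Fin n → ↥(H.{u} (ℵ_ 2))) → ↥(H.{u} (ℵ_ 2))) : Prop :=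
  ∃ i, ∀ v, t v = v i

theorem IsVar.apply {n : ℕ} (i : Fin n) :
    IsVar (fun v : Fin n → ↥(H.{u} (ℵ_ 2)) => v i) := ⟨i, fun _ => rfl⟩

/-- A variable of the outer context remains a variable under one more quantifier, where the old
valuation is `Fin.init w`. -/
theorem IsVar.init {n : ℕ} {t : (Fin n → ↥(H.{u} (ℵ_ 2))) → ↥(H.{u} (ℵ_ 2))} (ht : IsVar t) :
    IsVar (fun w : Fin (n + 1) → ↥(H.{u} (ℵ_ 2)) => t (Fin.init w)) := by
  obtain ⟨i, hi⟩ := ht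
  exact ⟨i.castSucc, fun w => hi _⟩

section
variable (π : Ordinal.{u} → ZFSet.{u}) (Y : Set ZFSet.{u})

/-- The relation `R` is definable without parameters in `(H(ω₂), ∈, π, 𝒴)`. -/
def IsDef {n : ℕ} (R : (Fin n → ↥(H.{u} (ℵ_ 2))) → Prop) : Prop :=
  letI := structureA π Y
  ∃ φ : langA.BoundedFormula Empty n, ∀ v, φ.Realize default v ↔ R v

end

variable {π : Ordinal.{u} → ZFSet.{u}} {Y : Set ZFSet.{u}}

namespace IsDef

variable {n : ℕ} {R S : (Fin n → ↥(H.{u} (ℵ_ 2))) → Prop}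
  {s t a b : (Fin n → ↥(H.{u} (ℵ_ 2))) → ↥(H.{u} (ℵ_ 2))}

theorem congr (hR : IsDef π Y R) (h : ∀ v, R v ↔ S v) : IsDef π Y S := by
  obtain ⟨φ, hφ⟩ := hR
  exact ⟨φ, fun v => (hφ v).trans (h v)⟩

theorem mem (hs : IsVar s) (ht : IsVar t) :
    IsDef π Y fun v => (s v : ZFSet.{u}) ∈ (t v : ZFSet.{u}) := by
  obtain ⟨i, hi⟩ := hs
  obtain ⟨j, hj⟩ := ht
  let _ := structureA π Y
  refine ⟨FirstOrder.Language.Relations.boundedFormula (L := langA) (n := 2) ARel.mem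
    ![.var (Sum.inr i), .var (Sum.inr j)], fun v => ?_⟩
  simp only [hi, hj]
  exact Iff.rfl

theorem eq (hs : IsVar s) (ht : IsVar t) :
    IsDef π Y fun v => (s v : ZFSet.{u}) = (t v : ZFSet.{u}) := by
  obtain ⟨i, hi⟩ := hs
  obtain ⟨j, hj⟩ := ht
  let _ := structureA π Y
  refine ⟨FirstOrder.Language.Term.bdEqual (L := langA) (.var (Sum.inr i)) (.var (Sum.inr j)),
    fun v => ?_⟩
  simp only [hi, hj]
  rw [FirstOrder.Language.BoundedFormula.realize_bdEqual]
  exact Subtype.ext_iff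

theorem graph (hs : IsVar s) (ht : IsVar t) :
    IsDef π Y fun v => ∃ α < ω_ 2, (s v : ZFSet.{u}) = α.toZFSet ∧ (t v : ZFSet.{u}) = π α := by
  obtain ⟨i, hi⟩ := hs
  obtain ⟨j, hj⟩ := ht
  let _ := structureA π Y
  refine ⟨FirstOrder.Language.Relations.boundedFormula (L := langA) (n := 2) ARel.graph
    ![.var (Sum.inr i), .var (Sum.inr j)], fun v => ?_⟩
  simp only [hi, hj]
  exact Iff.rfl

theorem inY (hs : IsVar s) : IsDef π Y fun v => (s v : ZFSet.{u}) ∈ Y := by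
  obtain ⟨i, hi⟩ := hs
  let _ := structureA π Y
  refine ⟨FirstOrder.Language.Relations.boundedFormula (L := langA) (n := 1) ARel.inY
    ![.var (Sum.inr i)], fun v => ?_⟩
  simp only [hi]
  exact Iff.rfl

theorem not (hR : IsDef π Y R) : IsDef π Y fun v => ¬ R v := by
  obtain ⟨φ, hφ⟩ := hR
  let _ := structureA π Y
  exact ⟨φ.not, fun v => by rw [FirstOrder.Language.BoundedFormula.realize_not, hφ]⟩

theorem imp (hR : IsDef π Y R) (hS : IsDef π Y S) : IsDef π Y fun v => R v → S v := by
  obtain ⟨φ, hφ⟩ := hR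
  obtain ⟨ψ, hψ⟩ := hS
  let _ := structureA π Y
  exact ⟨φ.imp ψ, fun v => by rw [FirstOrder.Language.BoundedFormula.realize_imp, hφ, hψ]⟩

theorem and (hR : IsDef π Y R) (hS : IsDef π Y S) : IsDef π Y fun v => R v ∧ S v :=
  (hR.imp hS.not).not.congr fun v => by tauto

theorem or (hR : IsDef π Y R) (hS : IsDef π Y S) : IsDef π Y fun v => R v ∨ S v :=
  (hR.not.imp hS).congr fun v => by tauto

theorem iff (hR : IsDef π Y R) (hS : IsDef π Y S) : IsDef π Y fun v => (R v ↔ S v) :=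
  ((hR.imp hS).and (hS.imp hR)).congr fun v => by tauto

theorem all {R : (Fin n → ↥(H.{u} (ℵ_ 2))) → ↥(H.{u} (ℵ_ 2)) → Prop}
    (hR : IsDef π Y fun w : Fin (n + 1) → ↥(H.{u} (ℵ_ 2)) => R (Fin.init w) (w (Fin.last n))) :
    IsDef π Y fun v => ∀ x, R v x := by
  obtain ⟨φ, hφ⟩ := hR
  let _ := structureA π Y
  refine ⟨φ.all, fun v => ?_⟩
  rw [FirstOrder.Language.BoundedFormula.realize_all]
  refine forall_congr' fun x => ?_
  rw [hφ]
  simp only [Fin.init_snoc, Fin.snoc_last]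

theorem ex {R : (Fin n → ↥(H.{u} (ℵ_ 2))) → ↥(H.{u} (ℵ_ 2)) → Prop}
    (hR : IsDef π Y fun w : Fin (n + 1) → ↥(H.{u} (ℵ_ 2)) => R (Fin.init w) (w (Fin.last n))) :
    IsDef π Y fun v => ∃ x, R v x :=
  (IsDef.all (R := fun v x => ¬ R v x) hR.not).not.congr fun v => by simp

end IsDef

/-- Extensionality for elements of `H(ω₂)`, with quantifiers restricted to `H(ω₂)`. -/
theorem ext_H {x : ↥(H.{u} (ℵ_ 2))} {y : ZFSet.{u}} (hy : ∀ z ∈ y, z ∈ H (ℵ_ 2)) :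
    (∀ t : ↥(H.{u} (ℵ_ 2)), (t : ZFSet.{u}) ∈ (x : ZFSet.{u}) ↔ (t : ZFSet.{u}) ∈ y) ↔
      (x : ZFSet.{u}) = y := by
  refine ⟨fun h => ZFSet.ext fun z => ⟨fun hz => ?_, fun hz => ?_⟩, fun h t => by rw [h]⟩
  · exact (h ⟨z, mem_H_of_mem x.2 hz⟩).1 hz
  · exact (h ⟨z, hy z hz⟩).2 hz

namespace IsDef

variable {n : ℕ} {s t a b f k : (Fin n → ↥(H.{u} (ℵ_ 2))) → ↥(H.{u} (ℵ_ 2))}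

/-- The language has no function symbols, so set operations are expressed by their graphs, spelled
out by extensionality. Transitivity of `H(ω₂)` makes the bounded quantifiers harmless. -/
theorem singleton (hs : IsVar s) (ha : IsVar a) :
    IsDef π Y fun v => (s v : ZFSet.{u}) = {(a v : ZFSet.{u})} :=
  (IsDef.all (R := fun v t => (t : ZFSet.{u}) ∈ (s v : ZFSet.{u}) ↔ (t : ZFSet.{u}) = a v)
    ((mem (.apply _) hs.init).iff (eq (.apply _) ha.init))).congr fun v => by
      rw [← ext_H (by simp)]
      simp

theorem upair (hs : IsVar s) (ha : IsVar a) (hb : IsVar b) :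
    IsDef π Y fun v => (s v : ZFSet.{u}) = {(a v : ZFSet.{u}), (b v : ZFSet.{u})} :=
  (IsDef.all (R := fun v t => (t : ZFSet.{u}) ∈ (s v : ZFSet.{u}) ↔
      ((t : ZFSet.{u}) = a v ∨ (t : ZFSet.{u}) = b v))
    ((mem (.apply _) hs.init).iff ((eq (.apply _) ha.init).or (eq (.apply _) hb.init)))).congr
    fun v => by
      rw [← ext_H (fun z hz => mem_H_of_mem (upair_mem_H (a v).2 (b v).2) hz)]
      simp

theorem pair (hs : IsVar s) (ha : IsVar a) (hb : IsVar b) :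
    IsDef π Y fun v => (s v : ZFSet.{u}) = ZFSet.pair (a v) (b v) :=
  (IsDef.all (R := fun v t => (t : ZFSet.{u}) ∈ (s v : ZFSet.{u}) ↔
      ((t : ZFSet.{u}) = {(a v : ZFSet.{u})} ∨
        (t : ZFSet.{u}) = {(a v : ZFSet.{u}), (b v : ZFSet.{u})}))
    ((mem (.apply _) hs.init).iff ((singleton (.apply _) ha.init).or
      (upair (.apply _) ha.init hb.init)))).congr
    fun v => by
      rw [← ext_H (fun z hz => mem_H_of_mem (pair_mem_H (a v).2 (b v).2) hz)]
      simp [ZFSet.pair]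

theorem pair_mem (hf : IsVar f) (ha : IsVar a) (hb : IsVar b) :
    IsDef π Y fun v => ZFSet.pair (a v) (b v) ∈ (f v : ZFSet.{u}) :=
  (IsDef.ex (R := fun v p => (p : ZFSet.{u}) = ZFSet.pair (a v) (b v) ∧
    (p : ZFSet.{u}) ∈ (f v : ZFSet.{u}))
    ((pair (.apply _) ha.init hb.init).and (mem (.apply _) hf.init))).congr fun v => by
      constructor
      · rintro ⟨p, h1, h2⟩
        rwa [← h1]
      · exact fun h => ⟨⟨_, mem_H_of_mem (f v).2 h⟩, rfl, h⟩

end IsDef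

/-- `f` maps a subset of `k` onto a superset of `a`. -/
def IsSurj (f k a : ZFSet.{u}) : Prop :=
  (∀ z ∈ a, ∃ i ∈ k, ZFSet.pair i z ∈ f) ∧
    ∀ i z z', ZFSet.pair i z ∈ f → ZFSet.pair i z' ∈ f → z = z'

theorem fst_mem_H {f i z : ZFSet.{u}} (hf : f ∈ H (ℵ_ 2)) (h : ZFSet.pair i z ∈ f) :
    i ∈ H (ℵ_ 2) ∧ z ∈ H (ℵ_ 2) := by
  have h1 := mem_H_of_mem hf h
  have h2 : ({i, z} : ZFSet.{u}) ∈ H (ℵ_ 2) := mem_H_of_mem h1 (by simp [ZFSet.pair])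
  exact ⟨mem_H_of_mem h2 (by simp), mem_H_of_mem h2 (by simp)⟩

theorem IsDef.isSurj {n : ℕ} {f k a : (Fin n → ↥(H.{u} (ℵ_ 2))) → ↥(H.{u} (ℵ_ 2))}
    (hf : IsVar f) (hk : IsVar k) (ha : IsVar a) : IsDef π Y fun v => IsSurj (f v) (k v) (a v) := by
  have h1 : IsDef π Y fun v => ∀ z : ↥(H.{u} (ℵ_ 2)), (z : ZFSet.{u}) ∈ (a v : ZFSet.{u}) →
      ∃ i : ↥(H.{u} (ℵ_ 2)), (i : ZFSet.{u}) ∈ (k v : ZFSet.{u}) ∧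
        ZFSet.pair i z ∈ (f v : ZFSet.{u}) :=
    IsDef.all ((IsDef.mem (.apply _) ha.init).imp (IsDef.ex
      (R := fun w i => (i : ZFSet.{u}) ∈ (k (Fin.init w) : ZFSet.{u}) ∧
        ZFSet.pair i (w (Fin.last n)) ∈ (f (Fin.init w) : ZFSet.{u}))
      ((IsDef.mem (.apply _) hk.init.init).and
        (IsDef.pair_mem hf.init.init (.apply _) (IsVar.apply _).init))))
  have h2 : IsDef π Y fun v => ∀ i z z' : ↥(H.{u} (ℵ_ 2)), ZFSet.pair i z ∈ (f v : ZFSet.{u}) →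
      ZFSet.pair i z' ∈ (f v : ZFSet.{u}) → (z : ZFSet.{u}) = z' :=
    IsDef.all (IsDef.all (R := fun w z => ∀ z' : ↥(H.{u} (ℵ_ 2)),
      ZFSet.pair (w (Fin.last n)) z ∈ (f (Fin.init w) : ZFSet.{u}) →
      ZFSet.pair (w (Fin.last n)) z' ∈ (f (Fin.init w) : ZFSet.{u}) → (z : ZFSet.{u}) = z')
      (IsDef.all (R := fun w z' =>
      ZFSet.pair (Fin.init w (Fin.last n)) (w (Fin.last _)) ∈ (f (Fin.init (Fin.init w)) : ZFSet.{u}) →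
      ZFSet.pair (Fin.init w (Fin.last n)) z' ∈ (f (Fin.init (Fin.init w)) : ZFSet.{u}) →
        ((w (Fin.last _) : ↥(H.{u} (ℵ_ 2))) : ZFSet.{u}) = z')
      ((IsDef.pair_mem hf.init.init.init (IsVar.apply _).init.init (IsVar.apply _).init).imp
        ((IsDef.pair_mem hf.init.init.init (IsVar.apply _).init.init (IsVar.apply _)).imp
        (IsDef.eq (IsVar.apply _).init (IsVar.apply _))))))
  refine (h1.and h2).congr fun v => and_congr ?_ ?_
  · constructor
    · intro h z hz
      obtain ⟨i, hi, hp⟩ := h ⟨z, mem_H_of_mem (a v).2 hz⟩ hz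
      exact ⟨i, hi, hp⟩
    · intro h z hz
      obtain ⟨i, hi, hp⟩ := h z hz
      exact ⟨⟨i, mem_H_of_mem (k v).2 hi⟩, hi, hp⟩
  · constructor
    · intro h i z z' hz hz'
      have h3 := fst_mem_H (f v).2 hz
      have h4 := fst_mem_H (f v).2 hz'
      exact h ⟨i, h3.1⟩ ⟨z, h3.2⟩ ⟨z', h4.2⟩ hz hz'
    · intro h i z z' hz hz'
      exact h i z z' hz hz'

end AdequateForcing

namespace AdequateForcing

variable {π : Ordinal.{u} → ZFSet.{u}} {Y : Set ZFSet.{u}} {Γ : Set Ordinal.{u}}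

/-! ### Skolem hulls -/

theorem mem_H_of_subset {κ : Cardinal.{u}} {x y : ZFSet.{u}} (hy : y ∈ H κ) (h : x ⊆ y) :
    x ∈ H κ := by
  obtain ⟨t, ht, hyt, hc⟩ := hy
  exact ⟨t, ht, fun _ hz => hyt (h hz), hc⟩

theorem Sk_mono {a b : ZFSet.{u}} (h : a ⊆ b) : Sk π Y a ⊆ Sk π Y b := by
  intro x hx
  induction hx with
  | base x hx => exact .base x (h hx)
  | step n φ v hv ih => exact MemSk.step n φ v ih

theorem subset_Sk {a x : ZFSet.{u}} (hx : x ∈ a) : x ∈ Sk π Y a := .base x hx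

theorem skolemFun_mem_H (hπ : Set.BijOn π (Set.Iio (ω_ 2)) (H (ℵ_ 2))) {n : ℕ}
    (φ : langA.BoundedFormula Empty (n + 1)) (v : Fin n → ↥(H.{u} (ℵ_ 2))) :
    skolemFun π Y φ v ∈ H (ℵ_ 2) := by
  apply hπ.mapsTo
  rw [Set.mem_Iio]
  -- If there is no witness the infimum is `0`, and the value is the default `π 0`.
  rcases Set.eq_empty_or_nonempty {α | α < ω_ 2 ∧ ∃ x : ↥(H.{u} (ℵ_ 2)),
    (x : ZFSet.{u}) = π α ∧ Sat π Y φ v x} with h | h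
  · rw [h, Ordinal.sInf_empty]
    exact omega_pos 2
  · exact (csInf_mem h).1

theorem mem_H_of_mem_Sk (hπ : Set.BijOn π (Set.Iio (ω_ 2)) (H (ℵ_ 2))) {a x : ZFSet.{u}}
    (ha : ∀ y ∈ a, y ∈ H (ℵ_ 2)) (hx : x ∈ Sk π Y a) : x ∈ H (ℵ_ 2) := by
  induction hx with
  | base x hx => exact ha x hx
  | step n φ v hv ih => exact skolemFun_mem_H hπ φ v

/-- A Skolem hull contains a witness for every definable relation with parameters in it. -/
theorem exists_mem_Sk (hπ : Set.BijOn π (Set.Iio (ω_ 2)) (H (ℵ_ 2))) {n : ℕ}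
    {R : (Fin n → ↥(H.{u} (ℵ_ 2))) → ↥(H.{u} (ℵ_ 2)) → Prop}
    (hR : IsDef π Y fun w : Fin (n + 1) → ↥(H.{u} (ℵ_ 2)) => R (Fin.init w) (w (Fin.last n)))
    {c : ZFSet.{u}} {v : Fin n → ↥(H.{u} (ℵ_ 2))} (hv : ∀ i, (v i : ZFSet.{u}) ∈ Sk π Y c)
    (hex : ∃ x, R v x) : ∃ x : ↥(H.{u} (ℵ_ 2)), (x : ZFSet.{u}) ∈ Sk π Y c ∧ R v x := by
  obtain ⟨φ, hφ⟩ := hR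
  obtain ⟨x, hx⟩ := hex
  have hsat : ∀ x, Sat π Y φ v x ↔ R v x := fun x => by
    refine (hφ _).trans ?_
    simp only [Fin.init_snoc, Fin.snoc_last]
  obtain ⟨α, hα, hαx⟩ := hπ.surjOn x.2
  have hne : {α | α < ω_ 2 ∧ ∃ x : ↥(H.{u} (ℵ_ 2)),
      (x : ZFSet.{u}) = π α ∧ Sat π Y φ v x}.Nonempty :=
    ⟨α, hα, x, hαx.symm, (hsat x).2 hx⟩
  obtain ⟨-, y, hy, hyR⟩ := csInf_mem hne
  refine ⟨y, ?_, (hsat y).1 hyR⟩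
  rw [hy]
  exact MemSk.step n φ v hv

/-- An object that is the unique solution of a formula with parameters in a hull is in the hull,
because the Skolem witness must be that object. The closure lemmas that follow use the same
argument. -/
theorem inter_mem_Sk (hπ : Set.BijOn π (Set.Iio (ω_ 2)) (H (ℵ_ 2))) {c a b : ZFSet.{u}}
    (haH : a ∈ H (ℵ_ 2)) (hbH : b ∈ H (ℵ_ 2)) (ha : a ∈ Sk π Y c) (hb : b ∈ Sk π Y c) :
    a ∩ b ∈ Sk π Y c := by
  have hsub : a ∩ b ⊆ a := fun z hz => (ZFSet.mem_inter.1 hz).1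
  obtain ⟨x, hx, hxR⟩ := exists_mem_Sk (Y := Y) hπ (n := 2) (v := ![⟨a, haH⟩, ⟨b, hbH⟩]) (c := c)
    (R := fun v x => ∀ t : ↥(H.{u} (ℵ_ 2)), (t : ZFSet.{u}) ∈ (x : ZFSet.{u}) ↔
      ((t : ZFSet.{u}) ∈ (v 0 : ZFSet.{u}) ∧ (t : ZFSet.{u}) ∈ (v 1 : ZFSet.{u})))
    (IsDef.all (R := fun (w : Fin 3 → _) (t : ↥(H.{u} (ℵ_ 2))) =>
      (t : ZFSet.{u}) ∈ (w (Fin.last 2) : ZFSet.{u}) ↔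
      ((t : ZFSet.{u}) ∈ (Fin.init w 0 : ZFSet.{u}) ∧
        (t : ZFSet.{u}) ∈ (Fin.init w 1 : ZFSet.{u})))
      ((IsDef.mem (.apply _) (IsVar.apply _).init).iff
        ((IsDef.mem (.apply _) (IsVar.apply (0 : Fin 2)).init.init).and
          (IsDef.mem (.apply _) (IsVar.apply (1 : Fin 2)).init.init))))
    (by intro i; fin_cases i <;> assumption)
    ⟨⟨a ∩ b, mem_H_of_subset haH hsub⟩, fun t => by simp⟩
  have : (x : ZFSet.{u}) = a ∩ b := by
    rw [← ext_H fun z hz => mem_H_of_mem haH (hsub hz)]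
    intro t
    simpa using hxR t
  rwa [← this]

/-- The graph of `π` is a predicate of the structure, so hulls are closed under `π` and, by
injectivity, under its inverse. A hull is therefore determined by its ordinals below `ω₂`. -/
theorem pi_mem_Sk (hπ : Set.BijOn π (Set.Iio (ω_ 2)) (H (ℵ_ 2))) {c : ZFSet.{u}} {α : Ordinal.{u}}
    (hα : α < ω_ 2) (h : α.toZFSet ∈ Sk π Y c) : π α ∈ Sk π Y c := by
  obtain ⟨x, hx, β, hβ, h1, h2⟩ := exists_mem_Sk (Y := Y) hπ (n := 1)
    (v := ![⟨α.toZFSet, toZFSet_mem_H hα⟩]) (c := c)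
    (R := fun v x => ∃ β < ω_ 2, (v 0 : ZFSet.{u}) = β.toZFSet ∧ (x : ZFSet.{u}) = π β)
    (IsDef.graph (IsVar.apply (0 : Fin 1)).init (.apply _))
    (by intro i; fin_cases i; assumption)
    ⟨⟨π α, hπ.mapsTo hα⟩, α, hα, rfl, rfl⟩
  obtain rfl : α = β := toZFSet_injective h1
  rwa [← h2]

theorem toZFSet_mem_Sk (hπ : Set.BijOn π (Set.Iio (ω_ 2)) (H (ℵ_ 2))) {c : ZFSet.{u}}
    {α : Ordinal.{u}} (hα : α < ω_ 2) (h : π α ∈ Sk π Y c) : α.toZFSet ∈ Sk π Y c := by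
  obtain ⟨x, hx, β, hβ, h1, h2⟩ := exists_mem_Sk (Y := Y) hπ (n := 1)
    (v := ![⟨π α, hπ.mapsTo hα⟩]) (c := c)
    (R := fun v x => ∃ β < ω_ 2, (x : ZFSet.{u}) = β.toZFSet ∧ (v 0 : ZFSet.{u}) = π β)
    (IsDef.graph (.apply _) (IsVar.apply (0 : Fin 1)).init)
    (by intro i; fin_cases i; assumption)
    ⟨⟨α.toZFSet, toZFSet_mem_H hα⟩, α, hα, rfl, rfl⟩
  obtain rfl : α = β := hπ.injOn hα hβ h2
  rwa [← h1]

theorem add_one_lt_omega_two {α : Ordinal.{u}} (hα : α < ω_ 2) : α + 1 < ω_ 2 :=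
  (isSuccLimit_omega 2).add_one_lt hα

theorem add_one_mem_Sk (hπ : Set.BijOn π (Set.Iio (ω_ 2)) (H (ℵ_ 2))) {c : ZFSet.{u}}
    {α : Ordinal.{u}} (hα : α < ω_ 2) (h : α.toZFSet ∈ Sk π Y c) :
    (α + 1).toZFSet ∈ Sk π Y c := by
  have hn := toZFSet_mem_H hα
  have hn' := toZFSet_mem_H (add_one_lt_omega_two hα)
  obtain ⟨x, hx, hxR⟩ := exists_mem_Sk (Y := Y) hπ (n := 1) (v := ![⟨_, hn⟩]) (c := c)
    (R := fun v x => ∀ t : ↥(H.{u} (ℵ_ 2)), (t : ZFSet.{u}) ∈ (x : ZFSet.{u}) ↔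
      ((t : ZFSet.{u}) = (v 0 : ZFSet.{u}) ∨ (t : ZFSet.{u}) ∈ (v 0 : ZFSet.{u})))
    (IsDef.all (R := fun (w : Fin 2 → _) (t : ↥(H.{u} (ℵ_ 2))) =>
      (t : ZFSet.{u}) ∈ (w (Fin.last 1) : ZFSet.{u}) ↔
      ((t : ZFSet.{u}) = (Fin.init w 0 : ZFSet.{u}) ∨
        (t : ZFSet.{u}) ∈ (Fin.init w 0 : ZFSet.{u})))
      ((IsDef.mem (.apply _) (IsVar.apply _).init).iff
        ((IsDef.eq (.apply _) (IsVar.apply (0 : Fin 1)).init.init).or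
          (IsDef.mem (.apply _) (IsVar.apply (0 : Fin 1)).init.init))))
    (by intro i; fin_cases i; assumption)
    ⟨⟨(α + 1).toZFSet, hn'⟩, fun t => by
        change (t : ZFSet.{u}) ∈ (α + 1).toZFSet ↔ _
        rw [toZFSet_add_one]
        exact ZFSet.mem_insert_iff⟩
  have : (x : ZFSet.{u}) = (α + 1).toZFSet := by
    rw [← ext_H (fun z hz => mem_H_of_mem hn' hz)]
    intro t
    rw [toZFSet_add_one, ZFSet.mem_insert_iff]
    exact hxR t
  rw [← this]
  exact hx

theorem nat_mem_Sk (hπ : Set.BijOn π (Set.Iio (ω_ 2)) (H (ℵ_ 2))) (c : ZFSet.{u}) (n : ℕ) :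
    (n : Ordinal.{u}).toZFSet ∈ Sk π Y c := by
  have hlt : ∀ n : ℕ, (n : Ordinal.{u}) < ω_ 2 := fun n =>
    (natCast_lt_omega0 n).trans_le (omega0_le_omega 2)
  induction n with
  | zero =>
    obtain ⟨x, hx, hxR⟩ := exists_mem_Sk (Y := Y) hπ (n := 0) (v := ![]) (c := c)
      (R := fun v x => ∀ t : ↥(H.{u} (ℵ_ 2)), ¬ (t : ZFSet.{u}) ∈ (x : ZFSet.{u}))
      (IsDef.all (R := fun (w : Fin 1 → _) (t : ↥(H.{u} (ℵ_ 2))) =>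
        ¬ (t : ZFSet.{u}) ∈ (w (Fin.last 0) : ZFSet.{u}))
        (IsDef.mem (.apply _) (IsVar.apply _).init).not)
      (by intro i; exact i.elim0)
      ⟨⟨(0 : Ordinal.{u}).toZFSet, toZFSet_mem_H (omega_pos 2)⟩, fun t => by simp⟩
    have : (x : ZFSet.{u}) = (0 : Ordinal.{u}).toZFSet := by
      rw [← ext_H (by simp)]
      intro t
      simpa using hxR t
    rw [Nat.cast_zero, ← this]
    exact hx
  | succ n ih =>
    rw [Nat.cast_succ]
    exact add_one_mem_Sk hπ (hlt n) ih

/-- A bijection from the initial ordinal of size `|a|`, coded as a set of pairs, has at most `ω₁`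
elements, all of them in `H(ω₂)`. -/
theorem exists_isSurj {a : ZFSet.{u}} (ha : a ∈ H (ℵ_ 2)) :
    ∃ f ∈ H (ℵ_ 2), IsSurj f a.card.ord.toZFSet a := by
  have hac : a.card < ℵ_ 2 := by
    obtain ⟨t, -, h, hc⟩ := ha
    exact (ZFSet.card_mono h).trans_lt hc
  have hlt : a.card.ord < ω_ 2 := by
    rw [lt_omega_two_iff, card_ord]
    exact hac
  have hcard : a.card.ord.toZFSet.card = a.card := by rw [card_toZFSet, card_ord]
  obtain ⟨e⟩ := Cardinal.eq.1 hcard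
  let e' : a.card.ord.toZFSet ≃ a := (equivShrink _).trans (e.trans (equivShrink _).symm)
  let f : Shrink.{u} a.card.ord.toZFSet → ZFSet.{u} := fun i =>
    ZFSet.pair ((equivShrink a.card.ord.toZFSet).symm i)
      (e' ((equivShrink a.card.ord.toZFSet).symm i))
  refine ⟨ZFSet.range f, ?_, ?_, ?_⟩
  · refine mem_H_of_forall_mem isRegular_aleph_two ?_ ?_
    · intro y hy
      obtain ⟨i, rfl⟩ := ZFSet.mem_range.1 hy
      exact pair_mem_H (mem_H_of_mem (toZFSet_mem_H hlt) (Subtype.coe_prop _))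
        (mem_H_of_mem ha (Subtype.coe_prop _))
    · have := ZFSet.lift_card_range_le (f := f)
      rw [Cardinal.lift_id, Cardinal.lift_id] at this
      refine this.trans_lt ?_
      change a.card.ord.toZFSet.card < _
      rwa [hcard]
  · intro z hz
    refine ⟨e'.symm ⟨z, hz⟩, Subtype.coe_prop _, ZFSet.mem_range.2 ⟨equivShrink _ (e'.symm ⟨z, hz⟩), ?_⟩⟩
    simp [f]
  · intro i z z' hz hz'
    obtain ⟨j, hj⟩ := ZFSet.mem_range.1 hz
    obtain ⟨j', hj'⟩ := ZFSet.mem_range.1 hz'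
    simp only [f, ZFSet.pair_inj] at hj hj'
    have : (equivShrink a.card.ord.toZFSet).symm j = (equivShrink a.card.ord.toZFSet).symm j' :=
      Subtype.ext (hj.1.trans hj'.1.symm)
    rw [← hj.2, ← hj'.2, this]

/-- An element of a Skolem hull which contains all ordinals below its cardinality is a subset of
the hull. -/
theorem mem_Sk_of_mem (hπ : Set.BijOn π (Set.Iio (ω_ 2)) (H (ℵ_ 2))) {c a : ZFSet.{u}}
    (haH : a ∈ H (ℵ_ 2)) (ha : a ∈ Sk π Y c)
    (hord : ∀ α < a.card.ord, α.toZFSet ∈ Sk π Y c) {z : ZFSet.{u}} (hz : z ∈ a) :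
    z ∈ Sk π Y c := by
  obtain ⟨f₀, hf₀, hs₀⟩ := exists_isSurj haH
  have hac : a.card < ℵ_ 2 := by
    obtain ⟨t, -, h, hc⟩ := haH
    exact (ZFSet.card_mono h).trans_lt hc
  have hlt : a.card.ord < ω_ 2 := by
    rw [lt_omega_two_iff, card_ord]
    exact hac
  -- The least ordinal carrying a surjection in `H(ω₂)` is definable from `a`, and `f₀` bounds it by
  -- the cardinality of `a`.
  obtain ⟨k, hk, hkmin⟩ : ∃ k : Ordinal.{u}, (k ≤ a.card.ord ∧ ∃ f ∈ H (ℵ_ 2),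
      IsSurj f k.toZFSet a) ∧ ∀ j < k, ¬ ∃ f ∈ H (ℵ_ 2), IsSurj f j.toZFSet a := by
    have hne : {k : Ordinal.{u} | ∃ f ∈ H (ℵ_ 2), IsSurj f k.toZFSet a}.Nonempty :=
      ⟨a.card.ord, f₀, hf₀, hs₀⟩
    have hmem : a.card.ord ∈ {k : Ordinal.{u} | ∃ f ∈ H (ℵ_ 2), IsSurj f k.toZFSet a} :=
      ⟨f₀, hf₀, hs₀⟩
    exact ⟨_, ⟨csInf_le' hmem, csInf_mem hne⟩, fun j hj h => notMem_of_lt_csInf' hj h⟩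
  have hk2 : k < ω_ 2 := hk.1.trans_lt hlt
  obtain ⟨f₁, hf₁, hs₁⟩ := hk.2
  -- the least ordinal which can be mapped onto `a` is in the hull
  have hkSk : k.toZFSet ∈ Sk π Y c := by
    obtain ⟨x, hx, hx1, hx2, hx3⟩ := exists_mem_Sk (Y := Y) hπ (n := 1) (v := ![⟨a, haH⟩]) (c := c)
      -- The first conjunct expresses that `x` is an ordinal below `ω₂`, as an element of the domain
      -- of `π`.
      (R := fun v x => (∃ y : ↥(H.{u} (ℵ_ 2)), ∃ α < ω_ 2, (x : ZFSet.{u}) = α.toZFSet ∧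
          (y : ZFSet.{u}) = π α) ∧ (∃ f : ↥(H.{u} (ℵ_ 2)), IsSurj f x (v 0)) ∧
        ∀ j : ↥(H.{u} (ℵ_ 2)), (j : ZFSet.{u}) ∈ (x : ZFSet.{u}) →
          ¬ ∃ f : ↥(H.{u} (ℵ_ 2)), IsSurj f j (v 0))
      (IsDef.and (IsDef.ex (R := fun (w : Fin 2 → _) (y : ↥(H.{u} (ℵ_ 2))) =>
          ∃ α < ω_ 2, (w (Fin.last 1) : ZFSet.{u}) = α.toZFSet ∧ (y : ZFSet.{u}) = π α)
          (IsDef.graph (IsVar.apply _).init (IsVar.apply _)))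
        (IsDef.and (IsDef.ex (R := fun (w : Fin 2 → _) (f : ↥(H.{u} (ℵ_ 2))) =>
          IsSurj f (w (Fin.last 1)) (Fin.init w 0))
          (IsDef.isSurj (.apply _) (IsVar.apply _).init (IsVar.apply (0 : Fin 1)).init.init))
        (IsDef.all (R := fun (w : Fin 2 → _) (j : ↥(H.{u} (ℵ_ 2))) =>
          (j : ZFSet.{u}) ∈ (w (Fin.last 1) : ZFSet.{u}) →
          ¬ ∃ f : ↥(H.{u} (ℵ_ 2)), IsSurj f j (Fin.init w 0))
          (IsDef.imp (IsDef.mem (.apply _) (IsVar.apply _).init)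
            (IsDef.ex (R := fun (w : Fin 3 → _) (f : ↥(H.{u} (ℵ_ 2))) =>
              IsSurj f (w (Fin.last 2)) (Fin.init (Fin.init w) 0))
              (IsDef.isSurj (.apply _) (IsVar.apply _).init
                (IsVar.apply (0 : Fin 1)).init.init.init)).not))))
      (by intro i; fin_cases i; assumption)
      ⟨⟨k.toZFSet, toZFSet_mem_H hk2⟩, ⟨⟨π k, hπ.mapsTo hk2⟩, k, hk2, rfl, rfl⟩,
        ⟨⟨f₁, hf₁⟩, hs₁⟩, fun j hj hf => by
          obtain ⟨j', hj', hjj⟩ := mem_toZFSet_iff.1 hj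
          obtain ⟨f, hf⟩ := hf
          refine hkmin j' hj' ⟨f, f.2, ?_⟩
          rw [hjj]
          exact hf⟩
    obtain ⟨-, α, hα, hxα, -⟩ := hx1
    obtain ⟨f, hf⟩ := hx2
    rw [hxα] at hf hx
    have hle : k ≤ α := by
      by_contra h
      exact hkmin α (not_le.1 h) ⟨f, f.2, hf⟩
    rcases hle.lt_or_eq with h | rfl
    · refine absurd ⟨⟨f₁, hf₁⟩, hs₁⟩ (hx3 ⟨k.toZFSet, toZFSet_mem_H hk2⟩ ?_)
      rw [hxα]
      exact toZFSet_mem_toZFSet_iff.2 h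
    · exact hx
  -- a map of this ordinal onto `a` is in the hull
  obtain ⟨f, hf, hfs⟩ := exists_mem_Sk (Y := Y) hπ (n := 2)
    (v := ![⟨k.toZFSet, toZFSet_mem_H hk2⟩, ⟨a, haH⟩]) (c := c)
    (R := fun v f => IsSurj f (v 0) (v 1))
    (IsDef.isSurj (.apply _) (IsVar.apply (0 : Fin 2)).init (IsVar.apply (1 : Fin 2)).init)
    (by intro i; fin_cases i <;> assumption) ⟨⟨f₁, hf₁⟩, hs₁⟩
  obtain ⟨i, hi, hp⟩ := hfs.1 z hz
  obtain ⟨j, hj, rfl⟩ := mem_toZFSet_iff.1 hi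
  -- The value of `f` at an index in the hull is in the hull, and `z` is that value.
  obtain ⟨y, hy, hyp⟩ := exists_mem_Sk (Y := Y) hπ (n := 2)
    (v := ![f, ⟨j.toZFSet, toZFSet_mem_H (hj.trans hk2)⟩]) (c := c)
    (R := fun v y => ZFSet.pair (v 1) y ∈ (v 0 : ZFSet.{u}))
    (IsDef.pair_mem (IsVar.apply (0 : Fin 2)).init (IsVar.apply (1 : Fin 2)).init (.apply _))
    (by
      intro i
      fin_cases i
      · exact hf
      · exact hord j (hj.trans_le hk.1))
    ⟨⟨z, mem_H_of_mem haH hz⟩, hp⟩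
  rw [hfs.2 _ _ _ hp hyp]
  exact hy

theorem mem_Sk_of_mem_of_countable (hπ : Set.BijOn π (Set.Iio (ω_ 2)) (H (ℵ_ 2))) {c a : ZFSet.{u}}
    (haH : a ∈ H (ℵ_ 2)) (ha : a ∈ Sk π Y c) (hac : (a : Set ZFSet.{u}).Countable)
    {z : ZFSet.{u}} (hz : z ∈ a) : z ∈ Sk π Y c := by
  refine mem_Sk_of_mem hπ haH ha (fun α hα => ?_) hz
  have h1 : α < ω := hα.trans_le (by
    rw [← ord_aleph0]; exact ord_le_ord.2 (card_le_aleph0_of_countable hac))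
  obtain ⟨n, rfl⟩ := lt_omega0.1 h1
  exact nat_mem_Sk hπ c n

/-- The Skolem hull of a closed set `c` is the image of `c` under `π`. -/
theorem mem_Sk_iff (hπ : Set.BijOn π (Set.Iio (ω_ 2)) (H (ℵ_ 2))) {c : ZFSet.{u}}
    (hc : IsSkClosed π Y c) {x : ZFSet.{u}} :
    x ∈ Sk π Y c ↔ ∃ α < ω_ 2, α.toZFSet ∈ c ∧ x = π α := by
  have hcsub : ∀ y ∈ c, y ∈ (ω_ 2 : Ordinal.{u}).toZFSet := fun y hy => by
    have : y ∈ (c : Set ZFSet.{u}) := hy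
    rw [← hc] at this
    exact this.2
  constructor
  · intro hx
    obtain ⟨α, hα, rfl⟩ := hπ.surjOn
      (mem_H_of_mem_Sk hπ (fun y hy => mem_H_of_mem_omega_two (hcsub y hy)) hx)
    refine ⟨α, hα, ?_, rfl⟩
    have : α.toZFSet ∈ (c : Set ZFSet.{u}) := by
      rw [← hc]
      exact ⟨toZFSet_mem_Sk hπ hα hx, toZFSet_mem_toZFSet_iff.2 hα⟩
    exact this
  · rintro ⟨α, hα, h, rfl⟩
    exact pi_mem_Sk hπ hα (subset_Sk h)

theorem IsSkClosed.mem {c : ZFSet.{u}} (hc : IsSkClosed π Y c) {x : ZFSet.{u}}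
    (hx : x ∈ Sk π Y c) (hx2 : x ∈ (ω_ 2 : Ordinal.{u}).toZFSet) : x ∈ c := by
  have : x ∈ (c : Set ZFSet.{u}) := by
    rw [← hc]
    exact ⟨hx, hx2⟩
  exact this

theorem IsSkClosed.subset {c : ZFSet.{u}} (hc : IsSkClosed π Y c) :
    c ⊆ (ω_ 2 : Ordinal.{u}).toZFSet := fun y hy => by
  have : y ∈ (c : Set ZFSet.{u}) := hy
  rw [← hc] at this
  exact this.2

theorem IsSkClosed.inter {c d : ZFSet.{u}} (hc : IsSkClosed π Y c) (hd : IsSkClosed π Y d) :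
    IsSkClosed π Y (c ∩ d) := by
  refine Set.Subset.antisymm ?_ ?_
  · rintro x ⟨hx, hx2⟩
    exact ZFSet.mem_inter.2 ⟨hc.mem (Sk_mono (fun z hz => (ZFSet.mem_inter.1 hz).1) hx) hx2,
      hd.mem (Sk_mono (fun z hz => (ZFSet.mem_inter.1 hz).2) hx) hx2⟩
  · intro x hx
    exact ⟨subset_Sk hx, hc.subset (ZFSet.mem_inter.1 hx).1⟩

/-- By injectivity of `π`, the codes of `x` in the two closed sets are the same ordinal. This is
what allows hull membership to be truncated at points of `C`. -/
theorem mem_Sk_inter (hπ : Set.BijOn π (Set.Iio (ω_ 2)) (H (ℵ_ 2))) {c d : ZFSet.{u}}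
    (hc : IsSkClosed π Y c) (hd : IsSkClosed π Y d) {x : ZFSet.{u}} (hxc : x ∈ Sk π Y c)
    (hxd : x ∈ Sk π Y d) : x ∈ Sk π Y (c ∩ d) := by
  obtain ⟨α, hα, h1, rfl⟩ := (mem_Sk_iff hπ hc).1 hxc
  obtain ⟨β, hβ, h2, h3⟩ := (mem_Sk_iff hπ hd).1 hxd
  obtain rfl := hπ.injOn hα hβ h3
  exact (mem_Sk_iff hπ (hc.inter hd)).2 ⟨α, hα, ZFSet.mem_inter.2 ⟨h1, h2⟩, rfl⟩

end AdequateForcing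

namespace AdequateForcing

variable {π : Ordinal.{u} → ZFSet.{u}} {Y : Set ZFSet.{u}} {Γ : Set Ordinal.{u}}

/-! ### Models and comparison points -/

section
variable (π Y Γ)

/-- The standing assumptions on `π`, `𝒴` and `Γ`. -/
structure Standing : Prop where
  bij : Set.BijOn π (Set.Iio (ω_ 2)) (H (ℵ_ 2))
  subset : ∀ a ∈ Y, a ⊆ (ω_ 2 : Ordinal.{u}).toZFSet
  countable : ∀ a ∈ Y, (a : Set ZFSet.{u}).Countable
  thin : IsThin Y
  inter_mem : ∀ a ∈ Y, ∀ β < ω_ 2, a ∩ β.toZFSet ∈ Y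
  subset_Lam : Γ ⊆ Lam π Y
  unbounded : ∀ α < ω_ 2, ∃ β ∈ Γ, α < β

/-- `M` and `N` are comparable below `β`. -/
def CompareAt (M N : ZFSet.{u}) (β : Ordinal.{u}) : Prop :=
  M ∩ β.toZFSet = N ∩ β.toZFSet ∨ M ∩ β.toZFSet ∈ Sk π Y N ∨ N ∩ β.toZFSet ∈ Sk π Y M

/-- `M` and `N` are comparable below `β_{M,N}`. -/
def Compare (M N : ZFSet.{u}) : Prop :=
  ∃ β, IsGreatest (gammaOf Γ M ∩ gammaOf Γ N) β ∧ CompareAt π Y M N β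

end

theorem CompareAt.symm {M N : ZFSet.{u}} {β : Ordinal.{u}} (h : CompareAt π Y M N β) :
    CompareAt π Y N M β := by
  rcases h with h | h | h
  exacts [Or.inl h.symm, Or.inr (Or.inr h), Or.inr (Or.inl h)]

theorem Compare.symm {M N : ZFSet.{u}} (h : Compare π Y Γ M N) : Compare π Y Γ N M := by
  obtain ⟨β, h1, h2⟩ := h
  exact ⟨β, by rwa [Set.inter_comm], h2.symm⟩

theorem exists_bound_of_countable {s : Set Ordinal.{u}} {a : Ordinal.{u}} (hs : s.Countable)
    (hlt : ∀ i ∈ s, i < a) (ha : ℵ₀ < a.cof) : ∃ ζ < a, ∀ i ∈ s, i < ζ := by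
  refine ⟨sSup ((· + 1) '' s), sSup_add_one_lt_of_lt_cof ?_ hlt, fun i hi => ?_⟩
  · rw [← Ordinal.lift_cof]
    refine (mk_le_aleph0_iff.2 hs.to_subtype).trans_lt ?_
    rwa [← Cardinal.lift_aleph0.{u + 1, u}, Cardinal.lift_lt]
  · refine (lt_add_one i).trans_le (le_csSup ⟨a, ?_⟩ ⟨i, hi, rfl⟩)
    rintro _ ⟨j, hj, rfl⟩
    exact Order.add_one_le_of_lt (hlt j hj)

theorem countable_ordinals {M : ZFSet.{u}} (hM : (M : Set ZFSet.{u}).Countable) :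
    {α : Ordinal.{u} | α.toZFSet ∈ M}.Countable :=
  hM.preimage toZFSet_injective

theorem aleph0_lt_cof_omega_two : ℵ₀ < (ω_ 2 : Ordinal.{u}).cof := by
  rw [isRegular_aleph_two.cof_omega_eq]
  exact aleph0_lt_aleph_two

theorem aleph0_lt_cof_omega_one : ℵ₀ < (ω_ 1 : Ordinal.{u}).cof := by
  rw [isRegular_aleph_one.cof_omega_eq]
  exact aleph0_lt_aleph_one

theorem omega_one_le_of_mem_Lam {β : Ordinal.{u}} (hβ : β ∈ Lam π Y) : ω_ 1 ≤ β := by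
  rw [← ord_aleph, ord_le, ← hβ.2.1]
  exact cof_le_card β

/-- Hulls are finitary: an element of `Sk(β)` is generated by finitely many ordinals below `β`, and
so lies in `Sk(γ)` for some `γ ∈ C` below `β`. -/
theorem mem_clubC_of_mem_Lam {β : Ordinal.{u}} (hβ : β ∈ Lam π Y) : β ∈ clubC π Y := by
  obtain ⟨hβ2, hcof, hlim⟩ := hβ
  refine ⟨hβ2, Set.Subset.antisymm ?_ ?_⟩
  · rintro x ⟨hx, hx2⟩
    have key : ∃ γ ∈ clubC π Y, γ < β ∧ x ∈ Sk π Y γ.toZFSet := by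
      -- The induction passes through arbitrary elements of the hull, not only ordinals.
      clear hx2
      induction hx with
      | base x hx =>
        obtain ⟨α, hα, rfl⟩ := mem_toZFSet_iff.1 hx
        obtain ⟨γ, hγ, h1, h2⟩ := hlim α hα
        exact ⟨γ, hγ, h2, subset_Sk (toZFSet_mem_toZFSet_iff.2 h1)⟩
      | step n φ v hv ih =>
        choose g hgC hgβ hg using ih
        obtain ⟨ζ, hζ, hζg⟩ := exists_bound_of_countable (Set.countable_range g)
          (by rintro _ ⟨i, rfl⟩; exact hgβ i) (a := β) (by rw [hcof]; exact aleph0_lt_aleph_one)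
        obtain ⟨γ, hγ, h1, h2⟩ := hlim ζ hζ
        refine ⟨γ, hγ, h2, MemSk.step n φ v fun i => Sk_mono ?_ (hg i)⟩
        exact toZFSet_subset_toZFSet_iff.2 ((hζg _ ⟨i, rfl⟩).trans h1).le
    obtain ⟨γ, hγ, h1, h2⟩ := key
    exact toZFSet_subset_toZFSet_iff.2 h1.le (hγ.2.mem h2 hx2)
  · intro x hx
    exact ⟨subset_Sk hx, toZFSet_subset_toZFSet_iff.2 hβ2.le hx⟩

/-- This form avoids suprema: below `β`, the set `M` exceeds every earlier point of `Γ`.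
Monotonicity in `M` becomes evident. -/
theorem mem_gammaOf_iff {M : ZFSet.{u}} {β : Ordinal.{u}} :
    β ∈ gammaOf Γ M ↔ β ∈ Γ ∧ ∀ γ ∈ Γ, γ < β → ∃ α, α.toZFSet ∈ M ∧ γ < α ∧ α < β := by
  have hbdd : ∀ α ∈ {α : Ordinal.{u} | α.toZFSet ∈ M ∧ α < β}, α ≤ β := fun α h => h.2.le
  constructor
  · rintro ⟨⟨h1, -⟩, h2⟩
    refine ⟨h1, fun γ hγ hlt => ?_⟩
    by_contra hcon
    push Not at hcon
    refine hlt.not_ge (h2 ⟨hγ, ?_⟩)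
    refine csSup_le' fun α hα => ?_
    by_contra hα'
    exact hα.2.not_ge (hcon α hα.1 (not_le.1 hα'))
  · rintro ⟨h1, h2⟩
    refine ⟨⟨h1, csSup_le' hbdd⟩, fun γ hγ => ?_⟩
    by_contra hlt
    obtain ⟨α, hα, h3, h4⟩ := h2 γ hγ.1 (not_le.1 hlt)
    exact h3.not_ge ((le_csSup ⟨β, hbdd⟩ ⟨hα, h4⟩).trans hγ.2)

theorem gammaOf_mono {L N : ZFSet.{u}} (h : L ⊆ N) : gammaOf Γ L ⊆ gammaOf Γ N := by
  intro β hβ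
  rw [mem_gammaOf_iff] at hβ ⊢
  refine ⟨hβ.1, fun γ hγ hlt => ?_⟩
  obtain ⟨α, hα, h1⟩ := hβ.2 γ hγ hlt
  exact ⟨α, h hα, h1⟩

/-- Together with `gammaOf_mono` and the next lemma: truncating `M` at `β ∈ Γ` keeps exactly the
points of `Γ_M` up to `β`. -/
theorem le_of_mem_gammaOf_inter {M : ZFSet.{u}} {β η : Ordinal.{u}} (hβ : β ∈ Γ)
    (h : η ∈ gammaOf Γ (M ∩ β.toZFSet)) : η ≤ β := by
  by_contra hlt
  obtain ⟨α, hα, h1, -⟩ := (mem_gammaOf_iff.1 h).2 β hβ (not_le.1 hlt)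
  exact h1.not_gt (toZFSet_mem_toZFSet_iff.1 (ZFSet.mem_inter.1 hα).2)

theorem mem_gammaOf_inter {M : ZFSet.{u}} {β η : Ordinal.{u}} (hη : η ∈ gammaOf Γ M)
    (h : η ≤ β) : η ∈ gammaOf Γ (M ∩ β.toZFSet) := by
  rw [mem_gammaOf_iff] at hη ⊢
  refine ⟨hη.1, fun γ hγ hlt => ?_⟩
  obtain ⟨α, hα, h1, h2⟩ := hη.2 γ hγ hlt
  exact ⟨α, ZFSet.mem_inter.2 ⟨hα, toZFSet_mem_toZFSet_iff.2 (h2.trans_le h)⟩, h1, h2⟩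

theorem inter_subset_left' {a b : ZFSet.{u}} : a ∩ b ⊆ a := fun _ h => (ZFSet.mem_inter.1 h).1

theorem inter_inter_of_le {M : ZFSet.{u}} {η β : Ordinal.{u}} (h : η ≤ β) :
    (M ∩ β.toZFSet) ∩ η.toZFSet = M ∩ η.toZFSet := by
  ext z
  simp only [ZFSet.mem_inter]
  have hsub : z ∈ η.toZFSet → z ∈ β.toZFSet := fun hz => toZFSet_subset_toZFSet_iff.2 h hz
  tauto

/-- `M` is small with respect to `N`: it is strictly below `N` at their comparison point. -/
def IsBelow (π : Ordinal.{u} → ZFSet.{u}) (Y : Set ZFSet.{u})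
    (Γ : Set Ordinal.{u}) (M N : ZFSet.{u}) : Prop :=
  (∃ β ∈ Γ, M ∩ N = M ∩ β.toZFSet) ∧ M ∩ N ∈ Sk π Y N ∧ ∀ x ∈ (ω_ 1 : Ordinal.{u}).toZFSet, x ∈ M → x ∈ N

/-! ### Truncation, comparison and amalgamation of adequate sets. -/

namespace Standing

theorem mem_H (S : Standing π Y Γ) {a : ZFSet.{u}} (ha : a ∈ Y) : a ∈ H (ℵ_ 2) :=
  mem_H_of_countable (fun _ hy => mem_H_of_mem_omega_two (S.subset a ha hy)) (S.countable a ha)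

theorem inter_mem_models (S : Standing π Y Γ) {M : ZFSet.{u}} {β : Ordinal.{u}}
    (hM : M ∈ models π Y) (hβ : β ∈ Γ) : M ∩ β.toZFSet ∈ models π Y := by
  have hL := S.subset_Lam hβ
  refine ⟨S.inter_mem M hM.1 β hL.1, hM.2.1.inter (mem_clubC_of_mem_Lam hL).2, fun γ hγ => ?_⟩
  rw [ZFSet.mem_inter] at hγ ⊢
  refine ⟨hM.2.2 γ hγ.1, toZFSet_mem_toZFSet_iff.2 ?_⟩
  exact (csSup_le' fun α hα => le_of_lt hα.2).trans_lt (toZFSet_mem_toZFSet_iff.1 hγ.2)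

/-- An initial segment of an element of `𝒴` below a point of `Λ` is in the hull of that point. -/
theorem inter_mem_Sk_toZFSet (S : Standing π Y Γ) {M : ZFSet.{u}} {β : Ordinal.{u}}
    (hM : M ∈ Y) (hβ : β ∈ Lam π Y) : M ∩ β.toZFSet ∈ Sk π Y β.toZFSet := by
  -- Since `β` has cofinality `ω₁`, the countable trace is bounded below `β`, and `β` can be
  -- replaced by some `γ ∈ C` below it, which is an element of `Sk(β)`.
  obtain ⟨ζ, hζ, hζM⟩ := exists_bound_of_countable (s := {α | α.toZFSet ∈ M ∧ α < β}) (a := β)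
    ((countable_ordinals (S.countable M hM)).mono fun α hα => hα.1) (fun i hi => hi.2)
    (by rw [hβ.2.1]; exact aleph0_lt_aleph_one)
  obtain ⟨γ, hγ, h1, h2⟩ := hβ.2.2 ζ hζ
  have hMγ : M ∩ β.toZFSet = M ∩ γ.toZFSet := by
    ext z
    simp only [ZFSet.mem_inter]
    refine and_congr_right fun hz => ⟨fun hzβ => ?_, fun h => toZFSet_subset_toZFSet_iff.2 h2.le h⟩
    obtain ⟨α, hα, rfl⟩ := mem_toZFSet_iff.1 hzβ
    exact toZFSet_mem_toZFSet_iff.2 ((hζM α ⟨hz, hα⟩).trans h1)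
  have hγ2 : γ < ω_ 2 := hγ.1
  have hγH := toZFSet_mem_H hγ2
  -- The elements of `𝒴` included in `γ` are exactly the traces on `γ`, so by thinness there are at
  -- most `ω₁` of them. The set `s` is definable from `γ`, and `ω₁ ≤ β`; hence all its elements are
  -- in `Sk(β)`.
  let s : ZFSet.{u} := γ.toZFSet.powerset.sep (· ∈ Y)
  have hs : ∀ b, b ∈ s ↔ b ∈ Y ∧ b ⊆ γ.toZFSet := fun b => by
    simp only [s, ZFSet.mem_sep, ZFSet.mem_powerset]
    tauto
  have hscard : s.card ≤ ℵ₁ := by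
    have h3 := S.thin γ hγ2
    have h4 : ((s : ZFSet.{u}) : Set ZFSet.{u}) = {b | ∃ a ∈ Y, b = a ∩ γ.toZFSet} := by
      ext b
      refine (hs b).trans ⟨fun h => ⟨b, h.1, (ZFSet.inter_eq_left_of_subset h.2).symm⟩, ?_⟩
      rintro ⟨a, ha, rfl⟩
      exact ⟨S.inter_mem a ha γ hγ2, fun z hz => (ZFSet.mem_inter.1 hz).2⟩
    rw [← h4] at h3
    have h5 := ZFSet.cardinalMk_coe_sort (x := s)
    rw [← Cardinal.lift_le.{u + 1}, ← h5, lift_aleph, Ordinal.lift_one]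
    exact h3
  have hsH : s ∈ H (ℵ_ 2) := mem_H_of_forall_mem isRegular_aleph_two
    (fun y hy => mem_H_of_subset hγH ((hs y).1 hy).2) (hscard.trans_lt aleph_one_lt_aleph_two)
  have hsSk : s ∈ Sk π Y β.toZFSet := by
    obtain ⟨x, hx, hxR⟩ := exists_mem_Sk (Y := Y) S.bij (n := 1) (v := ![⟨_, hγH⟩])
      (c := β.toZFSet)
      (R := fun v x => ∀ t : ↥(H.{u} (ℵ_ 2)), (t : ZFSet.{u}) ∈ (x : ZFSet.{u}) ↔
        ((t : ZFSet.{u}) ∈ Y ∧ ∀ w : ↥(H.{u} (ℵ_ 2)), (w : ZFSet.{u}) ∈ (t : ZFSet.{u}) →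
          (w : ZFSet.{u}) ∈ (v 0 : ZFSet.{u})))
      (IsDef.all (R := fun (w : Fin 2 → _) (t : ↥(H.{u} (ℵ_ 2))) =>
        (t : ZFSet.{u}) ∈ (w (Fin.last 1) : ZFSet.{u}) ↔
        ((t : ZFSet.{u}) ∈ Y ∧ ∀ z : ↥(H.{u} (ℵ_ 2)), (z : ZFSet.{u}) ∈ (t : ZFSet.{u}) →
          (z : ZFSet.{u}) ∈ (Fin.init w 0 : ZFSet.{u})))
        ((IsDef.mem (.apply _) (IsVar.apply _).init).iff
          ((IsDef.inY (.apply _)).and (IsDef.all (R := fun (w : Fin 3 → _)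
            (z : ↥(H.{u} (ℵ_ 2))) => (z : ZFSet.{u}) ∈ (w (Fin.last 2) : ZFSet.{u}) →
            (z : ZFSet.{u}) ∈ (Fin.init (Fin.init w) 0 : ZFSet.{u}))
            ((IsDef.mem (.apply _) (IsVar.apply _).init).imp
              (IsDef.mem (.apply _) (IsVar.apply (0 : Fin 1)).init.init.init))))))
      (by intro i; fin_cases i; exact subset_Sk (toZFSet_mem_toZFSet_iff.2 h2))
      ⟨⟨s, hsH⟩, fun t => (hs t).trans (and_congr_right fun _ =>
        ⟨fun h w hw => h hw, fun h w hw => h ⟨w, mem_H_of_mem t.2 hw⟩ hw⟩)⟩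
    have : (x : ZFSet.{u}) = s := by
      rw [← ext_H (fun z hz => mem_H_of_mem hsH hz)]
      intro t
      rw [hxR t, hs]
      exact and_congr_right fun _ =>
        ⟨fun h w hw => h ⟨w, mem_H_of_mem t.2 hw⟩ hw, fun h w hw => h hw⟩
    rwa [← this]
  rw [hMγ]
  refine mem_Sk_of_mem S.bij hsH hsSk (fun α hα => subset_Sk (toZFSet_mem_toZFSet_iff.2 ?_))
    ((hs _).2 ⟨S.inter_mem M hM γ hγ2, fun z hz => (ZFSet.mem_inter.1 hz).2⟩)
  refine hα.trans_le (le_trans ?_ (omega_one_le_of_mem_Lam hβ))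
  rw [← ord_aleph]
  exact ord_le_ord.2 hscard

/-- Countable elements of the hull of a model are subsets of the model. -/
theorem subset_of_mem_Sk (S : Standing π Y Γ) {K a : ZFSet.{u}} (hK : K ∈ models π Y)
    (ha : a ∈ Y) (h : a ∈ Sk π Y K) : a ⊆ K := fun _ hz =>
  hK.2.1.mem (mem_Sk_of_mem_of_countable S.bij (S.mem_H ha) h (S.countable a ha) hz)
    (S.subset a ha hz)

/-- The ordinal `ξ` need not be in the hull. As `a ⊆ K`, cutting at the least ordinal of `K` that is
at least `ξ` gives the same set; if there is no such ordinal, nothing is cut off. -/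
theorem inter_mem_Sk_of_mem_Sk (S : Standing π Y Γ) {K a : ZFSet.{u}} (hK : K ∈ models π Y)
    (ha : a ∈ Y) (h : a ∈ Sk π Y K) (ξ : Ordinal.{u}) : a ∩ ξ.toZFSet ∈ Sk π Y K := by
  have hsub := S.subset_of_mem_Sk hK ha h
  by_cases hex : ∃ κ : Ordinal.{u}, κ.toZFSet ∈ K ∧ ξ ≤ κ
  · let κ := sInf {κ : Ordinal.{u} | κ.toZFSet ∈ K ∧ ξ ≤ κ}
    have hκ : κ.toZFSet ∈ K ∧ ξ ≤ κ := csInf_mem hex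
    have heq : a ∩ ξ.toZFSet = a ∩ κ.toZFSet := by
      ext z
      simp only [ZFSet.mem_inter]
      refine and_congr_right fun hz => ⟨fun h => toZFSet_subset_toZFSet_iff.2 hκ.2 h, fun h => ?_⟩
      obtain ⟨α, hα, rfl⟩ := mem_toZFSet_iff.1 h
      refine toZFSet_mem_toZFSet_iff.2 ?_
      by_contra hlt
      exact notMem_of_lt_csInf' hα ⟨hsub hz, not_lt.1 hlt⟩
    rw [heq]
    exact inter_mem_Sk S.bij (S.mem_H ha) (mem_H_of_mem_omega_two (hK.2.1.subset hκ.1)) h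
      (subset_Sk hκ.1)
  · push Not at hex
    rwa [ZFSet.inter_eq_left_of_subset]
    intro z hz
    obtain ⟨α, hα, rfl⟩ := mem_toZFSet_iff.1 (S.subset a ha hz)
    exact toZFSet_mem_toZFSet_iff.2 (hex α (hsub hz))

theorem compareAt_of_le (S : Standing π Y Γ) {M N : ZFSet.{u}} {β η : Ordinal.{u}}
    (hM : M ∈ models π Y) (hN : N ∈ models π Y) (hβ : β < ω_ 2) (h : CompareAt π Y M N β)
    (hη : η ≤ β) : CompareAt π Y M N η := by
  have hMβ := S.inter_mem M hM.1 β hβ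
  have hNβ := S.inter_mem N hN.1 β hβ
  rcases h with h | h | h
  · left
    rw [← inter_inter_of_le hη, h, inter_inter_of_le hη]
  · right; left
    rw [← inter_inter_of_le hη]
    exact S.inter_mem_Sk_of_mem_Sk hN hMβ h η
  · right; right
    rw [← inter_inter_of_le hη]
    exact S.inter_mem_Sk_of_mem_Sk hM hNβ h η

theorem lt_omega_two (S : Standing π Y Γ) {β : Ordinal.{u}} (hβ : β ∈ Γ) : β < ω_ 2 :=
  (S.subset_Lam hβ).1

theorem mem_of_mem_gammaOf {M : ZFSet.{u}} {β : Ordinal.{u}} (h : β ∈ gammaOf Γ M) : β ∈ Γ :=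
  (mem_gammaOf_iff.1 h).1

/-- The comparison point exists. -/
theorem exists_isGreatest (S : Standing π Y Γ) {M : ZFSet.{u}} (N : ZFSet.{u})
    (hM : M ∈ models π Y) : ∃ β, IsGreatest (gammaOf Γ M ∩ gammaOf Γ N) β := by
  obtain ⟨ζ, hζ, hζM⟩ := exists_bound_of_countable (s := {α : Ordinal.{u} | α.toZFSet ∈ M})
    (a := ω_ 2) (countable_ordinals (S.countable M hM.1))
    (fun i hi => toZFSet_mem_toZFSet_iff.1 (S.subset M hM.1 hi)) aleph0_lt_cof_omega_two
  obtain ⟨β₀, hβ₀, hζβ⟩ := S.unbounded ζ hζ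
  have hbd : ∀ η ∈ gammaOf Γ M ∩ gammaOf Γ N, η ≤ β₀ := by
    intro η hη
    by_contra hlt
    obtain ⟨α, hα, h1, -⟩ := (mem_gammaOf_iff.1 hη.1).2 β₀ hβ₀ (not_le.1 hlt)
    exact (hζβ.trans h1).not_gt (hζM α hα)
  -- The largest common point is the least element of `Γ` at or above the supremum `s`. Any smaller
  -- `γ ∈ Γ` is below a common point, whose witnesses in `M` and `N` serve again. Without common
  -- points `s = 0`, and this is the minimum of `Γ`.
  let s := sSup (gammaOf Γ M ∩ gammaOf Γ N)
  have hs : s ≤ β₀ := csSup_le' hbd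
  have hne : {β | β ∈ Γ ∧ s ≤ β}.Nonempty := ⟨β₀, hβ₀, hs⟩
  have hmem := csInf_mem hne
  have hkey : ∀ γ ∈ Γ, γ < sInf {β | β ∈ Γ ∧ s ≤ β} → ∃ η ∈ gammaOf Γ M ∩ gammaOf Γ N, γ < η := by
    intro γ hγ hlt
    have h1 : γ < s := by
      by_contra h
      exact notMem_of_lt_csInf' hlt ⟨hγ, not_lt.1 h⟩
    by_contra hcon
    push Not at hcon
    exact h1.not_ge (csSup_le' hcon)
  have hle : ∀ η ∈ gammaOf Γ M ∩ gammaOf Γ N, η ≤ sInf {β | β ∈ Γ ∧ s ≤ β} := fun η hη =>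
    (le_csSup ⟨β₀, hbd⟩ hη).trans hmem.2
  refine ⟨_, ⟨mem_gammaOf_iff.2 ⟨hmem.1, fun γ hγ hlt => ?_⟩,
    mem_gammaOf_iff.2 ⟨hmem.1, fun γ hγ hlt => ?_⟩⟩, hle⟩
  · obtain ⟨η, hη, h1⟩ := hkey γ hγ hlt
    obtain ⟨α, h2, h3, h4⟩ := (mem_gammaOf_iff.1 hη.1).2 γ hγ h1
    exact ⟨α, h2, h3, h4.trans_le (hle η hη)⟩
  · obtain ⟨η, hη, h1⟩ := hkey γ hγ hlt
    obtain ⟨α, h2, h3, h4⟩ := (mem_gammaOf_iff.1 hη.2).2 γ hγ h1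
    exact ⟨α, h2, h3, h4.trans_le (hle η hη)⟩

/-- Common elements of two models are below their comparison point. -/
theorem inter_subset_of_isGreatest (S : Standing π Y Γ) {M N : ZFSet.{u}} {β : Ordinal.{u}}
    (hM : M ∈ models π Y) (hN : N ∈ models π Y)
    (hβ : IsGreatest (gammaOf Γ M ∩ gammaOf Γ N) β) {z : ZFSet.{u}} (hzM : z ∈ M) (hzN : z ∈ N) :
    z ∈ β.toZFSet := by
  obtain ⟨ξ, hξ, rfl⟩ := mem_toZFSet_iff.1 (S.subset M hM.1 hzM)
  -- The least element of `Γ` above a common ordinal `ξ` is a common point, so it is at most the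
  -- comparison point.
  have hne : {γ | γ ∈ Γ ∧ ξ < γ}.Nonempty := S.unbounded ξ hξ
  have hmem := csInf_mem hne
  have hkey : ∀ K ∈ models π Y, ξ.toZFSet ∈ K → sInf {γ | γ ∈ Γ ∧ ξ < γ} ∈ gammaOf Γ K := by
    intro K hK hξK
    -- The witness is `ξ + 1` rather than `ξ`, since `γ` may equal `ξ`.
    refine mem_gammaOf_iff.2 ⟨hmem.1, fun γ hγ hlt => ⟨ξ + 1, ?_, ?_, ?_⟩⟩
    · exact hK.2.1.mem (add_one_mem_Sk S.bij hξ (subset_Sk hξK))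
        (toZFSet_mem_toZFSet_iff.2 (add_one_lt_omega_two hξ))
    · rw [Order.lt_add_one_iff]
      by_contra h
      exact notMem_of_lt_csInf' hlt ⟨hγ, not_le.1 h⟩
    · obtain ⟨γ', -, h1, h2⟩ := (S.subset_Lam hmem.1).2.2 ξ hmem.2
      exact (Order.add_one_le_of_lt h1).trans_lt h2
  exact toZFSet_mem_toZFSet_iff.2
    (hmem.2.trans_le (hβ.2 ⟨hkey M hM hzM, hkey N hN hzN⟩))

/-- The comparison point can only drop. The one case that needs an argument is `N ∩ η ∈ Sk(M)`: this
trace is also in `Sk(η) ⊆ Sk(β)`, hence in `Sk(M ∩ β)`. -/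
theorem compare_inter_left (S : Standing π Y Γ) {M N : ZFSet.{u}} {β : Ordinal.{u}}
    (hM : M ∈ models π Y) (hN : N ∈ models π Y) (hβ : β ∈ Γ) (h : Compare π Y Γ M N) :
    Compare π Y Γ (M ∩ β.toZFSet) N := by
  obtain ⟨β₀, hg, hc⟩ := h
  obtain ⟨η, hη⟩ := S.exists_isGreatest N (S.inter_mem_models hM hβ)
  have h1 : η ≤ β := le_of_mem_gammaOf_inter hβ hη.1.1
  have h2 : η ≤ β₀ := hg.2 ⟨gammaOf_mono inter_subset_left' hη.1.1, hη.1.2⟩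
  refine ⟨η, hη, ?_⟩
  have hc' := S.compareAt_of_le hM hN (S.lt_omega_two (mem_of_mem_gammaOf hg.1.1)) hc h2
  rw [CompareAt, inter_inter_of_le h1]
  rcases hc' with h | h | h
  · exact Or.inl h
  · exact Or.inr (Or.inl h)
  · right; right
    have hηL := S.subset_Lam (mem_of_mem_gammaOf hη.1.2)
    refine mem_Sk_inter S.bij hM.2.1 (mem_clubC_of_mem_Lam (S.subset_Lam hβ)).2 h ?_
    exact Sk_mono (toZFSet_subset_toZFSet_iff.2 h1) (S.inter_mem_Sk_toZFSet hN.1 hηL)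

theorem compare_inter (S : Standing π Y Γ) {M N : ZFSet.{u}} {β γ : Ordinal.{u}}
    (hM : M ∈ models π Y) (hN : N ∈ models π Y) (hβ : β ∈ Γ) (hγ : γ ∈ Γ)
    (h : Compare π Y Γ M N) : Compare π Y Γ (M ∩ β.toZFSet) (N ∩ γ.toZFSet) :=
  (S.compare_inter_left hN (S.inter_mem_models hM hβ) hγ
    (S.compare_inter_left hM hN hβ h).symm).symm

theorem inter_eq_of_mem_Sk (S : Standing π Y Γ) {M N : ZFSet.{u}} {β : Ordinal.{u}}
    (hM : M ∈ models π Y) (hN : N ∈ models π Y)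
    (hβ : IsGreatest (gammaOf Γ M ∩ gammaOf Γ N) β) (h : M ∩ β.toZFSet ∈ Sk π Y N) :
    M ∩ N = M ∩ β.toZFSet := by
  have hsub := S.subset_of_mem_Sk hN
    (S.inter_mem M hM.1 β (S.lt_omega_two (mem_of_mem_gammaOf hβ.1.1))) h
  ext z
  constructor
  · intro hz
    rw [ZFSet.mem_inter] at hz ⊢
    exact ⟨hz.1, S.inter_subset_of_isGreatest hM hN hβ hz.1 hz.2⟩
  · intro hz
    exact ZFSet.mem_inter.2 ⟨(ZFSet.mem_inter.1 hz).1, hsub hz⟩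

theorem isBelow_of_mem_Sk (S : Standing π Y Γ) {M N : ZFSet.{u}} {β : Ordinal.{u}}
    (hM : M ∈ models π Y) (hN : N ∈ models π Y)
    (hβ : IsGreatest (gammaOf Γ M ∩ gammaOf Γ N) β) (h : M ∩ β.toZFSet ∈ Sk π Y N) :
    IsBelow π Y Γ M N := by
  have heq := S.inter_eq_of_mem_Sk hM hN hβ h
  refine ⟨⟨β, mem_of_mem_gammaOf hβ.1.1, heq⟩, by rwa [heq], fun x hx hxM => ?_⟩
  have : x ∈ M ∩ β.toZFSet := ZFSet.mem_inter.2 ⟨hxM, toZFSet_subset_toZFSet_iff.2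
    (omega_one_le_of_mem_Lam (S.subset_Lam (mem_of_mem_gammaOf hβ.1.1))) hx⟩
  rw [← heq] at this
  exact (ZFSet.mem_inter.1 this).2

/-- This dichotomy drives the amalgamation: models below `N` are reflected, while the others contain
all countable ordinals of `N`. -/
theorem isBelow_or (S : Standing π Y Γ) {M N : ZFSet.{u}} (hM : M ∈ models π Y)
    (hN : N ∈ models π Y) (h : Compare π Y Γ M N) :
    IsBelow π Y Γ M N ∨ ∀ x ∈ (ω_ 1 : Ordinal.{u}).toZFSet, x ∈ N → x ∈ M := by
  obtain ⟨β, hβ, hc⟩ := h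
  have hβ1 : ∀ x ∈ (ω_ 1 : Ordinal.{u}).toZFSet, x ∈ β.toZFSet := fun x hx =>
    toZFSet_subset_toZFSet_iff.2
      (omega_one_le_of_mem_Lam (S.subset_Lam (mem_of_mem_gammaOf hβ.1.1))) hx
  rcases hc with h | h | h
  · right
    intro x hx hxN
    have : x ∈ N ∩ β.toZFSet := ZFSet.mem_inter.2 ⟨hxN, hβ1 x hx⟩
    rw [← h] at this
    exact (ZFSet.mem_inter.1 this).1
  · exact Or.inl (S.isBelow_of_mem_Sk hM hN hβ h)
  · exact Or.inr (S.isBelow_of_mem_Sk hN hM (by rwa [Set.inter_comm]) h).2.2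

theorem compare_of_mem_Sk (S : Standing π Y Γ) {M N : ZFSet.{u}} (hM : M ∈ models π Y)
    (hN : N ∈ models π Y) (h : M ∈ Sk π Y N) : Compare π Y Γ M N := by
  obtain ⟨β, hβ⟩ := S.exists_isGreatest N hM
  exact ⟨β, hβ, Or.inr (Or.inl (S.inter_mem_Sk_of_mem_Sk hN hM.1 h β))⟩

theorem compare_self (S : Standing π Y Γ) {M : ZFSet.{u}} (hM : M ∈ models π Y) :
    Compare π Y Γ M M := by
  obtain ⟨β, hβ⟩ := S.exists_isGreatest M hM
  exact ⟨β, hβ, Or.inl rfl⟩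

/-- A model whose hull contains an adequate set may be added to that set. -/
theorem isAdequate_insert (S : Standing π Y Γ) {A : Set ZFSet.{u}} {N : ZFSet.{u}}
    (hA : IsAdequate π Y Γ A) (hN : N ∈ models π Y) (h : ∀ M ∈ A, M ∈ Sk π Y N) :
    IsAdequate π Y Γ (insert N A) := by
  refine ⟨Set.insert_subset hN hA.1, fun M hM K hK => ?_⟩
  rcases hM with rfl | hM <;> rcases hK with rfl | hK
  · exact S.compare_self hN
  · exact (S.compare_of_mem_Sk (hA.1 hK) hN (h K hK)).symm
  · exact S.compare_of_mem_Sk (hA.1 hM) hN (h M hM)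
  · exact hA.2 M hM K hK

/-- Adequate sets stay adequate when truncations of their elements are added. -/
theorem isAdequate_truncations (S : Standing π Y Γ) {A B : Set ZFSet.{u}}
    (hA : IsAdequate π Y Γ A)
    (hB : ∀ M ∈ B, M ∈ A ∨ ∃ K ∈ A, ∃ β ∈ Γ, M = K ∩ β.toZFSet) : IsAdequate π Y Γ B := by
  refine ⟨fun M hM => ?_, fun M hM K hK => ?_⟩
  · rcases hB M hM with h | ⟨K, hK, β, hβ, rfl⟩
    · exact hA.1 h
    · exact S.inter_mem_models (hA.1 hK) hβ
  · rcases hB M hM with h | ⟨M, h, β, hβ, rfl⟩ <;> rcases hB K hK with h' | ⟨K, h', γ, hγ, rfl⟩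
    · exact hA.2 M h K h'
    · exact (S.compare_inter_left (hA.1 h') (hA.1 h) hγ (hA.2 K h' M h)).symm
    · exact S.compare_inter_left (hA.1 h) (hA.1 h') hβ (hA.2 M h K h')
    · exact S.compare_inter (hA.1 h) (hA.1 h') hβ hγ (hA.2 M h K h')

/-- Amalgamation of an adequate set `A` containing `N` with an adequate set contained in the hull
of `N` to which the traces on `N` of the smaller elements of `A` belong. -/
theorem isAdequate_union (S : Standing π Y Γ) {A B : Set ZFSet.{u}} {N : ZFSet.{u}}
    (hA : IsAdequate π Y Γ A) (hB : IsAdequate π Y Γ B) (hN : N ∈ A) (hBN : ∀ L ∈ B, L ∈ Sk π Y N)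
    (hAB : ∀ M ∈ A, IsBelow π Y Γ M N → M ∩ N ∈ B) : IsAdequate π Y Γ (A ∪ B) := by
  have hNm := hA.1 hN
  have key : ∀ K ∈ A, ∀ L ∈ B, Compare π Y Γ K L := by
    intro K hK L hL
    have hKm := hA.1 hK
    have hLm := hB.1 hL
    have hLN : L ⊆ N := S.subset_of_mem_Sk hNm hLm.1 (hBN L hL)
    obtain ⟨β, hβ, hc⟩ := hA.2 K hK N hN
    have hβΓ : β ∈ Γ := mem_of_mem_gammaOf hβ.1.1
    obtain ⟨η, hη⟩ := S.exists_isGreatest L hKm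
    have hηβ : η ≤ β := hβ.2 ⟨hη.1.1, gammaOf_mono hLN hη.1.2⟩
    have hηL := S.subset_Lam (mem_of_mem_gammaOf hη.1.1)
    -- the trace of `L` is in the hull of the trace of `N`
    have htr : L ∩ η.toZFSet ∈ Sk π Y (N ∩ β.toZFSet) :=
      mem_Sk_inter S.bij hNm.2.1 (mem_clubC_of_mem_Lam (S.subset_Lam hβΓ)).2
        (S.inter_mem_Sk_of_mem_Sk hNm hLm.1 (hBN L hL) η)
        (Sk_mono (toZFSet_subset_toZFSet_iff.2 hηβ) (S.inter_mem_Sk_toZFSet hLm.1 hηL))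
    rcases hc with h | h | h
    -- Here `K` and `N` have the same trace on `β`, so the hull containing `L ∩ η` is included in
    -- `Sk(K)`.
    · refine ⟨η, hη, Or.inr (Or.inr ?_)⟩
      rw [← h] at htr
      exact Sk_mono inter_subset_left' htr
    -- Here `K ∩ β` is the trace `K ∩ N ∈ B`. It is comparable with `L` inside `B`, at a point no
    -- smaller than `η`, and it agrees with `K` below `η`.
    · have hbelow := S.isBelow_of_mem_Sk hKm hNm hβ h
      have hKB := hAB K hK hbelow
      rw [S.inter_eq_of_mem_Sk hKm hNm hβ h] at hKB
      obtain ⟨η', hη', hc'⟩ := hB.2 _ hKB L hL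
      have h1 : η ≤ η' := hη'.2 ⟨mem_gammaOf_inter hη.1.1 hηβ, hη.1.2⟩
      have h2 : CompareAt π Y (K ∩ β.toZFSet) L η := S.compareAt_of_le (hB.1 hKB) hLm
        (S.lt_omega_two (mem_of_mem_gammaOf hη'.1.1)) hc' h1
      rw [CompareAt, inter_inter_of_le hηβ] at h2
      refine ⟨η, hη, ?_⟩
      rcases h2 with h2 | h2 | h2
      · exact Or.inl h2
      · exact Or.inr (Or.inl h2)
      · exact Or.inr (Or.inr (Sk_mono inter_subset_left' h2))
    -- Here `N ∩ β` is a countable element of `Sk(K)`, hence a subset of `K`.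
    · refine ⟨η, hη, Or.inr (Or.inr ?_)⟩
      have hsub := S.subset_of_mem_Sk hKm (S.inter_mem N hNm.1 β (S.lt_omega_two hβΓ)) h
      exact Sk_mono hsub htr
  refine ⟨Set.union_subset hA.1 hB.1, fun M hM K hK => ?_⟩
  rcases hM with hM | hM <;> rcases hK with hK | hK
  · exact hA.2 M hM K hK
  · exact key M hM K hK
  · exact (key K hK M hM).symm
  · exact hB.2 M hM K hK

/-- The countable ordinals in a model form an initial segment. -/
theorem mem_of_mem_of_mem (S : Standing π Y Γ) {M x y : ZFSet.{u}} (hM : M ∈ models π Y)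
    (hy : y ∈ (ω_ 1 : Ordinal.{u}).toZFSet) (hyM : y ∈ M) (hx : x ∈ y) : x ∈ M := by
  obtain ⟨α, hα, rfl⟩ := mem_toZFSet_iff.1 hy
  have hα2 := hα.trans omega_one_lt_omega_two
  refine hM.2.1.mem (mem_Sk_of_mem_of_countable S.bij (toZFSet_mem_H hα2) (subset_Sk hyM)
    (countable_of_card_le_aleph0 ?_) hx) (toZFSet_subset_toZFSet_iff.2 hα2.le hx)
  rw [card_toZFSet]
  exact lt_omega_one_iff.1 hα

end Standing

end AdequateForcing

namespace AdequateForcing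

/-! ### Closing off under countably many relations, and lifting stationary sets -/

section Closure

variable {α : Type*} {X Z : Set α} {K : List α → Set α}

/-- `N` is closed under the set-valued operation `K`. -/
def IsClosedUnder (K : List α → Set α) (N : Set α) : Prop := ∀ l, (∀ x ∈ l, x ∈ N) → K l ⊆ N

/-- One step of closing off under `K`. -/
def closeStep (K : List α → Set α) (a : Set α) : Set α :=
  a ∪ ⋃ l ∈ {l : List α | ∀ x ∈ l, x ∈ a}, K l

/-- The closure of `a` under `K`. -/
def closeOff (K : List α → Set α) (a : Set α) : Set α := ⋃ n : ℕ, (closeStep K)^[n] a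

theorem countable_setOf_list {a : Set α} (ha : a.Countable) :
    {l : List α | ∀ x ∈ l, x ∈ a}.Countable := by
  have : Countable a := ha.to_subtype
  refine (Set.countable_range (fun l : List a => l.map Subtype.val)).mono fun l hl => ?_
  exact ⟨l.attach.map fun x => ⟨x.1, hl x.1 x.2⟩, by simp⟩

theorem exists_forall_mem_of_monotone {f : ℕ → Set α} (hf : Monotone f) (l : List α)
    (hl : ∀ x ∈ l, x ∈ ⋃ n, f n) : ∃ n, ∀ x ∈ l, x ∈ f n := by
  induction l with
  | nil => exact ⟨0, by simp⟩
  | cons y l ih =>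
    obtain ⟨n, hn⟩ := ih fun x hx => hl x (List.mem_cons_of_mem _ hx)
    obtain ⟨m, hm⟩ := Set.mem_iUnion.1 (hl y List.mem_cons_self)
    refine ⟨max n m, fun x hx => ?_⟩
    rcases List.mem_cons.1 hx with rfl | hx
    · exact hf (le_max_right _ _) hm
    · exact hf (le_max_left _ _) (hn x hx)

theorem monotone_iterate_closeStep (K : List α → Set α) (a : Set α) :
    Monotone fun n : ℕ => (closeStep K)^[n] a := by
  refine monotone_nat_of_le_succ fun n => ?_
  rw [Function.iterate_succ_apply']
  exact Set.subset_union_left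

theorem subset_closeOff (K : List α → Set α) (a : Set α) : a ⊆ closeOff K a :=
  Set.subset_iUnion (fun n : ℕ => (closeStep K)^[n] a) 0

theorem isClosedUnder_closeOff (K : List α → Set α) (a : Set α) :
    IsClosedUnder K (closeOff K a) := by
  intro l hl y hy
  obtain ⟨n, hn⟩ := exists_forall_mem_of_monotone (monotone_iterate_closeStep K a) l hl
  refine Set.mem_iUnion.2 ⟨n + 1, ?_⟩
  rw [Function.iterate_succ_apply']
  exact Or.inr (Set.mem_biUnion (show l ∈ {l : List α | ∀ x ∈ l, x ∈ _} from hn) hy)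

theorem closeOff_subset {a c : Set α} (hac : a ⊆ c) (hc : IsClosedUnder K c) :
    closeOff K a ⊆ c := by
  refine Set.iUnion_subset fun n => ?_
  induction n with
  | zero => exact hac
  | succ n ih =>
    rw [Function.iterate_succ_apply']
    exact Set.union_subset ih (Set.iUnion₂_subset fun l hl => hc l fun x hx => ih (hl x hx))

theorem closeOff_mono {a b : Set α} (h : a ⊆ b) : closeOff K a ⊆ closeOff K b :=
  closeOff_subset (h.trans (subset_closeOff K b)) (isClosedUnder_closeOff K b)

/-- The operation takes finite lists, and a finite list from an increasing union already lies in one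
stage. -/
theorem closeOff_iUnion {f : ℕ → Set α} (hf : Monotone f) :
    closeOff K (⋃ n, f n) = ⋃ n, closeOff K (f n) := by
  refine Set.Subset.antisymm (closeOff_subset ?_ ?_) (Set.iUnion_subset fun n =>
    closeOff_mono (Set.subset_iUnion f n))
  · exact Set.iUnion_mono fun n => subset_closeOff K (f n)
  · intro l hl
    obtain ⟨n, hn⟩ := exists_forall_mem_of_monotone (fun i j hij => closeOff_mono (hf hij)) l hl
    exact (isClosedUnder_closeOff K (f n) l hn).trans
      (Set.subset_iUnion (fun n => closeOff K (f n)) n)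

theorem countable_closeOff (hK : ∀ l, (K l).Countable) {a : Set α} (ha : a.Countable) :
    (closeOff K a).Countable := by
  refine Set.countable_iUnion fun n => ?_
  induction n with
  | zero => exact ha
  | succ n ih =>
    rw [Function.iterate_succ_apply']
    exact ih.union ((countable_setOf_list ih).biUnion fun l _ => hK l)

/-- A stationary set of countable subsets of `Z` contains the trace of a countable set which is
closed under a given operation. -/
theorem exists_isClosedUnder (hZX : Z ⊆ X) (hK : ∀ l, (K l).Countable)
    (hKX : ∀ l, K l ⊆ X) {S : Set (Set α)} (hS : IsStationaryCountable Z S) :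
    ∃ N ∈ countableSubsets X, IsClosedUnder K N ∧ N ∩ Z ∈ S := by
  have hX : IsClosedUnder K X := fun l _ => hKX l
  -- The club consists of those `a` whose closure adds no new element of `Z`; one in `S` is then the
  -- trace of its own closure.
  have hclub : IsClubCountable Z {a | a ∈ countableSubsets Z ∧ closeOff K a ∩ Z = a} := by
    refine ⟨fun a ha => ha.1, fun a ha => ?_, fun f hf hmem => ⟨⟨?_, ?_⟩, ?_⟩⟩
    · let g : ℕ → Set α := fun n => (fun b => closeOff K b ∩ Z)^[n] a
      have hgs : ∀ n, g (n + 1) = closeOff K (g n) ∩ Z := fun n =>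
        Function.iterate_succ_apply' _ _ _
      have hgc : ∀ n, g n ∈ countableSubsets Z := by
        intro n
        induction n with
        | zero => exact ha
        | succ n ih =>
          rw [hgs]
          exact ⟨Set.inter_subset_right, (countable_closeOff hK ih.2).mono Set.inter_subset_left⟩
      have hgm : Monotone g := monotone_nat_of_le_succ fun n => by
        rw [hgs]
        exact Set.subset_inter (subset_closeOff K _) (hgc n).1
      refine ⟨⋃ n, g n, ⟨⟨Set.iUnion_subset fun n => (hgc n).1,
        Set.countable_iUnion fun n => (hgc n).2⟩, ?_⟩, Set.subset_iUnion g 0⟩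
      rw [closeOff_iUnion hgm]
      refine Set.Subset.antisymm ?_ ?_
      · rintro x ⟨hx, hxZ⟩
        obtain ⟨n, hn⟩ := Set.mem_iUnion.1 hx
        refine Set.mem_iUnion.2 ⟨n + 1, ?_⟩
        rw [hgs]
        exact ⟨hn, hxZ⟩
      · intro x hx
        obtain ⟨n, hn⟩ := Set.mem_iUnion.1 hx
        exact ⟨Set.mem_iUnion.2 ⟨n, subset_closeOff K _ hn⟩, (hgc n).1 hn⟩
    · exact Set.iUnion_subset fun n => (hmem n).1.1
    · exact Set.countable_iUnion fun n => (hmem n).1.2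
    · rw [closeOff_iUnion hf, Set.iUnion_inter]
      exact Set.iUnion_congr fun n => (hmem n).2
  obtain ⟨a, haS, haZ, ha⟩ := hS.2 _ hclub
  exact ⟨closeOff K a, ⟨closeOff_subset (haZ.1.trans hZX) hX, countable_closeOff hK haZ.2⟩,
    isClosedUnder_closeOff K a, by rwa [ha]⟩

/-- Every closed unbounded set is generated by an operation. -/
theorem exists_operation {D : Set (Set α)} (hD : IsClubCountable X D) :
    ∃ K : List α → Set α, (∀ l, K l ∈ D) ∧
      ∀ N, N ⊆ X → N.Countable → IsClosedUnder K N → N ∈ D := by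
  classical
  have hne : ∃ b, b ∈ D := by
    obtain ⟨b, hb, -⟩ := hD.unbounded ∅ ⟨Set.empty_subset _, Set.countable_empty⟩
    exact ⟨b, hb⟩
  have hstep : ∀ (x : α) (a : Set α), ∃ b, b ∈ D ∧ (a ∈ D → x ∈ X → insert x a ⊆ b) := by
    intro x a
    by_cases h : a ∈ D ∧ x ∈ X
    · obtain ⟨b, hb, h2⟩ := hD.unbounded (insert x a)
        ⟨Set.insert_subset h.2 (hD.subset h.1).1, (hD.subset h.1).2.insert x⟩
      exact ⟨b, hb, fun _ _ => h2⟩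
    · obtain ⟨b, hb⟩ := hne
      exact ⟨b, hb, fun h1 h2 => absurd ⟨h1, h2⟩ h⟩
  choose g hgD hg using hstep
  obtain ⟨b, hb⟩ := hne
  -- Folding `g` along a list gives a member of `D` that contains the list and, for list entries in
  -- `X`, grows each time an entry is prepended.
  let K : List α → Set α := fun l => l.foldr g b
  have hKD : ∀ l, K l ∈ D := by
    intro l
    cases l with
    | nil => exact hb
    | cons x l => exact hgD x _
  refine ⟨K, hKD, fun N hNX hNc hN => ?_⟩
  rcases N.eq_empty_or_nonempty with rfl | hNne
  · have h1 : K [] ⊆ ∅ := hN [] (by simp)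
    rw [← Set.subset_empty_iff.1 h1]
    exact hKD []
  · obtain ⟨e, he⟩ := hNc.exists_eq_range hNne
    have heN : ∀ n, e n ∈ N := fun n => by rw [he]; exact ⟨n, rfl⟩
    -- These lists are the initial segments of an enumeration of `N`, so the sets `K (L n)` form an
    -- increasing chain in `D` with union `N`.
    let L : ℕ → List α := fun n => Nat.rec [] (fun n l => e n :: l) n
    have hLN : ∀ n, ∀ x ∈ L n, x ∈ N := by
      intro n
      induction n with
      | zero => simp [L]
      | succ n ih =>
        intro x hx
        rcases List.mem_cons.1 (show x ∈ e n :: L n from hx) with rfl | hx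
        · exact heN n
        · exact ih x hx
    have hsub : ∀ n, insert (e n) (K (L n)) ⊆ K (L (n + 1)) := fun n =>
      hg (e n) (K (L n)) (hKD _) (hNX (heN n))
    have hUn : N = ⋃ n, K (L n) := by
      refine Set.Subset.antisymm (fun x hx => ?_) (Set.iUnion_subset fun n => hN _ (hLN n))
      rw [he] at hx
      obtain ⟨n, rfl⟩ := hx
      exact Set.mem_iUnion.2 ⟨n + 1, hsub n (Set.mem_insert _ _)⟩
    rw [hUn]
    exact hD.closed _ (monotone_nat_of_le_succ fun n =>
      (Set.subset_insert _ _).trans (hsub n)) fun n => hKD _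

/-- `N` contains witnesses for the relations `R i` with parameters in `N`. -/
def IsWitnessed {ι : Type*} (X : Set α) (R : ι → List α → α → Prop) (N : Set α) : Prop :=
  ∀ i l, (∀ x ∈ l, x ∈ N) → (∃ x ∈ X, R i l x) → ∃ x ∈ N, R i l x

/-- This lifts stationarity from `Z` to `X`: one operation generates `D` and also supplies witnesses
for all the relations. -/
theorem exists_isWitnessed {ι : Type*} [Countable ι] (R : ι → List α → α → Prop) (hZX : Z ⊆ X)
    {S : Set (Set α)} (hS : IsStationaryCountable Z S) {D : Set (Set α)}
    (hD : IsClubCountable X D) :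
    ∃ N ∈ D, N ∩ Z ∈ S ∧ IsWitnessed X R N := by
  obtain ⟨K, hKD, hK⟩ := exists_operation hD
  have hw : ∀ i l, ∃ s : Set α, s ⊆ X ∧ s.Countable ∧ ((∃ x ∈ X, R i l x) → ∃ x ∈ s, R i l x) := by
    intro i l
    by_cases h : ∃ x ∈ X, R i l x
    · obtain ⟨x, hx, hR⟩ := h
      exact ⟨{x}, by simpa using hx, Set.countable_singleton x, fun _ => ⟨x, rfl, hR⟩⟩
    · exact ⟨∅, Set.empty_subset _, Set.countable_empty, fun h' => absurd h' h⟩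
  choose W hWX hWc hW using hw
  obtain ⟨N, hN, hNK, hNS⟩ := exists_isClosedUnder (K := fun l => K l ∪ ⋃ i, W i l) hZX
    (fun l => (hD.subset (hKD l)).2.union (Set.countable_iUnion fun i => hWc i l))
    (fun l => Set.union_subset (hD.subset (hKD l)).1 (Set.iUnion_subset fun i => hWX i l)) hS
  refine ⟨N, hK N hN.1 hN.2 fun l hl => Set.subset_union_left.trans (hNK l hl), hNS,
    fun i l hl hex => ?_⟩
  obtain ⟨x, hx, hR⟩ := hW i l hex
  exact ⟨x, hNK l hl (Or.inr (Set.mem_iUnion.2 ⟨i, hx⟩)), hR⟩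

end Closure

/-! ### Elementary submodels -/

/-- The relation whose witnesses are required by the Tarski–Vaught test. -/
def tarskiVaught (θ : Cardinal.{u}) (i : Σ n, langSet.BoundedFormula Empty (n + 1))
    (l : List ZFSet.{u}) (x : ZFSet.{u}) : Prop :=
  ∃ (v : Fin i.1 → ↥(H θ)) (y : ↥(H θ)), l = List.ofFn (fun j => (v j : ZFSet.{u})) ∧
    x = y ∧ i.2.Realize default (Fin.snoc v y : Fin (i.1 + 1) → ↥(H θ))

theorem isElementaryInH_of_isWitnessed {θ : Cardinal.{u}} {N : Set ZFSet.{u}} (hN : N ⊆ H θ)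
    (h : IsWitnessed (H θ) (tarskiVaught θ) N) : IsElementaryInH θ N := by
  -- With no function symbols every subset is a substructure, so only the Tarski–Vaught test
  -- remains.
  let S : langSet.Substructure ↥(H θ) :=
    { carrier := {x | (x : ZFSet.{u}) ∈ N}
      fun_mem := fun f => Empty.elim f }
  have hS : S.IsElementary := by
    refine S.isElementary_of_exists fun n φ x a ha => ?_
    obtain ⟨y, hyN, v, b, h1, rfl, h2⟩ := h ⟨n, φ⟩ (List.ofFn fun j => ((x j : ↥(H θ)) : ZFSet.{u}))
      (by
        intro y hy
        obtain ⟨j, rfl⟩ := List.mem_ofFn.1 hy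
        exact (x j).2)
      ⟨a, a.2, fun j => x j, a, rfl, rfl, ha⟩
    refine ⟨⟨b, hyN⟩, ?_⟩
    have hv : v = fun j => (x j : ↥(H θ)) := by
      funext j
      exact Subtype.ext (congrFun (List.ofFn_injective h1) j).symm
    rw [hv] at h2
    exact h2
  refine ⟨⟨S, hS⟩, ?_⟩
  ext x
  constructor
  · exact fun hx => ⟨⟨x, hN hx⟩, hx, rfl⟩
  · rintro ⟨y, hy, rfl⟩
    exact hy

theorem countable_symbols_langSet : Countable langSet.Symbols := by
  have h1 : ∀ l, Countable (langSet.Functions l) := fun _ => inferInstanceAs (Countable Empty)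
  have h2 : ∀ l, Countable (langSet.Relations l) := fun l =>
    Function.Injective.countable (f := fun _ : SetRel l => ()) (by rintro ⟨⟩ ⟨⟩ _; rfl)
  exact inferInstanceAs (Countable ((Σ l, langSet.Functions l) ⊕ (Σ l, langSet.Relations l)))

theorem countable_symbols_langA : Countable langA.Symbols := by
  have h1 : ∀ l, Countable (langA.Functions l) := fun _ => inferInstanceAs (Countable Empty)
  have h2 : ∀ l, Countable (langA.Relations l) := fun l =>
    Function.Injective.countable
      (f := fun r : ARel l => match r with | .mem => 0 | .graph => 1 | .inY => 2)
      (by rintro ⟨⟩ ⟨⟩ h <;> first | rfl | simp at h)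
  exact inferInstanceAs (Countable ((Σ l, langA.Functions l) ⊕ (Σ l, langA.Relations l)))

theorem countable_formulas (L : FirstOrder.Language.{0, 0}) (hL : Countable L.Symbols) :
    Countable (Σ n, L.BoundedFormula Empty (n + 1)) := by
  have : ∀ n, Countable (L.BoundedFormula Empty (n + 1)) := fun n =>
    Function.Injective.countable
      (f := fun φ => (⟨n + 1, φ⟩ : Σ n, L.BoundedFormula Empty n)) sigma_mk_injective
  infer_instance

end AdequateForcing

namespace AdequateForcing

variable {π : Ordinal.{u} → ZFSet.{u}} {Y : Set ZFSet.{u}} {Γ : Set Ordinal.{u}}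

/-! ### Finite trees -/

namespace TreeData

variable {T : TreeData.{u}} {a b c : ZFSet.{u}}

theorem mem_maxNodes : a ∈ T.maxNodes ↔ a ∈ T.nodes ∧ ∀ b, ¬ T.Lt a b := by
  simp [maxNodes]

namespace IsFiniteTree

theorem left_mem (hT : T.IsFiniteTree) (h : T.Lt a b) : a ∈ T.nodes :=
  (ZFSet.pair_mem_prod.1 (hT.rel_subset h)).1

theorem right_mem (hT : T.IsFiniteTree) (h : T.Lt a b) : b ∈ T.nodes :=
  (ZFSet.pair_mem_prod.1 (hT.rel_subset h)).2

theorem le_trans (hT : T.IsFiniteTree) (h : T.Le a b) (h' : T.Le b c) : T.Le a c := by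
  rcases h with rfl | h
  · exact h'
  · rcases h' with rfl | h'
    · exact Or.inr h
    · exact Or.inr (hT.trans _ _ _ h h')

theorem lt_of_lt_of_le (hT : T.IsFiniteTree) (h : T.Lt a b) (h' : T.Le b c) : T.Lt a c := by
  rcases h' with rfl | h'
  · exact h
  · exact hT.trans _ _ _ h h'

theorem lt_of_le_of_lt (hT : T.IsFiniteTree) (h : T.Le a b) (h' : T.Lt b c) : T.Lt a c := by
  rcases h with rfl | h
  · exact h'
  · exact hT.trans _ _ _ h h'

theorem le_or_lt (hT : T.IsFiniteTree) (h : T.Le a c) (h' : T.Le b c) :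
    T.Le a b ∨ T.Lt b a := by
  rcases h with rfl | h <;> rcases h' with rfl | h'
  · exact Or.inl (Or.inl rfl)
  · exact Or.inr h'
  · exact Or.inl (Or.inr h)
  · rcases hT.tree _ _ _ h h' with h | h | h
    exacts [Or.inl (Or.inl h), Or.inl (Or.inr h), Or.inr h]

theorem eq_of_le_max (h : T.Le a b) (ha : a ∈ T.maxNodes) : a = b :=
  h.resolve_right ((mem_maxNodes.1 ha).2 b)

end IsFiniteTree

end TreeData

theorem Triple.IsCondition.val_unique {p : Triple.{u}} (hp : p.IsCondition π Y Γ)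
    {a x y : ZFSet.{u}} (hx : ZFSet.pair a x ∈ p.F) (hy : ZFSet.pair a y ∈ p.F) : x = y := by
  have ha : a ∈ p.T.maxNodes := (ZFSet.pair_mem_prod.1 (hp.func.1 hx)).1
  obtain ⟨z, -, hz⟩ := hp.func.2 a ha
  exact (hz x hx).trans (hz y hy).symm

theorem Triple.IsCondition.mem_maxNodes {p : Triple.{u}} (hp : p.IsCondition π Y Γ)
    {a x : ZFSet.{u}} (hx : ZFSet.pair a x ∈ p.F) : a ∈ p.T.maxNodes :=
  (ZFSet.pair_mem_prod.1 (hp.func.1 hx)).1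

theorem Triple.IsCondition.val_mem {p : Triple.{u}} (hp : p.IsCondition π Y Γ)
    {a x : ZFSet.{u}} (hx : ZFSet.pair a x ∈ p.F) : x ∈ (ω_ 2 : Ordinal.{u}).toZFSet :=
  (ZFSet.pair_mem_prod.1 (hp.func.1 hx)).2

/-! ### Amalgamation -/

/-- `s` reflects `r` inside `N`, as witnessed by the map `e` on nodes and the map `m` on those
models of `r` which are below `N`. -/
structure Reflects (π : Ordinal.{u} → ZFSet.{u}) (Y : Set ZFSet.{u}) (Γ : Set Ordinal.{u})
    (N : ZFSet.{u}) (r s : Triple.{u}) (e m : ZFSet.{u} → ZFSet.{u}) : Prop where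
  map_mem : ∀ x ∈ r.T.nodes, e x ∈ s.T.nodes
  map_lt : ∀ x ∈ r.T.nodes, ∀ y ∈ r.T.nodes, s.T.Lt (e x) (e y) ↔ r.T.Lt x y
  map_inj : ∀ x ∈ r.T.nodes, ∀ y ∈ r.T.nodes, e x = e y → x = y
  map_eq : ∀ x ∈ r.T.nodes, x ∈ N → e x = x
  -- A value outside `N` is reflected to one outside the trace `M ∩ N`, so it cannot coincide with a
  -- value in `M ∩ N` of a branch of `w`.
  val : ∀ a ξ, ZFSet.pair a ξ ∈ r.F → ∃ ξ', ZFSet.pair (e a) ξ' ∈ s.F ∧ (ξ ∈ N → ξ' = ξ) ∧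
    ∀ M ∈ r.A, IsBelow π Y Γ M N → (ξ ∉ N → ξ' ∉ M ∩ N) ∧ (ξ ∈ M → ξ' ∈ m M)
  model_mem : ∀ M ∈ r.A, IsBelow π Y Γ M N → m M ∈ s.A
  trace_mem : ∀ M ∈ r.A, IsBelow π Y Γ M N → M ∩ N ∈ s.A
  trace_subset : ∀ M ∈ r.A, IsBelow π Y Γ M N → M ∩ N ⊆ m M
  mem_of_mem : ∀ M ∈ r.A, IsBelow π Y Γ M N → ∀ c ∈ (ω_ 1 : Ordinal.{u}).toZFSet, c ∈ m M → c ∈ M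
  map_notMem : ∀ M ∈ r.A, IsBelow π Y Γ M N → ∀ x ∈ r.T.nodes, x ∉ N → e x ∉ m M

/-- The situation in which a condition `r` is amalgamated with a condition `w` inside `N` extending
a reflection `s` of `r`. -/
structure Amalgamable (π : Ordinal.{u} → ZFSet.{u}) (Y : Set ZFSet.{u}) (Γ : Set Ordinal.{u})
    (N : ZFSet.{u}) (r s w : Triple.{u}) (e m : ZFSet.{u} → ZFSet.{u}) : Prop where
  standing : Standing π Y Γ
  r_cond : r.IsCondition π Y Γ
  s_cond : s.IsCondition π Y Γ
  w_cond : w.IsCondition π Y Γ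
  reflects : Reflects π Y Γ N r s e m
  extend : w.Extends s
  N_mem : N ∈ r.A
  max_notMem : ∀ a ∈ r.T.maxNodes, a ∉ N
  node_mem : ∀ x ∈ w.T.nodes, x ∈ N
  val_mem : ∀ x ξ, ZFSet.pair x ξ ∈ w.F → ξ ∈ N
  hull_mem : ∀ L ∈ w.A, L ∈ Sk π Y N

section
variable (N : ZFSet.{u}) (r w : Triple.{u})

/-- The node `u` of `w` is put below the node `y` of `r`. -/
def Anchor (y u : ZFSet.{u}) : Prop :=
  (u ∈ N ∧ r.T.Lt u y) ∨
    -- The node `u` of `w` has the same value as `a`, so it must go below `a`. As `d` is also below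
    -- `a` and lies outside `N`, the node `u ∈ N` must then be below `d`, hence below `y`.
    ∃ a d ξ, d ∉ N ∧ d ∈ r.T.nodes ∧ r.T.Le d y ∧ r.T.Le d a ∧ ξ ∈ N ∧ ZFSet.pair a ξ ∈ r.F ∧
      ZFSet.pair u ξ ∈ w.F

/-- The order of the amalgamation. -/
def AmalgLt (x y : ZFSet.{u}) : Prop :=
  w.T.Lt x y ∨ (x ∉ N ∧ r.T.Lt x y) ∨
    (x ∈ w.T.nodes ∧ y ∈ r.T.nodes ∧ y ∉ N ∧ ∃ u, Anchor N r w y u ∧ w.T.Le x u)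

/-- The amalgamated tree. -/
noncomputable def amalgTree : TreeData.{u} where
  nodes := w.T.nodes ∪ r.T.nodes
  rel := ((w.T.nodes ∪ r.T.nodes).prod (w.T.nodes ∪ r.T.nodes)).sep
    fun p => ∃ x y, p = ZFSet.pair x y ∧ AmalgLt N r w x y

/-- The amalgamation of `r` and `w`. -/
noncomputable def amalg : Triple.{u} where
  T := amalgTree N r w
  F := ((amalgTree N r w).maxNodes.prod (ω_ 2 : Ordinal.{u}).toZFSet).sep
    fun p => ∃ x ξ, p = ZFSet.pair x ξ ∧ ((x ∉ N ∧ ZFSet.pair x ξ ∈ r.F) ∨ ZFSet.pair x ξ ∈ w.F)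
  A := r.A ∪ w.A

end

namespace Amalgamable

variable {N : ZFSet.{u}} {r s w : Triple.{u}} {e m : ZFSet.{u} → ZFSet.{u}} {a b c d x y z u v ξ : ZFSet.{u}}

theorem N_model (h : Amalgamable π Y Γ N r s w e m) : N ∈ models π Y :=
  h.r_cond.adequate.1 h.N_mem

theorem mem_of_le (h : Amalgamable π Y Γ N r s w e m) (hxy : r.T.Le x y) (hy : y ∈ N) : x ∈ N := by
  rcases hxy with rfl | hxy
  · exact hy
  · exact h.standing.mem_of_mem_of_mem h.N_model
      (h.r_cond.tree.nodes_subset (h.r_cond.tree.right_mem hxy)) hy (h.r_cond.tree.lt_of_lt _ _ hxy)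

theorem mem_of_mem_notMem (h : Amalgamable π Y Γ N r s w e m)
    (hx : x ∈ (ω_ 1 : Ordinal.{u}).toZFSet) (hy : y ∈ (ω_ 1 : Ordinal.{u}).toZFSet) (hxN : x ∈ N)
    (hyN : y ∉ N) : x ∈ y := by
  obtain ⟨α, hα, rfl⟩ := mem_toZFSet_iff.1 hx
  obtain ⟨β, hβ, rfl⟩ := mem_toZFSet_iff.1 hy
  rcases lt_trichotomy α β with hlt | rfl | hlt
  · exact toZFSet_mem_toZFSet_iff.2 hlt
  · exact absurd hxN hyN
  · exact absurd (h.standing.mem_of_mem_of_mem h.N_model hx hxN (toZFSet_mem_toZFSet_iff.2 hlt)) hyN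

/-- Of two comparable nodes of `r`, the one in `N` is below the one outside `N`. -/
theorem lt_of_mem_notMem (h : Amalgamable π Y Γ N r s w e m) (hx : x ∈ N) (hy : y ∉ N)
    (hxz : r.T.Le x z) (hyz : r.T.Le y z) : r.T.Lt x y := by
  rcases h.r_cond.tree.le_or_lt hyz hxz with h1 | h1
  · exact absurd (h.mem_of_le h1 hx) hy
  · exact h1

theorem map_mem (h : Amalgamable π Y Γ N r s w e m) (hx : x ∈ r.T.nodes) : e x ∈ w.T.nodes :=
  h.extend.endExtends.1 (h.reflects.map_mem x hx)

theorem map_lt (h : Amalgamable π Y Γ N r s w e m) (hx : x ∈ r.T.nodes) (hy : y ∈ r.T.nodes) :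
    w.T.Lt (e x) (e y) ↔ r.T.Lt x y :=
  (h.extend.endExtends.2 _ (h.reflects.map_mem x hx) _ (h.reflects.map_mem y hy)).trans
    (h.reflects.map_lt x hx y hy)

theorem map_le (h : Amalgamable π Y Γ N r s w e m) (hx : x ∈ r.T.nodes) (hy : y ∈ r.T.nodes) :
    w.T.Le (e x) (e y) ↔ r.T.Le x y :=
  or_congr ⟨fun h' => h.reflects.map_inj x hx y hy h', fun h' => by rw [h']⟩ (h.map_lt hx hy)

theorem node_of_max (ha : a ∈ r.T.maxNodes) : a ∈ r.T.nodes := (TreeData.mem_maxNodes.1 ha).1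

/-- Each branch of `r` corresponds to a branch of `w`. -/
theorem exists_max (h : Amalgamable π Y Γ N r s w e m) {ξ' : ZFSet.{u}}
    (hξ : ZFSet.pair (e a) ξ' ∈ s.F) :
    ∃ g ∈ w.T.maxNodes, w.T.Le (e a) g ∧ ZFSet.pair g ξ' ∈ w.F := by
  obtain ⟨g, hg, hle, x, h1, h2⟩ := h.extend.maximal _ (h.s_cond.mem_maxNodes hξ)
  obtain rfl := h.s_cond.val_unique h1 hξ
  exact ⟨g, hg, hle, h2⟩

/-- Values in `N` are fixed by the reflection and kept when `s` is extended to `w`; injectivity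
identifies the branch. -/
theorem map_le_of_val (h : Amalgamable π Y Γ N r s w e m) (hξ : ξ ∈ N)
    (ha : ZFSet.pair a ξ ∈ r.F) (hu : ZFSet.pair u ξ ∈ w.F) : w.T.Le (e a) u := by
  obtain ⟨ξ', h1, h2, -⟩ := h.reflects.val a ξ ha
  obtain rfl := h2 hξ
  obtain ⟨g, -, hle, hg⟩ := h.exists_max h1
  rwa [h.w_cond.inj u g _ hu hg]

/-- Values in `N` determine the branches of `r` above a node outside `N`. -/
theorem eq_of_val_mem (h : Amalgamable π Y Γ N r s w e m) {ζ : ZFSet.{u}} (hd : d ∉ N)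
    (hda : r.T.Le d a) (hdb : r.T.Le d b) (ha : ZFSet.pair a ξ ∈ r.F) (hb : ZFSet.pair b ζ ∈ r.F)
    (hξ : ξ ∈ N) (hζ : ζ ∈ N) : a = b := by
  by_contra hne
  have hda' : r.T.Lt d a := hda.resolve_left (by
    rintro rfl
    exact hne (TreeData.IsFiniteTree.eq_of_le_max hdb (h.r_cond.mem_maxNodes ha)))
  have hdb' : r.T.Lt d b := hdb.resolve_left (by
    rintro rfl
    exact hne (TreeData.IsFiniteTree.eq_of_le_max hda (h.r_cond.mem_maxNodes hb)).symm)
  -- Clause (4) for `N` itself would put `d` into `N`.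
  exact hd (h.r_cond.meet N h.N_mem a (h.r_cond.mem_maxNodes ha) b (h.r_cond.mem_maxNodes hb) hne
    ξ hξ ζ hζ ha hb d hda' hdb')

theorem anchor_of_le (h : Amalgamable π Y Γ N r s w e m) (hxy : r.T.Le x y)
    (hu : Anchor N r w x u) : Anchor N r w y u := by
  rcases hu with ⟨huN, hlt⟩ | ⟨a, d, ξ, h1, h2, h3, h4⟩
  · exact Or.inl ⟨huN, h.r_cond.tree.lt_of_lt_of_le hlt hxy⟩
  · exact Or.inr ⟨a, d, ξ, h1, h2, h.r_cond.tree.le_trans h3 hxy, h4⟩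

/-- Comparable nodes outside `N` have the same anchors: if the splitting node `d` is above `x`, then
`x` can take its place. -/
theorem anchor_of_ge (h : Amalgamable π Y Γ N r s w e m) (hx : x ∉ N) (hxn : x ∈ r.T.nodes)
    (hxy : r.T.Le x y) (hu : Anchor N r w y u) : Anchor N r w x u := by
  rcases hu with ⟨huN, hlt⟩ | ⟨a, d, ξ, h1, h2, h3, h4, h5⟩
  · exact Or.inl ⟨huN, h.lt_of_mem_notMem huN hx (Or.inr hlt) hxy⟩
  · rcases h.r_cond.tree.le_or_lt h3 hxy with hd | hd
    · exact Or.inr ⟨a, d, ξ, h1, h2, hd, h4, h5⟩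
    · exact Or.inr ⟨a, x, ξ, hx, hxn, Or.inl rfl, h.r_cond.tree.le_trans (Or.inr hd) h4, h5⟩

/-- The anchors of a node form a chain. -/
theorem anchor_le (h : Amalgamable π Y Γ N r s w e m) (hu : Anchor N r w y u)
    (hv : Anchor N r w y v) : w.T.Le u v ∨ w.T.Le v u := by
  -- A node `u` of `r` in `N` is below `d` and therefore below `a`; applying `e`, which fixes `u`,
  -- puts it below `e a` and so below `v`.
  have mixed : ∀ u v, u ∈ N → r.T.Lt u y → (∃ a d ξ, d ∉ N ∧ d ∈ r.T.nodes ∧ r.T.Le d y ∧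
      r.T.Le d a ∧ ξ ∈ N ∧ ZFSet.pair a ξ ∈ r.F ∧ ZFSet.pair v ξ ∈ w.F) → w.T.Le u v := by
    rintro u v huN hlt ⟨a, d, ξ, h1, h2, h3, h4, h5, h6, h7⟩
    have hud : r.T.Lt u d := h.lt_of_mem_notMem huN h1 (Or.inr hlt) h3
    have hua : r.T.Lt u a := h.r_cond.tree.lt_of_lt_of_le hud h4
    have hun := h.r_cond.tree.left_mem hlt
    have := (h.map_lt hun (h.r_cond.tree.right_mem hua)).2 hua
    rw [h.reflects.map_eq u hun huN] at this
    exact Or.inr (h.w_cond.tree.lt_of_lt_of_le this (h.map_le_of_val h5 h6 h7))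
  rcases hu with ⟨huN, hlt⟩ | hu <;> rcases hv with ⟨hvN, hlt'⟩ | hv
  · have hun := h.r_cond.tree.left_mem hlt
    have hvn := h.r_cond.tree.left_mem hlt'
    rcases h.r_cond.tree.le_or_lt (Or.inr hlt) (Or.inr hlt') with h1 | h1
    · left
      rw [← h.reflects.map_eq u hun huN, ← h.reflects.map_eq v hvn hvN]
      exact (h.map_le hun hvn).2 h1
    · right
      rw [← h.reflects.map_eq u hun huN, ← h.reflects.map_eq v hvn hvN]
      exact (h.map_le hvn hun).2 (Or.inr h1)
  · exact Or.inl (mixed u v huN hlt hv)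
  · exact Or.inr (mixed v u hvN hlt' hu)
  · obtain ⟨a, d, ξ, h1, h2, h3, h4, h5, h6, h7⟩ := hu
    obtain ⟨b, d', ζ, h1', h2', h3', h4', h5', h6', h7'⟩ := hv
    -- The lower of the two nodes `d`, `d'` is below both `a` and `b`, and their values are in `N`.
    have hab : a = b := by
      rcases h.r_cond.tree.le_or_lt h3 h3' with hd | hd
      · exact h.eq_of_val_mem h1 h4 (h.r_cond.tree.le_trans hd h4') h6 h6' h5 h5'
      · exact h.eq_of_val_mem h1' (h.r_cond.tree.le_trans (Or.inr hd) h4) h4' h6 h6' h5 h5'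
    subst hab
    obtain rfl := h.r_cond.val_unique h6 h6'
    exact Or.inl (Or.inl (h.w_cond.inj _ _ _ h7 h7'))

theorem amalgLt_mem (h : Amalgamable π Y Γ N r s w e m) (hxy : AmalgLt N r w x y) :
    x ∈ w.T.nodes ∪ r.T.nodes ∧ y ∈ w.T.nodes ∪ r.T.nodes := by
  simp only [ZFSet.mem_union]
  rcases hxy with hlt | ⟨-, hlt⟩ | ⟨h1, h2, -⟩
  · exact ⟨Or.inl (h.w_cond.tree.left_mem hlt), Or.inl (h.w_cond.tree.right_mem hlt)⟩
  · exact ⟨Or.inr (h.r_cond.tree.left_mem hlt), Or.inr (h.r_cond.tree.right_mem hlt)⟩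
  · exact ⟨Or.inl h1, Or.inr h2⟩

theorem lt_iff (h : Amalgamable π Y Γ N r s w e m) :
    (amalgTree N r w).Lt x y ↔ AmalgLt N r w x y := by
  simp only [TreeData.Lt, amalgTree, ZFSet.mem_sep, ZFSet.pair_mem_prod]
  constructor
  · rintro ⟨-, x', y', h1, h2⟩
    obtain ⟨rfl, rfl⟩ := ZFSet.pair_inj.1 h1
    exact h2
  · exact fun h' => ⟨h.amalgLt_mem h', x, y, rfl, h'⟩

/-- Below a node of `w` the order is that of `w`. -/
theorem amalgLt_of_mem (h : Amalgamable π Y Γ N r s w e m) (hy : y ∈ N)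
    (hxy : AmalgLt N r w x y) : w.T.Lt x y := by
  rcases hxy with hlt | ⟨hx, hlt⟩ | ⟨-, -, h2, -⟩
  · exact hlt
  · exact absurd (h.mem_of_le (Or.inr hlt) hy) hx
  · exact absurd hy h2

/-- Above a node outside `N` the order is that of `r`. -/
theorem amalgLt_of_notMem (h : Amalgamable π Y Γ N r s w e m) (hx : x ∉ N)
    (hxy : AmalgLt N r w x y) : r.T.Lt x y := by
  rcases hxy with hlt | ⟨-, hlt⟩ | ⟨h1, -⟩
  · exact absurd (h.node_mem x (h.w_cond.tree.left_mem hlt)) hx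
  · exact hlt
  · exact absurd (h.node_mem x h1) hx

theorem amalgLt_of_mem_notMem (h : Amalgamable π Y Γ N r s w e m) (hx : x ∈ N) (hy : y ∉ N)
    (hxy : AmalgLt N r w x y) :
    x ∈ w.T.nodes ∧ y ∈ r.T.nodes ∧ ∃ u, Anchor N r w y u ∧ w.T.Le x u := by
  rcases hxy with hlt | ⟨hx', -⟩ | ⟨h1, h2, h3, h4⟩
  · exact absurd (h.node_mem y (h.w_cond.tree.right_mem hlt)) hy
  · exact absurd hx hx'
  · exact ⟨h1, h2, h4⟩

/-- The critical case of linearity below a node is that of two nodes of `w` below a node outside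
`N`: each is below an anchor, and the anchors form a chain. -/
theorem isFiniteTree (h : Amalgamable π Y Γ N r s w e m) : (amalgTree N r w).IsFiniteTree := by
  have hsub : w.T.nodes ∪ r.T.nodes ⊆ (ω_ 1 : Ordinal.{u}).toZFSet := by
    intro z hz
    rcases ZFSet.mem_union.1 hz with hz | hz
    exacts [h.w_cond.tree.nodes_subset hz, h.r_cond.tree.nodes_subset hz]
  refine ⟨hsub, ?_, fun z hz => ?_, fun x hx => ?_, fun x y z hxy hyz => ?_,
    fun x y z hxz hyz => ?_, fun x y hxy => ?_⟩
  · change ((w.T.nodes ∪ r.T.nodes : ZFSet.{u}) : Set ZFSet.{u}).Finite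
    rw [ZFSet.coe_union]
    exact h.w_cond.tree.nodes_finite.union h.r_cond.tree.nodes_finite
  · simp only [amalgTree, ZFSet.mem_sep] at hz
    exact hz.1
  · rw [h.lt_iff] at hx
    by_cases hN : x ∈ N
    · exact h.w_cond.tree.irrefl x (h.amalgLt_of_mem hN hx)
    · exact h.r_cond.tree.irrefl x (h.amalgLt_of_notMem hN hx)
  · rw [h.lt_iff] at hxy hyz ⊢
    by_cases hy : y ∈ N
    · have h1 := h.amalgLt_of_mem hy hxy
      by_cases hz : z ∈ N
      · exact Or.inl (h.w_cond.tree.trans _ _ _ h1 (h.amalgLt_of_mem hz hyz))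
      · obtain ⟨-, h2, u, h3, h4⟩ := h.amalgLt_of_mem_notMem hy hz hyz
        exact Or.inr (Or.inr ⟨h.w_cond.tree.left_mem h1, h2, hz, u, h3,
          Or.inr (h.w_cond.tree.lt_of_lt_of_le h1 h4)⟩)
    · have h1 := h.amalgLt_of_notMem hy hyz
      by_cases hx : x ∈ N
      · obtain ⟨h2, -, u, h3, h4⟩ := h.amalgLt_of_mem_notMem hx hy hxy
        exact Or.inr (Or.inr ⟨h2, h.r_cond.tree.right_mem h1,
          fun hz => hy (h.mem_of_le (Or.inr h1) hz), u, h.anchor_of_le (Or.inr h1) h3, h4⟩)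
      · exact Or.inr (Or.inl ⟨hx, h.r_cond.tree.trans _ _ _ (h.amalgLt_of_notMem hx hxy) h1⟩)
  · rw [h.lt_iff] at hxz hyz
    simp only [h.lt_iff]
    have mixed : ∀ x y, x ∈ N → y ∉ N → AmalgLt N r w x z → AmalgLt N r w y z →
        AmalgLt N r w x y := by
      intro x y hx hy hxz hyz
      have h1 := h.amalgLt_of_notMem hy hyz
      obtain ⟨h2, -, u, h3, h4⟩ := h.amalgLt_of_mem_notMem hx
        (fun hz => hy (h.mem_of_le (Or.inr h1) hz)) hxz
      have hyn := h.r_cond.tree.left_mem h1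
      exact Or.inr (Or.inr ⟨h2, hyn, hy, u, h.anchor_of_ge hy hyn (Or.inr h1) h3, h4⟩)
    have hw : ∀ v, w.T.Le x v → w.T.Le y v → x = y ∨ AmalgLt N r w x y ∨ AmalgLt N r w y x := by
      intro v hx hy
      rcases h.w_cond.tree.le_or_lt hx hy with (h1 | h1) | h1
      exacts [Or.inl h1, Or.inr (Or.inl (Or.inl h1)), Or.inr (Or.inr (Or.inl h1))]
    by_cases hx : x ∈ N <;> by_cases hy : y ∈ N
    · by_cases hz : z ∈ N
      · exact hw z (Or.inr (h.amalgLt_of_mem hz hxz)) (Or.inr (h.amalgLt_of_mem hz hyz))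
      · obtain ⟨-, -, u, h3, h4⟩ := h.amalgLt_of_mem_notMem hx hz hxz
        obtain ⟨-, -, v, h3', h4'⟩ := h.amalgLt_of_mem_notMem hy hz hyz
        rcases h.anchor_le h3 h3' with huv | huv
        · exact hw v (h.w_cond.tree.le_trans h4 huv) h4'
        · exact hw u h4 (h.w_cond.tree.le_trans h4' huv)
    · exact Or.inr (Or.inl (mixed x y hx hy hxz hyz))
    · exact Or.inr (Or.inr (mixed y x hy hx hyz hxz))
    · rcases h.r_cond.tree.tree _ _ _ (h.amalgLt_of_notMem hx hxz) (h.amalgLt_of_notMem hy hyz)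
        with h1 | h1 | h1
      exacts [Or.inl h1, Or.inr (Or.inl (Or.inr (Or.inl ⟨hx, h1⟩))),
        Or.inr (Or.inr (Or.inr (Or.inl ⟨hy, h1⟩)))]
  · rw [h.lt_iff] at hxy
    have hm := h.amalgLt_mem hxy
    by_cases hx : x ∈ N <;> by_cases hy : y ∈ N
    · exact h.w_cond.tree.lt_of_lt _ _ (h.amalgLt_of_mem hy hxy)
    · exact h.mem_of_mem_notMem (hsub hm.1) (hsub hm.2) hx hy
    · exact h.w_cond.tree.lt_of_lt _ _ (h.amalgLt_of_mem hy hxy)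
    · exact h.r_cond.tree.lt_of_lt _ _ (h.amalgLt_of_notMem hx hxy)

theorem mem_max_of_notMem (h : Amalgamable π Y Γ N r s w e m) (hx : x ∉ N) :
    x ∈ (amalgTree N r w).maxNodes ↔ x ∈ r.T.maxNodes := by
  rw [TreeData.mem_maxNodes, TreeData.mem_maxNodes]
  refine and_congr ⟨fun h' => ?_, fun h' => ZFSet.mem_union.2 (Or.inr h')⟩
    (forall_congr' fun y => not_congr ?_)
  · exact (ZFSet.mem_union.1 h').resolve_left fun h'' => hx (h.node_mem x h'')
  · rw [h.lt_iff]
    exact ⟨h.amalgLt_of_notMem hx, fun h' => Or.inr (Or.inl ⟨hx, h'⟩)⟩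

/-- A maximal node of `w` is below a maximal node of `r` with the same value. -/
theorem lt_of_val (h : Amalgamable π Y Γ N r s w e m) (hξ : ξ ∈ N) (ha : ZFSet.pair a ξ ∈ r.F)
    (hx : ZFSet.pair x ξ ∈ w.F) : AmalgLt N r w x a := by
  have ham := h.r_cond.mem_maxNodes ha
  have han := h.max_notMem a ham
  exact Or.inr (Or.inr ⟨(TreeData.mem_maxNodes.1 (h.w_cond.mem_maxNodes hx)).1, node_of_max ham,
    han, x, Or.inr ⟨a, a, ξ, han, node_of_max ham, Or.inl rfl, Or.inl rfl, hξ, ha, hx⟩, Or.inl rfl⟩)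

theorem mem_max_of_mem (h : Amalgamable π Y Γ N r s w e m) (hx : x ∈ N)
    (hm : x ∈ (amalgTree N r w).maxNodes) : x ∈ w.T.maxNodes := by
  rw [TreeData.mem_maxNodes] at hm ⊢
  refine ⟨?_, fun y hy => hm.2 y (h.lt_iff.2 (Or.inl hy))⟩
  rcases ZFSet.mem_union.1 hm.1 with h1 | h1
  · exact h1
  · rw [← h.reflects.map_eq x h1 hx]
    exact h.map_mem h1

/-- A node newly placed above `x` is outside `N`, and `x` is itself an anchor of it. An anchor of
the first kind would have a proper successor in `w` through `e`, so a branch of `r` shares the value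
of `x`. -/
theorem mem_max_or (h : Amalgamable π Y Γ N r s w e m) (hx : x ∈ w.T.maxNodes) :
    x ∈ (amalgTree N r w).maxNodes ∨
      ∃ a ξ, ξ ∈ N ∧ ZFSet.pair a ξ ∈ r.F ∧ ZFSet.pair x ξ ∈ w.F := by
  by_cases hm : x ∈ (amalgTree N r w).maxNodes
  · exact Or.inl hm
  · right
    rw [TreeData.mem_maxNodes] at hm hx
    have hxV : x ∈ (amalgTree N r w).nodes := ZFSet.mem_union.2 (Or.inl hx.1)
    push Not at hm
    obtain ⟨y, hy⟩ := hm hxV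
    rw [h.lt_iff] at hy
    have hxN := h.node_mem x hx.1
    by_cases hyN : y ∈ N
    · exact absurd (h.amalgLt_of_mem hyN hy) (hx.2 y)
    · obtain ⟨-, hyn, u, hu, hxu⟩ := h.amalgLt_of_mem_notMem hxN hyN hy
      obtain rfl : x = u := hxu.resolve_right (hx.2 u)
      rcases hu with ⟨-, hlt⟩ | ⟨a, d, ξ, -, -, -, -, h1, h2, h3⟩
      · have hxn := h.r_cond.tree.left_mem hlt
        have := (h.map_lt hxn hyn).2 hlt
        rw [h.reflects.map_eq x hxn hxN] at this
        exact absurd this (hx.2 _)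
      · exact ⟨a, ξ, h1, h2, h3⟩

theorem val_iff (h : Amalgamable π Y Γ N r s w e m) :
    ZFSet.pair x ξ ∈ (amalg N r w).F ↔ x ∈ (amalgTree N r w).maxNodes ∧
      ((x ∉ N ∧ ZFSet.pair x ξ ∈ r.F) ∨ (x ∈ N ∧ ZFSet.pair x ξ ∈ w.F)) := by
  simp only [amalg, ZFSet.mem_sep, ZFSet.pair_mem_prod]
  constructor
  · rintro ⟨⟨h1, -⟩, x', ξ', h2, h3⟩
    obtain ⟨rfl, rfl⟩ := ZFSet.pair_inj.1 h2
    exact ⟨h1, h3.imp id fun h4 =>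
      ⟨h.node_mem _ (TreeData.mem_maxNodes.1 (h.w_cond.mem_maxNodes h4)).1, h4⟩⟩
  · rintro ⟨h1, h2⟩
    refine ⟨⟨h1, ?_⟩, x, ξ, rfl, h2.imp id And.right⟩
    rcases h2 with h2 | h2
    exacts [h.r_cond.val_mem h2.2, h.w_cond.val_mem h2.2]

theorem extends_w (h : Amalgamable π Y Γ N r s w e m) : (amalg N r w).Extends w := by
  refine ⟨⟨fun x hx => ZFSet.mem_union.2 (Or.inl hx), fun x hx y hy => ?_⟩,
    fun M hM => ZFSet.mem_union.2 (Or.inr hM), fun x hx => ?_⟩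
  · exact h.lt_iff.trans ⟨h.amalgLt_of_mem (h.node_mem y hy), Or.inl⟩
  · obtain ⟨ξ, hξ, -⟩ := h.w_cond.func.2 x hx
    have hxN := h.node_mem x (TreeData.mem_maxNodes.1 hx).1
    rcases h.mem_max_or hx with hm | ⟨a, ζ, hζ, ha, hxζ⟩
    · exact ⟨x, hm, Or.inl rfl, ξ, hξ, h.val_iff.2 ⟨hm, Or.inr ⟨hxN, hξ⟩⟩⟩
    · have ham := h.r_cond.mem_maxNodes ha
      have han := h.max_notMem a ham
      have hm := (h.mem_max_of_notMem han).2 ham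
      exact ⟨a, hm, Or.inr (h.lt_iff.2 (h.lt_of_val hζ ha hxζ)), ζ, hxζ,
        h.val_iff.2 ⟨hm, Or.inl ⟨han, ha⟩⟩⟩

/-- No new relation appears between nodes of `r`, because `e` embeds `r` into `w` and fixes the
nodes in `N`. -/
theorem extends_r (h : Amalgamable π Y Γ N r s w e m) : (amalg N r w).Extends r := by
  refine ⟨⟨fun x hx => ZFSet.mem_union.2 (Or.inr hx), fun x hx y hy => ?_⟩,
    fun M hM => ZFSet.mem_union.2 (Or.inl hM), fun a ha => ?_⟩
  · refine h.lt_iff.trans ⟨fun hxy => ?_, fun hxy => ?_⟩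
    · by_cases hxN : x ∈ N
      · by_cases hyN : y ∈ N
        · have := h.amalgLt_of_mem hyN hxy
          rwa [← h.reflects.map_eq x hx hxN, ← h.reflects.map_eq y hy hyN, h.map_lt hx hy] at this
        · obtain ⟨-, -, u, hu, hxu⟩ := h.amalgLt_of_mem_notMem hxN hyN hxy
          rcases hu with ⟨huN, hlt⟩ | ⟨a, d, ξ, h1, h2, h3, h4, h5, h6, h7⟩
          · have hun := h.r_cond.tree.left_mem hlt
            rw [← h.reflects.map_eq x hx hxN, ← h.reflects.map_eq u hun huN,
              h.map_le hx hun] at hxu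
            exact h.r_cond.tree.lt_of_le_of_lt hxu hlt
          · have han := h.r_cond.mem_maxNodes h6
            rw [← h.reflects.map_eq x hx hxN] at hxu
            -- Both `x` and `e a` are below `u` in `w`, hence comparable there; maximality of `a` in
            -- `r` decides the direction.
            have hxa : r.T.Le x a := by
              rcases h.w_cond.tree.le_or_lt hxu (h.map_le_of_val h5 h6 h7) with h8 | h8
              · exact (h.map_le hx (node_of_max han)).1 h8
              · exact absurd ((h.map_lt (node_of_max han) hx).1 h8)
                  ((TreeData.mem_maxNodes.1 han).2 x)
            exact h.r_cond.tree.lt_of_lt_of_le (h.lt_of_mem_notMem hxN h1 hxa h4) h3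
      · exact h.amalgLt_of_notMem hxN hxy
    · by_cases hxN : x ∈ N
      · by_cases hyN : y ∈ N
        · left
          rwa [← h.reflects.map_eq x hx hxN, ← h.reflects.map_eq y hy hyN, h.map_lt hx hy]
        · refine Or.inr (Or.inr ⟨?_, hy, hyN, x, Or.inl ⟨hxN, hxy⟩, Or.inl rfl⟩)
          rw [← h.reflects.map_eq x hx hxN]
          exact h.map_mem hx
      · exact Or.inr (Or.inl ⟨hxN, hxy⟩)
  · obtain ⟨ξ, hξ, -⟩ := h.r_cond.func.2 a ha
    have han := h.max_notMem a ha
    have hm := (h.mem_max_of_notMem han).2 ha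
    exact ⟨a, hm, Or.inl rfl, ξ, hξ, h.val_iff.2 ⟨hm, Or.inl ⟨han, hξ⟩⟩⟩

end Amalgamable

end AdequateForcing

/-! ### The amalgamation is a condition. -/

namespace AdequateForcing

variable {π : Ordinal.{u} → ZFSet.{u}} {Y : Set ZFSet.{u}} {Γ : Set Ordinal.{u}}

/-- `L` is a model of `w` which stands in for the model `M` of the amalgamation. -/
structure StandsFor (N : ZFSet.{u}) (r s w : Triple.{u}) (e : ZFSet.{u} → ZFSet.{u})
    (M L : ZFSet.{u}) : Prop where
  mem : L ∈ w.A
  mem_of_mem_inter : ∀ ξ ∈ M, ξ ∈ N → ξ ∈ L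
  countable_mem : ∀ c ∈ (ω_ 1 : Ordinal.{u}).toZFSet, c ∈ L → c ∈ M
  val : ∀ x ξ, ZFSet.pair x ξ ∈ r.F → ξ ∈ M → ∃ ξ' ∈ L, ZFSet.pair (e x) ξ' ∈ s.F ∧
    (ξ ∈ N → ξ' = ξ) ∧ (ξ ∉ N → ∀ ζ ∈ M, ζ ∈ N → ζ ≠ ξ')
  meet : ∀ x y ξ ζ d, ZFSet.pair x ξ ∈ r.F → ZFSet.pair y ζ ∈ r.F → x ≠ y → ξ ∈ M → ζ ∈ M →
    r.T.Le d x → r.T.Le d y → d ∈ N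
  map_notMem : ∀ x ξ d, ZFSet.pair x ξ ∈ r.F → ξ ∈ M → ξ ∉ N → d ∈ r.T.nodes → d ∉ N → e d ∉ L

namespace Amalgamable

variable {N : ZFSet.{u}} {r s w : Triple.{u}} {e m : ZFSet.{u} → ZFSet.{u}}
  {a b c d x y z u v ξ M L : ZFSet.{u}}

theorem lt_of_le_of_ne_max {x y : ZFSet.{u}}
    (hx : x ∈ r.T.maxNodes) (hy : y ∈ r.T.maxNodes) (hne : x ≠ y) (hdx : r.T.Le d x)
    (hdy : r.T.Le d y) : r.T.Lt d x ∧ r.T.Lt d y := by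
  constructor
  · refine hdx.resolve_left ?_
    rintro rfl
    exact hne (TreeData.IsFiniteTree.eq_of_le_max hdy hx)
  · refine hdy.resolve_left ?_
    rintro rfl
    exact hne (TreeData.IsFiniteTree.eq_of_le_max hdx hy).symm

/-- A model of `w` stands for itself, and a model of `r` below `N` is represented by its reflection.
Any other model of `r` contains all countable ordinals of `N` and needs no substitute. -/
theorem exists_standsFor (h : Amalgamable π Y Γ N r s w e m) (hM : M ∈ (amalg N r w).A) :
    (M ∈ r.A ∧ ∀ x ∈ (ω_ 1 : Ordinal.{u}).toZFSet, x ∈ N → x ∈ M) ∨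
      ∃ L, StandsFor N r s w e M L := by
  have hMm : M ∈ r.A ∨ M ∈ w.A := ZFSet.mem_union.1 hM
  by_cases hw : M ∈ w.A
  · right
    have hMN : M ⊆ N := h.standing.subset_of_mem_Sk h.N_model
      (h.w_cond.adequate.1 hw).1 (h.hull_mem M hw)
    refine ⟨M, hw, fun ξ hξ _ => hξ, fun c _ hc => hc, fun x ξ hx hξ => ?_,
      fun x y ξ ζ d hx hy hne hξ hζ hdx hdy => ?_, fun x ξ d _ hξ hξN => absurd (hMN hξ) hξN⟩
    · obtain ⟨ξ', h1, h2, -⟩ := h.reflects.val x ξ hx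
      obtain rfl := h2 (hMN hξ)
      exact ⟨ξ', hξ, h1, fun _ => rfl, fun hn => absurd (hMN hξ) hn⟩
    · by_contra hd
      exact hne (h.eq_of_val_mem hd hdx hdy hx hy (hMN hξ) (hMN hζ))
  · have hr := hMm.resolve_right hw
    rcases h.standing.isBelow_or (h.r_cond.adequate.1 hr) h.N_model
      (h.r_cond.adequate.2 M hr N h.N_mem) with hb | hb
    · right
      refine ⟨m M, h.extend.subset (h.reflects.model_mem M hr hb),
        fun ξ hξ hξN => h.reflects.trace_subset M hr hb (ZFSet.mem_inter.2 ⟨hξ, hξN⟩),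
        h.reflects.mem_of_mem M hr hb, fun x ξ hx hξ => ?_,
        fun x y ξ ζ d hx hy hne hξ hζ hdx hdy => ?_,
        fun x ξ d _ _ _ hd hdN => h.reflects.map_notMem M hr hb d hd hdN⟩
      · obtain ⟨ξ', h1, h2, h3⟩ := h.reflects.val x ξ hx
        refine ⟨ξ', (h3 M hr hb).2 hξ, h1, h2, fun hn ζ hζ hζN => ?_⟩
        rintro rfl
        exact (h3 M hr hb).1 hn (ZFSet.mem_inter.2 ⟨hζ, hζN⟩)
      · have hxm := h.r_cond.mem_maxNodes hx
        have hym := h.r_cond.mem_maxNodes hy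
        obtain ⟨h1, h2⟩ := lt_of_le_of_ne_max hxm hym hne hdx hdy
        exact hb.2.2 d (h.r_cond.tree.nodes_subset (h.r_cond.tree.left_mem h1))
          (h.r_cond.meet M hr x hxm y hym hne ξ hξ ζ hζ hx hy d h1 h2)
    · exact Or.inl ⟨hr, hb⟩

/-- The branch `x'` of `w` with value `ξ'` in `L` stands for the branch `x` of the amalgamation with
value `ξ` in `M`. -/
def BranchFor (N : ZFSet.{u}) (r w : Triple.{u}) (e : ZFSet.{u} → ZFSet.{u})
    (M L x ξ x' ξ' : ZFSet.{u}) : Prop :=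
  x' ∈ w.T.maxNodes ∧ ξ' ∈ L ∧ ZFSet.pair x' ξ' ∈ w.F ∧
    ((x ∈ N ∧ x' = x ∧ ξ' = ξ ∧ ξ ∈ N) ∨
      (x ∉ N ∧ ZFSet.pair x ξ ∈ r.F ∧ w.T.Le (e x) x' ∧ (ξ ∈ N → ξ' = ξ) ∧
        (ξ ∉ N → ∀ ζ ∈ M, ζ ∈ N → ζ ≠ ξ')))

theorem exists_branchFor (h : Amalgamable π Y Γ N r s w e m) (hL : StandsFor N r s w e M L)
    (hx : ZFSet.pair x ξ ∈ (amalg N r w).F) (hξ : ξ ∈ M) :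
    ∃ x' ξ', BranchFor N r w e M L x ξ x' ξ' := by
  obtain ⟨hm, ⟨hxN, hx⟩ | ⟨hxN, hx⟩⟩ := h.val_iff.1 hx
  · obtain ⟨ξ', h1, h2, h3, h4⟩ := hL.val x ξ hx hξ
    obtain ⟨g, hg, hle, hgv⟩ := h.exists_max h2
    exact ⟨g, ξ', hg, h1, hgv, Or.inr ⟨hxN, hx, hle, h3, h4⟩⟩
  · have hξN := h.val_mem x ξ hx
    exact ⟨x, ξ, h.w_cond.mem_maxNodes hx, hL.mem_of_mem_inter ξ hξ hξN, hx,
      Or.inl ⟨hxN, rfl, rfl, hξN⟩⟩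

/-- The delicate case has `x ∈ N` and `y ∉ N`. If the value of `y` is in `N`, equality would place
`x` below `y`, against maximality; otherwise the reflected value of `y` avoids `M ∩ N`, which
contains the value of `x`. -/
theorem branchFor_ne (h : Amalgamable π Y Γ N r s w e m) {ζ x' ξ' y' ζ' : ZFSet.{u}} (hne : x ≠ y)
    (hxm : x ∈ (amalgTree N r w).maxNodes) (hym : y ∈ (amalgTree N r w).maxNodes)
    (hξ : ξ ∈ M) (hζ : ζ ∈ M)
    (hx : BranchFor N r w e M L x ξ x' ξ') (hy : BranchFor N r w e M L y ζ y' ζ') : x' ≠ y' := by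
  have mixed : ∀ x ξ x' ξ' y ζ y' ζ', x ∈ (amalgTree N r w).maxNodes → ξ ∈ M →
      BranchFor N r w e M L x ξ x' ξ' → BranchFor N r w e M L y ζ y' ζ' → x ∈ N → y ∉ N →
      x' ≠ y' := by
    rintro x ξ x' ξ' y ζ y' ζ' hxm hξ ⟨-, -, hx', hx⟩ ⟨-, -, hy', hy⟩ hxN hyN rfl
    obtain ⟨-, rfl, rfl, hξN⟩ := hx.resolve_right fun h' => h'.1 hxN
    obtain ⟨-, hyF, -, h1, h2⟩ := hy.resolve_left fun h' => hyN h'.1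
    obtain rfl := h.w_cond.val_unique hx' hy'
    by_cases hζN : ζ ∈ N
    · obtain rfl := h1 hζN
      exact (TreeData.mem_maxNodes.1 hxm).2 y (h.lt_iff.2 (h.lt_of_val hξN hyF hx'))
    · exact h2 hζN ξ' hξ hξN rfl
  by_cases hxN : x ∈ N <;> by_cases hyN : y ∈ N
  · obtain ⟨-, rfl, -⟩ := hx.2.2.2.resolve_right fun h' => h'.1 hxN
    obtain ⟨-, rfl, -⟩ := hy.2.2.2.resolve_right fun h' => h'.1 hyN
    exact hne
  · exact mixed _ _ _ _ _ _ _ _ hxm hξ hx hy hxN hyN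
  · exact (mixed _ _ _ _ _ _ _ _ hym hζ hy hx hyN hxN).symm
  · obtain ⟨-, hxF, hlex, -⟩ := hx.2.2.2.resolve_left fun h' => hxN h'.1
    obtain ⟨-, hyF, hley, -⟩ := hy.2.2.2.resolve_left fun h' => hyN h'.1
    rintro rfl
    have hxr := h.r_cond.mem_maxNodes hxF
    have hyr := h.r_cond.mem_maxNodes hyF
    rcases h.w_cond.tree.le_or_lt hlex hley with h1 | h1
    · exact hne (TreeData.IsFiniteTree.eq_of_le_max
        ((h.map_le (node_of_max hxr) (node_of_max hyr)).1 h1) hxr)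
    · exact (TreeData.mem_maxNodes.1 hyr).2 x
        ((h.map_lt (node_of_max hyr) (node_of_max hxr)).1 h1)

/-- A node of `w` below a branch of the amalgamation is below the corresponding branch of `w`,
unless it was put there because of another branch through a common node outside `N`. -/
theorem le_branchFor_or (h : Amalgamable π Y Γ N r s w e m) {x' ξ' : ZFSet.{u}}
    (hx : BranchFor N r w e M L x ξ x' ξ') (hc : c ∈ N) (hcx : AmalgLt N r w c x) :
    w.T.Le c x' ∨ ∃ d, d ∉ N ∧ x ∉ N ∧ ZFSet.pair x ξ ∈ r.F ∧ ξ ∉ N ∧ r.T.Lt d x ∧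
      w.T.Lt (e d) c ∧ w.T.Lt (e d) x' := by
  obtain ⟨hxm, hξL, hxw, ⟨hxN, rfl, rfl, -⟩ | ⟨hxN, hxF, hle, h1, -⟩⟩ := hx
  · exact Or.inl (Or.inr (h.amalgLt_of_mem hxN hcx))
  · obtain ⟨hcw, hxn, u, hu, hcu⟩ := h.amalgLt_of_mem_notMem hc hxN hcx
    rcases hu with ⟨huN, hlt⟩ | ⟨a, d, ζ, hdN, hdn, hdx, hda, hζ, haF, huF⟩
    · left
      have hun := h.r_cond.tree.left_mem hlt
      have h2 := (h.map_lt hun hxn).2 hlt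
      rw [h.reflects.map_eq u hun huN] at h2
      exact h.w_cond.tree.le_trans hcu (Or.inr (h.w_cond.tree.lt_of_lt_of_le h2 hle))
    · by_cases hax : a = x
      · subst hax
        obtain rfl := h.r_cond.val_unique hxF haF
        obtain rfl := h1 hζ
        rw [h.w_cond.inj _ _ _ hxw huF]
        exact Or.inl hcu
      -- The node `c` was put below `x` because of another branch `a` through `d`. Both `c` and `e
      -- d` are below `u`, and only `e d < c` leads to the exception.
      · have ham := h.r_cond.mem_maxNodes haF
        obtain ⟨hda', hdx'⟩ := lt_of_le_of_ne_max ham (h.r_cond.mem_maxNodes hxF) hax hda hdx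
        have h2 : w.T.Lt (e d) x' :=
          h.w_cond.tree.lt_of_lt_of_le ((h.map_lt hdn hxn).2 hdx') hle
        have h3 : w.T.Lt (e d) u := h.w_cond.tree.lt_of_lt_of_le
          ((h.map_lt hdn (node_of_max ham)).2 hda') (h.map_le_of_val hζ haF huF)
        rcases h.w_cond.tree.le_or_lt hcu (Or.inr h3) with h4 | h4
        · exact Or.inl (h.w_cond.tree.le_trans h4 (Or.inr h2))
        · refine Or.inr ⟨d, hdN, hxN, hxF, fun hξ => hax ?_, hdx', h4, h2⟩
          exact h.eq_of_val_mem hdN hda hdx haF hxF hζ hξ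

/-- The exceptional alternative cannot occur. If `y ∈ N`, clause (4) for `L` in `w` gives `e d ∈ L`,
against `map_notMem`. If `y ∉ N`, an anchor in `N` of the first kind would force `d ∈ N`, and one of
the second kind gives `x` and `y` a common node of `r` outside `N`, against `StandsFor.meet`. -/
theorem not_lt_common (h : Amalgamable π Y Γ N r s w e m) (hL : StandsFor N r s w e M L)
    {ζ x' ξ' y' ζ' : ZFSet.{u}} (hne : x ≠ y) (hne' : x' ≠ y')
    (hx : BranchFor N r w e M L x ξ x' ξ') (hy : BranchFor N r w e M L y ζ y' ζ')
    (hξ : ξ ∈ M) (hζ : ζ ∈ M) (hc : c ∈ N) (hcy : AmalgLt N r w c y) (hdN : d ∉ N)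
    (hxF : ZFSet.pair x ξ ∈ r.F) (hξN : ξ ∉ N) (hdx : r.T.Lt d x) (hdc : w.T.Lt (e d) c)
    (hdx' : w.T.Lt (e d) x') : False := by
  have hdn := h.r_cond.tree.left_mem hdx
  obtain ⟨hym, hζL, hyw, ⟨hyN, rfl, rfl, -⟩ | ⟨hyN, hyF, hle, h1, -⟩⟩ := hy
  · have hdy := h.w_cond.tree.trans _ _ _ hdc (h.amalgLt_of_mem hyN hcy)
    exact hL.map_notMem x ξ d hxF hξ hξN hdn hdN (h.w_cond.meet L hL.mem x' hx.1 _ hym hne'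
      ξ' hx.2.1 _ hζL hx.2.2.1 hyw _ hdx' hdy)
  · obtain ⟨hcw, hyn, u, hu, hcu⟩ := h.amalgLt_of_mem_notMem hc hyN hcy
    have hdu := h.w_cond.tree.lt_of_lt_of_le hdc hcu
    rcases hu with ⟨huN, hlt⟩ | ⟨b, d', ζ₀, hdN', hdn', hdy, hdb, hζ₀, hbF, huF⟩
    · have hun := h.r_cond.tree.left_mem hlt
      rw [← h.reflects.map_eq u hun huN, h.map_lt hdn hun] at hdu
      exact hdN (h.mem_of_le (Or.inr hdu) huN)
    · have hbm := h.r_cond.mem_maxNodes hbF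
      have hdb' : r.T.Le d b := by
        rcases h.w_cond.tree.le_or_lt (Or.inr hdu) (h.map_le_of_val hζ₀ hbF huF) with h2 | h2
        · exact (h.map_le hdn (node_of_max hbm)).1 h2
        · exact absurd ((h.map_lt (node_of_max hbm) hdn).1 h2)
            ((TreeData.mem_maxNodes.1 hbm).2 d)
      rcases h.r_cond.tree.le_or_lt hdb' hdb with h2 | h2
      · exact hdN (hL.meet x y ξ ζ d hxF hyF hne hξ hζ (Or.inr hdx)
          (h.r_cond.tree.le_trans h2 hdy))
      · exact hdN' (hL.meet x y ξ ζ d' hxF hyF hne hξ hζ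
          (Or.inr (h.r_cond.tree.trans _ _ _ h2 hdx)) hdy)

theorem isCondition (h : Amalgamable π Y Γ N r s w e m) :
    (amalg N r w).IsCondition π Y Γ := by
  refine ⟨h.isFiniteTree, ⟨fun z hz => ?_, fun x hx => ?_⟩,
    fun x y ξ hx hy => ?_, ?_, ?_, ?_⟩
  · simp only [amalg, ZFSet.mem_sep] at hz
    exact hz.1
  · by_cases hxN : x ∈ N
    · have hxw := h.mem_max_of_mem hxN hx
      obtain ⟨ξ, hξ, hu⟩ := h.w_cond.func.2 x hxw
      refine ⟨ξ, h.val_iff.2 ⟨hx, Or.inr ⟨hxN, hξ⟩⟩, fun ζ hζ => hu ζ ?_⟩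
      exact ((h.val_iff.1 hζ).2.resolve_left fun h' => h'.1 hxN).2
    · obtain ⟨ξ, hξ, hu⟩ := h.r_cond.func.2 x ((h.mem_max_of_notMem hxN).1 hx)
      refine ⟨ξ, h.val_iff.2 ⟨hx, Or.inl ⟨hxN, hξ⟩⟩, fun ζ hζ => hu ζ ?_⟩
      exact ((h.val_iff.1 hζ).2.resolve_right fun h' => hxN h'.1).2
  · have mixed : ∀ x y, ZFSet.pair x ξ ∈ w.F → x ∈ (amalgTree N r w).maxNodes →
        ZFSet.pair y ξ ∈ r.F → False := fun x y hx hxm hy =>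
      (TreeData.mem_maxNodes.1 hxm).2 y (h.lt_iff.2 (h.lt_of_val (h.val_mem x ξ hx) hy hx))
    obtain ⟨hxm, ⟨-, hx⟩ | ⟨-, hx⟩⟩ := h.val_iff.1 hx <;>
      obtain ⟨hym, ⟨-, hy⟩ | ⟨-, hy⟩⟩ := h.val_iff.1 hy
    · exact h.r_cond.inj _ _ _ hx hy
    · exact (mixed y x hy hym hx).elim
    · exact (mixed x y hx hxm hy).elim
    · exact h.w_cond.inj _ _ _ hx hy
  · change ((r.A ∪ w.A : ZFSet.{u}) : Set ZFSet.{u}).Finite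
    rw [ZFSet.coe_union]
    exact h.r_cond.finite.union h.w_cond.finite
  · change IsAdequate π Y Γ ((r.A ∪ w.A : ZFSet.{u}) : Set ZFSet.{u})
    rw [ZFSet.coe_union]
    exact h.standing.isAdequate_union h.r_cond.adequate h.w_cond.adequate h.N_mem h.hull_mem
      fun M hM hb => h.extend.subset (h.reflects.trace_mem M hM hb)
  · intro M hM x hxm y hym hne ξ hξ ζ hζ hx hy c hcx hcy
    have hcx' : AmalgLt N r w c x := h.lt_iff.1 hcx
    have hcy' : AmalgLt N r w c y := h.lt_iff.1 hcy
    have hc1 : c ∈ (ω_ 1 : Ordinal.{u}).toZFSet :=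
      h.isFiniteTree.nodes_subset (h.amalgLt_mem hcx').1
    -- For `c ∈ N`, clause (4) comes from `w` through the substitute model and branches. For `c ∉
    -- N`, everything above `c` belongs to `r`; a model of `w` is included in `N`, and clause (4) of
    -- `r` for `N` rules this case out.
    by_cases hcN : c ∈ N
    · rcases h.exists_standsFor hM with ⟨-, hlarge⟩ | ⟨L, hL⟩
      · exact hlarge c hc1 hcN
      · obtain ⟨x', ξ', hbx⟩ := h.exists_branchFor hL hx hξ
        obtain ⟨y', ζ', hby⟩ := h.exists_branchFor hL hy hζ
        have hne' := h.branchFor_ne hne hxm hym hξ hζ hbx hby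
        rcases h.le_branchFor_or hbx hcN hcx' with h1 | ⟨d, h1, -, h2, h3, h4, h5, h6⟩
        · rcases h.le_branchFor_or hby hcN hcy' with h1' | ⟨d, h1', -, h2, h3, h4, h5, h6⟩
          · have hcx2 : w.T.Lt c x' := h1.resolve_left (by
              rintro rfl
              exact hne' (TreeData.IsFiniteTree.eq_of_le_max h1' hbx.1))
            have hcy2 : w.T.Lt c y' := h1'.resolve_left (by
              rintro rfl
              exact hne' (TreeData.IsFiniteTree.eq_of_le_max h1 hby.1).symm)
            exact hL.countable_mem c hc1 (h.w_cond.meet L hL.mem x' hbx.1 y' hby.1 hne'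
              ξ' hbx.2.1 ζ' hby.2.1 hbx.2.2.1 hby.2.2.1 c hcx2 hcy2)
          · exact (h.not_lt_common hL hne.symm hne'.symm hby hbx hζ hξ hcN hcx' h1' h2 h3 h4 h5
              h6).elim
        · exact (h.not_lt_common hL hne hne' hbx hby hξ hζ hcN hcy' h1 h2 h3 h4 h5 h6).elim
    · have h1 := h.amalgLt_of_notMem hcN hcx'
      have h2 := h.amalgLt_of_notMem hcN hcy'
      have hxN : x ∉ N := fun hxN => hcN (h.mem_of_le (Or.inr h1) hxN)
      have hyN : y ∉ N := fun hyN => hcN (h.mem_of_le (Or.inr h2) hyN)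
      have hxF := ((h.val_iff.1 hx).2.resolve_right fun h' => hxN h'.1).2
      have hyF := ((h.val_iff.1 hy).2.resolve_right fun h' => hyN h'.1).2
      rcases ZFSet.mem_union.1 (show M ∈ r.A ∪ w.A from hM) with hMr | hMw
      · exact h.r_cond.meet M hMr x (h.r_cond.mem_maxNodes hxF) y (h.r_cond.mem_maxNodes hyF) hne
          ξ hξ ζ hζ hxF hyF c h1 h2
      · have hMN : M ⊆ N := h.standing.subset_of_mem_Sk h.N_model
          (h.w_cond.adequate.1 hMw).1 (h.hull_mem M hMw)
        exact absurd (h.r_cond.meet N h.N_mem x (h.r_cond.mem_maxNodes hxF) y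
          (h.r_cond.mem_maxNodes hyF) hne ξ (hMN hξ) ζ (hMN hζ) hxF hyF c h1 h2) hcN

end Amalgamable

end AdequateForcing

namespace AdequateForcing

variable {π : Ordinal.{u} → ZFSet.{u}} {Y : Set ZFSet.{u}} {Γ : Set Ordinal.{u}}

/-! ### Moving the maximal nodes up -/

section
variable (h : ZFSet.{u} → ZFSet.{u}) (r : Triple.{u})

/-- The condition obtained from `r` by putting a new node `h a` on top of each maximal node `a`. -/
noncomputable def addTops : Triple.{u} where
  T := 
    { nodes := (ω_ 1 : Ordinal.{u}).toZFSet.sep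
        fun x => x ∈ r.T.nodes ∨ ∃ a ∈ r.T.maxNodes, x = h a
      rel := ((ω_ 1 : Ordinal.{u}).toZFSet.prod (ω_ 1 : Ordinal.{u}).toZFSet).sep
        fun p => ∃ x y, p = ZFSet.pair x y ∧
          (r.T.Lt x y ∨ ∃ a ∈ r.T.maxNodes, y = h a ∧ r.T.Le x a) }
  F := ((ω_ 1 : Ordinal.{u}).toZFSet.prod (ω_ 2 : Ordinal.{u}).toZFSet).sep
    fun p => ∃ a ξ, p = ZFSet.pair (h a) ξ ∧ ZFSet.pair a ξ ∈ r.F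
  A := r.A

end

/-- Maximal nodes of `r` must leave `N` so that branches of `w` with the same values can be
continued to them. Common predecessors of new tops were already common predecessors of the old
maximal nodes, so clause (4) is unaffected. -/
theorem exists_extends_maxNodes_notMem (S : Standing π Y Γ) {N : ZFSet.{u}}
    (hN : N ∈ models π Y) {r : Triple.{u}} (hr : r.IsCondition π Y Γ) :
    ∃ q : Triple.{u}, q.IsCondition π Y Γ ∧ q.Extends r ∧ q.A = r.A ∧
      ∀ a ∈ q.T.maxNodes, a ∉ N := by
  obtain ⟨δ, hδ, hδN⟩ := exists_bound_of_countable
    (s := {α : Ordinal.{u} | α < ω_ 1 ∧ (α.toZFSet ∈ N ∨ α.toZFSet ∈ r.T.nodes)}) (a := ω_ 1)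
    (((countable_ordinals (S.countable N hN.1)).union
      (countable_ordinals hr.tree.nodes_finite.countable)).mono fun α hα => hα.2)
    (fun α hα => hα.1) aleph0_lt_cof_omega_one
  -- The ordinal `δ < ω₁` exceeds all nodes and all countable ordinals of `N`. Adding the rank,
  -- which for a node is the node itself, keeps the tops distinct, and they stay below `ω₁` by
  -- additive indecomposability.
  let h : ZFSet.{u} → ZFSet.{u} := fun x => (δ + x.rank).toZFSet
  have hmax : ∀ a ∈ r.T.maxNodes, a ∈ r.T.nodes := fun a ha => (TreeData.mem_maxNodes.1 ha).1
  have hord : ∀ a ∈ r.T.nodes, ∃ α < δ, a = α.toZFSet ∧ α < ω_ 1 := by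
    intro a ha
    obtain ⟨α, hα, rfl⟩ := mem_toZFSet_iff.1 (hr.tree.nodes_subset ha)
    exact ⟨α, hδN α ⟨hα, Or.inr ha⟩, rfl, hα⟩
  have h1 : ∀ a ∈ r.T.nodes, h a ∈ (ω_ 1 : Ordinal.{u}).toZFSet := by
    intro a ha
    obtain ⟨α, hα, rfl, hα1⟩ := hord a ha
    simp only [h, rank_toZFSet, toZFSet_mem_toZFSet_iff]
    exact isPrincipal_add_omega 1 hδ hα1
  have hinj : ∀ a ∈ r.T.nodes, ∀ b ∈ r.T.nodes, h a = h b → a = b := by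
    intro a ha b hb hab
    obtain ⟨α, hα, rfl, -⟩ := hord a ha
    obtain ⟨β, hβ, rfl, -⟩ := hord b hb
    have := toZFSet_injective hab
    simp only [rank_toZFSet, add_right_inj] at this
    rw [this]
  have hmem : ∀ a ∈ r.T.nodes, ∀ b ∈ r.T.nodes, a ∈ h b := by
    intro a ha b hb
    obtain ⟨α, hα, rfl, -⟩ := hord a ha
    exact toZFSet_mem_toZFSet_iff.2 (hα.trans_le le_self_add)
  have hnode : ∀ a ∈ r.T.nodes, h a ∉ r.T.nodes := fun a ha ha' =>
    ZFSet.mem_irrefl _ (hmem _ ha' a ha)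
  have hnot : ∀ a ∈ r.T.nodes, h a ∉ N := by
    intro a ha ha'
    obtain ⟨α, hα, h2⟩ := mem_toZFSet_iff.1 (h1 a ha)
    have h3 := hδN α ⟨hα, Or.inl (by rwa [h2])⟩
    have : α = δ + a.rank := toZFSet_injective h2
    rw [this] at h3
    exact h3.not_ge le_self_add
  have hnodes : ∀ x, x ∈ (addTops h r).T.nodes ↔ x ∈ r.T.nodes ∨ ∃ a ∈ r.T.maxNodes, x = h a := by
    intro x
    simp only [addTops, ZFSet.mem_sep, and_iff_right_iff_imp]
    rintro (hx | ⟨a, ha, rfl⟩)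
    exacts [hr.tree.nodes_subset hx, h1 a (hmax a ha)]
  have hlt : ∀ x y, (addTops h r).T.Lt x y ↔
      (r.T.Lt x y ∨ ∃ a ∈ r.T.maxNodes, y = h a ∧ r.T.Le x a) := by
    intro x y
    simp only [addTops, TreeData.Lt, ZFSet.mem_sep, ZFSet.pair_mem_prod, ZFSet.pair_inj]
    constructor
    · rintro ⟨-, x', y', ⟨rfl, rfl⟩, h2⟩
      exact h2
    · intro h2
      refine ⟨?_, x, y, ⟨rfl, rfl⟩, h2⟩
      rcases h2 with h2 | ⟨a, ha, rfl, rfl | h2⟩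
      · exact ⟨hr.tree.nodes_subset (hr.tree.left_mem h2),
          hr.tree.nodes_subset (hr.tree.right_mem h2)⟩
      · exact ⟨hr.tree.nodes_subset (hmax _ ha), h1 _ (hmax _ ha)⟩
      · exact ⟨hr.tree.nodes_subset (hr.tree.left_mem h2), h1 a (hmax a ha)⟩
  have hltn : ∀ x y, y ∈ r.T.nodes → (addTops h r).T.Lt x y → r.T.Lt x y := by
    intro x y hy hxy
    rcases (hlt x y).1 hxy with h2 | ⟨a, ha, rfl, -⟩
    exacts [h2, absurd hy (hnode a (hmax a ha))]
  have hlth : ∀ x a, a ∈ r.T.maxNodes → (addTops h r).T.Lt x (h a) → r.T.Le x a := by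
    intro x a ha hxa
    rcases (hlt x (h a)).1 hxa with h2 | ⟨b, hb, h2, h3⟩
    · exact absurd (hr.tree.right_mem h2) (hnode a (hmax a ha))
    · rwa [hinj a (hmax a ha) b (hmax b hb) h2]
  have hF : ∀ x ξ, ZFSet.pair x ξ ∈ (addTops h r).F ↔ ∃ a, x = h a ∧ ZFSet.pair a ξ ∈ r.F := by
    intro x ξ
    simp only [addTops, ZFSet.mem_sep, ZFSet.pair_mem_prod, ZFSet.pair_inj]
    constructor
    · rintro ⟨-, a, ξ', ⟨rfl, rfl⟩, h2⟩
      exact ⟨a, rfl, h2⟩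
    · rintro ⟨a, rfl, h2⟩
      exact ⟨⟨h1 a (hmax a (hr.mem_maxNodes h2)), hr.val_mem h2⟩, a, ξ, ⟨rfl, rfl⟩, h2⟩
  have hmn : ∀ x, x ∈ (addTops h r).T.maxNodes ↔ ∃ a ∈ r.T.maxNodes, x = h a := by
    intro x
    rw [TreeData.mem_maxNodes, hnodes]
    constructor
    · rintro ⟨hx | hx, h2⟩
      · have hxm : x ∈ r.T.maxNodes :=
          TreeData.mem_maxNodes.2 ⟨hx, fun y hy => h2 y ((hlt x y).2 (Or.inl hy))⟩
        exact absurd ((hlt x (h x)).2 (Or.inr ⟨x, hxm, rfl, Or.inl rfl⟩)) (h2 _)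
      · exact hx
    · rintro ⟨a, ha, rfl⟩
      refine ⟨Or.inr ⟨a, ha, rfl⟩, fun y hy => ?_⟩
      have hb : ∀ b, b ∈ r.T.nodes → h a ≠ b := fun b hb hab => hnode a (hmax a ha) (by rwa [hab])
      rcases (hlt _ y).1 hy with h2 | ⟨b, hbm, -, h2 | h2⟩
      · exact hb _ (hr.tree.left_mem h2) rfl
      · exact hb b (hmax b hbm) h2
      · exact hb _ (hr.tree.left_mem h2) rfl
  have htree : (addTops h r).T.IsFiniteTree := by
    refine ⟨fun x hx => ?_, ?_, fun p hp => ?_, fun x hx => ?_, fun x y z hxy hyz => ?_,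
      fun x y z hxz hyz => ?_, fun x y hxy => ?_⟩
    · simp only [addTops, ZFSet.mem_sep] at hx
      exact hx.1
    · have hfin : (r.T.maxNodes : Set ZFSet.{u}).Finite :=
        hr.tree.nodes_finite.subset fun a ha => hmax a ha
      refine (hr.tree.nodes_finite.union (hfin.image h)).subset fun x hx => ?_
      rcases (hnodes x).1 hx with h2 | ⟨a, ha, rfl⟩
      exacts [Or.inl h2, Or.inr ⟨a, ha, rfl⟩]
    · have hp' := hp
      simp only [addTops, ZFSet.mem_sep] at hp'
      obtain ⟨-, x, y, rfl, h2⟩ := hp'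
      rw [ZFSet.pair_mem_prod, hnodes, hnodes]
      rcases h2 with h2 | ⟨a, ha, rfl, rfl | h2⟩
      · exact ⟨Or.inl (hr.tree.left_mem h2), Or.inl (hr.tree.right_mem h2)⟩
      · exact ⟨Or.inl (hmax _ ha), Or.inr ⟨_, ha, rfl⟩⟩
      · exact ⟨Or.inl (hr.tree.left_mem h2), Or.inr ⟨a, ha, rfl⟩⟩
    · rcases (hlt x x).1 hx with h2 | ⟨a, ha, rfl, h2 | h2⟩
      · exact hr.tree.irrefl x h2
      · exact hnode a (hmax a ha) (by rw [h2]; exact hmax a ha)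
      · exact hnode a (hmax a ha) (hr.tree.left_mem h2)
    · rw [hlt] at hyz ⊢
      rcases hyz with h2 | ⟨a, ha, rfl, h2⟩
      · exact Or.inl (hr.tree.trans _ _ _ (hltn x y (hr.tree.left_mem h2) hxy) h2)
      · have hyn : y ∈ r.T.nodes := by
          rcases h2 with rfl | h2
          exacts [hmax _ ha, hr.tree.left_mem h2]
        exact Or.inr ⟨a, ha, rfl, Or.inr (hr.tree.lt_of_lt_of_le (hltn x y hyn hxy) h2)⟩
    · have hle : ∃ v, r.T.Le x v ∧ r.T.Le y v := by
        rcases (hlt x z).1 hxz with h2 | ⟨a, ha, rfl, h2⟩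
        · exact ⟨z, Or.inr h2, Or.inr (hltn y z (hr.tree.right_mem h2) hyz)⟩
        · exact ⟨a, h2, hlth y a ha hyz⟩
      obtain ⟨v, hxv, hyv⟩ := hle
      rw [hlt, hlt]
      rcases hr.tree.le_or_lt hxv hyv with (h2 | h2) | h2
      exacts [Or.inl h2, Or.inr (Or.inl (Or.inl h2)), Or.inr (Or.inr (Or.inl h2))]
    · rcases (hlt x y).1 hxy with h2 | ⟨a, ha, rfl, rfl | h2⟩
      · exact hr.tree.lt_of_lt _ _ h2
      · exact hmem _ (hmax _ ha) _ (hmax _ ha)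
      · exact hmem _ (hr.tree.left_mem h2) _ (hmax a ha)
  refine ⟨addTops h r, ⟨htree, ⟨fun p hp => ?_, fun x hx => ?_⟩, ?_, hr.finite, hr.adequate, ?_⟩,
    ⟨⟨fun x hx => (hnodes x).2 (Or.inl hx), fun x hx y hy =>
      ⟨hltn x y hy, fun h2 => (hlt x y).2 (Or.inl h2)⟩⟩, fun _ hM => hM, fun a ha => ?_⟩, rfl, ?_⟩
  · have hp' := hp
    simp only [addTops, ZFSet.mem_sep] at hp'
    obtain ⟨-, a, ξ, rfl, h2⟩ := hp'
    exact ZFSet.pair_mem_prod.2 ⟨(hmn _).2 ⟨a, hr.mem_maxNodes h2, rfl⟩, hr.val_mem h2⟩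
  · obtain ⟨a, ha, rfl⟩ := (hmn x).1 hx
    obtain ⟨ξ, hξ, hu⟩ := hr.func.2 a ha
    refine ⟨ξ, (hF _ _).2 ⟨a, rfl, hξ⟩, fun ζ hζ => ?_⟩
    obtain ⟨b, hab, hb⟩ := (hF _ _).1 hζ
    obtain rfl := hinj a (hmax a ha) b (hmax b (hr.mem_maxNodes hb)) hab
    exact hu ζ hb
  · intro x y ξ hx hy
    obtain ⟨a, rfl, ha⟩ := (hF _ _).1 hx
    obtain ⟨b, rfl, hb⟩ := (hF _ _).1 hy
    rw [hr.inj a b ξ ha hb]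
  · intro M hM x hx y hy hne ξ hξ ζ hζ hxF hyF c hcx hcy
    obtain ⟨a, rfl, ha⟩ := (hF _ _).1 hxF
    obtain ⟨b, rfl, hb⟩ := (hF _ _).1 hyF
    have ham := hr.mem_maxNodes ha
    have hbm := hr.mem_maxNodes hb
    have hab : a ≠ b := fun hab => hne (by rw [hab])
    obtain ⟨h2, h3⟩ := Amalgamable.lt_of_le_of_ne_max ham hbm hab (hlth c a ham hcx)
      (hlth c b hbm hcy)
    exact hr.meet M hM a ham b hbm hab ξ hξ ζ hζ ha hb c h2 h3
  · obtain ⟨ξ, hξ, -⟩ := hr.func.2 a ha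
    exact ⟨h a, (hmn _).2 ⟨a, ha, rfl⟩, Or.inr ((hlt _ _).2 (Or.inr ⟨a, ha, rfl, Or.inl rfl⟩)), ξ,
      hξ, (hF _ _).2 ⟨a, rfl, hξ⟩⟩
  · intro x hx
    obtain ⟨a, ha, rfl⟩ := (hmn x).1 hx
    exact hnot a (hmax a ha)

end AdequateForcing

namespace AdequateForcing

variable {π : Ordinal.{u} → ZFSet.{u}} {Y : Set ZFSet.{u}} {Γ : Set Ordinal.{u}}

/-! ### Reflecting conditions -/

/-- The finite pattern of a condition with `n` nodes and `k` models relative to a model `N`: the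
tree order, which nodes are in `N`, which nodes are maximal, which values are in `N`, and which
values are in which models. -/
abbrev Pattern (n k : ℕ) : Type :=
  (Fin n → Fin n → Prop) × (Fin n → Prop) × (Fin n → Prop) × (Fin n → Prop) × (Fin n → Fin k → Prop)

/-- The nodes `t`, their values `v` and the models `μ` of the condition `p` realize a pattern, with
the nodes `a` and the values `b` in `N` and the traces `c` of the models on `N` being prescribed. -/
structure Realizes {n k : ℕ} (i : Pattern n k) (a b t v : Fin n → ZFSet.{u})
    (c μ : Fin k → ZFSet.{u}) (p : Triple.{u}) : Prop where
  inj : Function.Injective t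
  mem : ∀ j, t j ∈ p.T.nodes
  lt_iff : ∀ j l, p.T.Lt (t j) (t l) ↔ i.1 j l
  node_eq : ∀ j, i.2.1 j → t j = a j
  pair_mem : ∀ j, i.2.2.1 j → ZFSet.pair (t j) (v j) ∈ p.F
  val_eq : ∀ j, i.2.2.1 j → i.2.2.2.1 j → v j = b j
  val_notMem : ∀ j, i.2.2.1 j → ¬ i.2.2.2.1 j → ∀ l, v j ∉ c l
  val_mem : ∀ j l, i.2.2.1 j → i.2.2.2.2 j l → v j ∈ μ l
  model_mem : ∀ l, μ l ∈ p.A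
  trace_mem : ∀ l, c l ∈ p.A
  trace_subset : ∀ l, c l ⊆ μ l
  node_notMem : ∀ j l, ¬ i.2.1 j → t j ∉ μ l
  mem_trace : ∀ l, ∀ x ∈ (ω_ 1 : Ordinal.{u}).toZFSet, x ∈ μ l → x ∈ c l

/-- The relation whose witnesses are the conditions realizing a pattern. -/
def realizeRel (π : Ordinal.{u} → ZFSet.{u}) (Y : Set ZFSet.{u}) (Γ : Set Ordinal.{u})
    (i : Σ d : ℕ × ℕ, Pattern d.1 d.2) (l : List ZFSet.{u}) (x : ZFSet.{u}) : Prop :=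
  ∃ a b c, l = (List.ofFn a ++ List.ofFn b) ++ List.ofFn c ∧ ∃ p : Triple.{u},
    p.IsCondition π Y Γ ∧ x = p.toSet ∧ ∃ t v μ, Realizes i.2 a b t v c μ p

/-- The condition `r` with its models replaced by those below `N` and their traces on `N`. -/
noncomputable def belowPart (π : Ordinal.{u} → ZFSet.{u}) (Y : Set ZFSet.{u})
    (Γ : Set Ordinal.{u}) (N : ZFSet.{u}) (r : Triple.{u}) : Triple.{u} where
  T := r.T
  F := r.F
  A := (r.A ∪ N.powerset).sep fun L => ∃ M ∈ r.A, IsBelow π Y Γ M N ∧ (L = M ∨ L = M ∩ N)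

theorem mem_belowPart {N L : ZFSet.{u}} {r : Triple.{u}} :
    L ∈ (belowPart π Y Γ N r).A ↔ ∃ M ∈ r.A, IsBelow π Y Γ M N ∧ (L = M ∨ L = M ∩ N) := by
  simp only [belowPart, ZFSet.mem_sep, ZFSet.mem_union, ZFSet.mem_powerset]
  refine ⟨fun h => h.2, fun h => ⟨?_, h⟩⟩
  obtain ⟨M, hM, -, rfl | rfl⟩ := h
  · exact Or.inl hM
  · exact Or.inr fun z hz => (ZFSet.mem_inter.1 hz).2

/-- The traces are truncations at points of `Γ`, so adequacy is kept. Clause (4) passes to `M ∩ N`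
because the countable ordinals of `M` are in `N`. -/
theorem isCondition_belowPart (S : Standing π Y Γ) {N : ZFSet.{u}} {r : Triple.{u}}
    (hr : r.IsCondition π Y Γ) : (belowPart π Y Γ N r).IsCondition π Y Γ := by
  refine ⟨hr.tree, hr.func, hr.inj, ?_, S.isAdequate_truncations hr.adequate fun L hL => ?_, ?_⟩
  · refine (hr.finite.union (hr.finite.image fun M => M ∩ N)).subset fun L hL => ?_
    obtain ⟨M, hM, -, rfl | rfl⟩ := mem_belowPart.1 hL
    exacts [Or.inl hM, Or.inr ⟨M, hM, rfl⟩]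
  · obtain ⟨M, hM, hB, rfl | rfl⟩ := mem_belowPart.1 hL
    · exact Or.inl hM
    · obtain ⟨β, hβ, h⟩ := hB.1
      exact Or.inr ⟨M, hM, β, hβ, h⟩
  · intro L hL a ha b hb hab x hx y hy hax hby c hca hcb
    obtain ⟨M, hM, hB, hL⟩ := mem_belowPart.1 hL
    have hsub : ∀ z ∈ L, z ∈ M := by
      rcases hL with rfl | rfl
      exacts [fun _ h => h, fun _ h => (ZFSet.mem_inter.1 h).1]
    have hc := hr.meet M hM a ha b hb hab x (hsub x hx) y (hsub y hy) hax hby c hca hcb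
    rcases hL with rfl | rfl
    · exact hc
    · exact ZFSet.mem_inter.2 ⟨hc, hB.2.2 c (hr.tree.nodes_subset (hr.tree.left_mem hca)) hc⟩

/-- A condition is reflected by a condition inside any sufficiently closed set. -/
theorem exists_reflects (S : Standing π Y Γ) {N : ZFSet.{u}} {r : Triple.{u}}
    (hr : r.IsCondition π Y Γ) {X K : Set ZFSet.{u}}
    (hX : (kurepaPoset π Y Γ).carrier ⊆ X) (hK : Sk π Y N ⊆ K)
    (hw : IsWitnessed X (realizeRel π Y Γ) K) :
    ∃ s e m, s.IsCondition π Y Γ ∧ s.toSet ∈ K ∧ Reflects π Y Γ N r s e m := by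
  classical
  obtain ⟨n, t, ht, hrt⟩ := hr.tree.nodes_finite.fin_param
  obtain ⟨k, μ, hμ, hrμ⟩ := (hr.finite.subset (t := {M | M ∈ r.A ∧ IsBelow π Y Γ M N})
    fun M h => h.1).fin_param
  have hμr : ∀ l, μ l ∈ r.A ∧ IsBelow π Y Γ (μ l) N := fun l => by
    have : μ l ∈ Set.range μ := ⟨l, rfl⟩
    rwa [hrμ] at this
  have htr : ∀ j, t j ∈ r.T.nodes := fun j => by
    have : t j ∈ Set.range t := ⟨j, rfl⟩
    rwa [hrt] at this
  have hv : ∀ j, ∃ x, t j ∈ r.T.maxNodes → ZFSet.pair (t j) x ∈ r.F := fun j => by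
    by_cases h : t j ∈ r.T.maxNodes
    · obtain ⟨x, hx, -⟩ := hr.func.2 _ h
      exact ⟨x, fun _ => hx⟩
    · exact ⟨∅, fun h' => absurd h' h⟩
  choose v hv using hv
  have h0 : (∅ : ZFSet.{u}) ∈ K := hK (by simpa using nat_mem_Sk S.bij (Y := Y) N 0)
  let i : Pattern n k := ⟨fun j l => r.T.Lt (t j) (t l), fun j => t j ∈ N,
    fun j => t j ∈ r.T.maxNodes, fun j => v j ∈ N, fun j l => v j ∈ μ l⟩
  -- Entries outside `N` are replaced by the dummy parameter `∅`, so that all parameters belong to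
  -- `K`.
  let a : Fin n → ZFSet.{u} := fun j => if t j ∈ N then t j else ∅
  let b : Fin n → ZFSet.{u} := fun j => if v j ∈ N then v j else ∅
  let c : Fin k → ZFSet.{u} := fun l => μ l ∩ N
  have hreal : Realizes i a b t v c μ (belowPart π Y Γ N r) :=
    { inj := ht
      mem := htr
      lt_iff := fun _ _ => Iff.rfl
      node_eq := fun j h => (if_pos h).symm
      pair_mem := hv
      val_eq := fun j _ h => (if_pos h).symm
      val_notMem := fun j _ h l h' => h (ZFSet.mem_inter.1 h').2
      val_mem := fun _ _ _ h => h
      model_mem := fun l => mem_belowPart.2 ⟨_, (hμr l).1, (hμr l).2, Or.inl rfl⟩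
      trace_mem := fun l => mem_belowPart.2 ⟨_, (hμr l).1, (hμr l).2, Or.inr rfl⟩
      trace_subset := fun l z hz => (ZFSet.mem_inter.1 hz).1
      node_notMem := fun j l h h' => h ((hμr l).2.2.2 _ (hr.tree.nodes_subset (htr j)) h')
      mem_trace := fun l x hx h => ZFSet.mem_inter.2 ⟨h, (hμr l).2.2.2 x hx h⟩ }
  obtain ⟨_, hxK, a', b', c', hl, s, hs, rfl, t', v', μ', hs'⟩ := hw ⟨(n, k), i⟩
    ((List.ofFn a ++ List.ofFn b) ++ List.ofFn c) (by
      intro x hx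
      rcases List.mem_append.1 hx with hx | hx
      · rcases List.mem_append.1 hx with hx | hx <;> obtain ⟨j, rfl⟩ := List.mem_ofFn.1 hx
        · by_cases h : t j ∈ N
          · simpa [a, h] using hK (subset_Sk h)
          · simpa [a, h] using h0
        · by_cases h : v j ∈ N
          · simpa [b, h] using hK (subset_Sk h)
          · simpa [b, h] using h0
      · obtain ⟨l, rfl⟩ := List.mem_ofFn.1 hx
        exact hK (hμr l).2.2.1)
    ⟨_, hX ⟨_, isCondition_belowPart S hr, rfl⟩, a, b, c, rfl, _, isCondition_belowPart S hr, rfl,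
      t, v, μ, hreal⟩
  obtain ⟨hl, hc⟩ := List.append_inj hl (by simp)
  obtain ⟨ha, hb⟩ := List.append_inj hl (by simp)
  obtain rfl := List.ofFn_injective ha
  obtain rfl := List.ofFn_injective hb
  obtain rfl := List.ofFn_injective hc
  -- The maps `e` and `m` match the two enumerations; their values elsewhere play no role.
  have he : ∀ j, Function.extend t t' id (t j) = t' j := ht.extend_apply _ _
  have hm : ∀ l, Function.extend μ μ' id (μ l) = μ' l := hμ.extend_apply _ _
  have hnode : ∀ x ∈ r.T.nodes, ∃ j, t j = x := fun x hx => by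
    have : x ∈ (r.T.nodes : Set ZFSet.{u}) := hx
    rwa [← hrt] at this
  have hmodel : ∀ M ∈ r.A, IsBelow π Y Γ M N → ∃ l, μ l = M := fun M hM hB => by
    have : M ∈ {M | M ∈ r.A ∧ IsBelow π Y Γ M N} := ⟨hM, hB⟩
    rwa [← hrμ] at this
  refine ⟨s, Function.extend t t' id, Function.extend μ μ' id, hs, hxK, ?_, ?_, ?_, ?_, ?_, ?_, ?_,
    ?_, ?_, ?_⟩
  · intro x hx
    obtain ⟨j, rfl⟩ := hnode x hx
    rw [he]
    exact hs'.mem j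
  · intro x hx y hy
    obtain ⟨j, rfl⟩ := hnode x hx
    obtain ⟨l, rfl⟩ := hnode y hy
    rw [he, he]
    exact hs'.lt_iff j l
  · intro x hx y hy hxy
    obtain ⟨j, rfl⟩ := hnode x hx
    obtain ⟨l, rfl⟩ := hnode y hy
    rw [he, he] at hxy
    rw [hs'.inj hxy]
  · intro x hx hxN
    obtain ⟨j, rfl⟩ := hnode x hx
    rw [he, hs'.node_eq j hxN]
    exact if_pos hxN
  · intro x ξ hxξ
    have hx := hr.mem_maxNodes hxξ
    obtain ⟨j, rfl⟩ := hnode x (TreeData.mem_maxNodes.1 hx).1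
    obtain rfl := hr.val_unique hxξ (hv j hx)
    rw [he]
    refine ⟨v' j, hs'.pair_mem j hx, fun h => ?_, fun M hM hB => ?_⟩
    · rw [hs'.val_eq j hx h]
      exact if_pos h
    · obtain ⟨l, rfl⟩ := hmodel M hM hB
      rw [hm]
      exact ⟨fun h => hs'.val_notMem j hx h l, fun h => hs'.val_mem j l hx h⟩
  · intro M hM hB
    obtain ⟨l, rfl⟩ := hmodel M hM hB
    rw [hm]
    exact hs'.model_mem l
  · intro M hM hB
    obtain ⟨l, rfl⟩ := hmodel M hM hB
    exact hs'.trace_mem l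
  · intro M hM hB
    obtain ⟨l, rfl⟩ := hmodel M hM hB
    rw [hm]
    exact hs'.trace_subset l
  · intro M hM hB x hx hxm
    obtain ⟨l, rfl⟩ := hmodel M hM hB
    rw [hm] at hxm
    exact (ZFSet.mem_inter.1 (hs'.mem_trace l x hx hxm)).1
  · intro M hM hB x hx hxN
    obtain ⟨l, rfl⟩ := hmodel M hM hB
    obtain ⟨j, rfl⟩ := hnode x hx
    rw [hm, he]
    exact hs'.node_notMem j l hxN

end AdequateForcing

namespace AdequateForcing

variable {π : Ordinal.{u} → ZFSet.{u}} {Y : Set ZFSet.{u}} {Γ : Set Ordinal.{u}}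

/-! ### Strongly generic conditions -/

/-- `K` is a countable set of the kind for which strongly generic conditions exist, and `N` is its
trace on `ω₂`. -/
structure IsSuitable (π : Ordinal.{u} → ZFSet.{u}) (Y : Set ZFSet.{u}) (Γ : Set Ordinal.{u})
    (θ : Cardinal.{u}) (K : Set ZFSet.{u}) (N : ZFSet.{u}) : Prop where
  mem_iff : ∀ x, x ∈ N ↔ x ∈ K ∧ x ∈ (ω_ 2 : Ordinal.{u}).toZFSet
  model : N ∈ models π Y
  hull_subset : Sk π Y N ⊆ K
  mem_hull : ∀ x ∈ K, x ∈ H (ℵ_ 2) → x ∈ Sk π Y N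
  mem_of_mem : ∀ x ∈ K, (x : Set ZFSet.{u}).Countable → ∀ y ∈ x, y ∈ K
  witnessed : IsWitnessed (H θ) (realizeRel π Y Γ) K

/-- The graphs of the Skolem functions. -/
def skolemRel (π : Ordinal.{u} → ZFSet.{u}) (Y : Set ZFSet.{u})
    (i : Σ n, langA.BoundedFormula Empty (n + 1)) (l : List ZFSet.{u}) (x : ZFSet.{u}) : Prop :=
  ∃ v : Fin i.1 → ↥(H.{u} (ℵ_ 2)), l = List.ofFn (fun j => (v j : ZFSet.{u})) ∧
    x = skolemFun π Y i.2 v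

/-- The graph of the inverse of `π`. -/
def invRel (π : Ordinal.{u} → ZFSet.{u}) (_ : Unit) (l : List ZFSet.{u}) (x : ZFSet.{u}) : Prop :=
  ∃ α < ω_ 2, l = [π α] ∧ x = α.toZFSet

/-- The graph of the function taking `γ` to the supremum of `C ∩ γ`. -/
def supRel (π : Ordinal.{u} → ZFSet.{u}) (Y : Set ZFSet.{u}) (_ : Unit) (l : List ZFSet.{u})
    (x : ZFSet.{u}) : Prop :=
  ∃ γ : Ordinal.{u}, l = [γ.toZFSet] ∧ x = (sSup (clubC π Y ∩ Set.Iio γ)).toZFSet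

theorem exists_enumeration (a : ZFSet.{u}) : ∃ f : ℕ → ZFSet.{u},
    (a : Set ZFSet.{u}).Countable → ∀ y ∈ a, ∃ n, f n = y := by
  by_cases h : (a : Set ZFSet.{u}).Countable
  · rcases (a : Set ZFSet.{u}).eq_empty_or_nonempty with h0 | h0
    · refine ⟨fun _ => ∅, fun _ y hy => ?_⟩
      have : y ∈ (a : Set ZFSet.{u}) := hy
      rw [h0] at this
      exact this.elim
    · obtain ⟨f, hf⟩ := h.exists_eq_range h0
      refine ⟨f, fun _ y hy => ?_⟩
      have : y ∈ (a : Set ZFSet.{u}) := hy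
      rwa [hf] at this
  · exact ⟨fun _ => ∅, fun h' => absurd h' h⟩

/-- Each relation secures one requirement on `K`: elementarity, closure under Skolem functions,
reflection of conditions, inclusion of countable elements, `K ∩ H(ω₂) ⊆ Sk(N)` through the inverse
of `π`, and closure of `N` under `γ ↦ sup(C ∩ γ)`. -/
theorem exists_isSuitable (S : Standing π Y Γ)
    (hY : IsStationaryCountable ((ω_ 2 : Ordinal.{u}).toZFSet : Set ZFSet.{u})
      ((fun a : ZFSet.{u} => (a : Set ZFSet.{u})) '' Y))
    {θ : Cardinal.{u}} (hθ : ℵ_ 2 ≤ θ) {D : Set (Set ZFSet.{u})} (hD : IsClubCountable (H θ) D) :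
    ∃ K ∈ D, IsElementaryInH θ K ∧ ∃ N, IsSuitable π Y Γ θ K N := by
  have hH : H (ℵ_ 2) ⊆ H θ := H_mono hθ
  choose f hf using exists_enumeration.{u}
  have := countable_formulas langSet countable_symbols_langSet
  have := countable_formulas langA countable_symbols_langA
  obtain ⟨K, hK, ⟨N, hNY, hNK⟩, hw⟩ := exists_isWitnessed (X := H θ)
    (Sum.elim (tarskiVaught θ) (Sum.elim (skolemRel π Y) (Sum.elim (realizeRel π Y Γ)
      (Sum.elim (fun (n : ℕ) l x => ∃ a, l = [a] ∧ x = f a n) (Sum.elim (invRel π) (supRel π Y))))))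
    (fun x hx => hH (mem_H_of_mem_omega_two hx)) hY hD
  have hKsub := (hD.subset hK).1
  have hN : ∀ x, x ∈ N ↔ x ∈ K ∧ x ∈ (ω_ 2 : Ordinal.{u}).toZFSet := fun x => by
    have : x ∈ (N : Set ZFSet.{u}) ↔ x ∈ K ∩ ((ω_ 2 : Ordinal.{u}).toZFSet : Set ZFSet.{u}) :=
      Set.ext_iff.1 hNK x
    exact this
  have hSk : Sk π Y N ⊆ K := by
    intro x hx
    induction hx with
    | base x hx => exact ((hN x).1 hx).1
    | step n φ v hv ih =>
      obtain ⟨y, hyK, v', h1, rfl⟩ := hw (Sum.inr (Sum.inl ⟨n, φ⟩))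
        (List.ofFn fun j => (v j : ZFSet.{u})) (by
          intro y hy
          obtain ⟨j, rfl⟩ := List.mem_ofFn.1 hy
          exact ih j) ⟨_, hH (skolemFun_mem_H S.bij φ v), v, rfl, rfl⟩
      have hv' : v = v' := funext fun j => Subtype.ext (congrFun (List.ofFn_injective h1) j)
      rwa [hv']
  have hskN : IsSkClosed π Y N := by
    refine Set.Subset.antisymm (fun x hx => (hN x).2 ⟨hSk hx.1, hx.2⟩) fun x hx => ?_
    exact ⟨subset_Sk hx, ((hN x).1 hx).2⟩
  refine ⟨K, hK, isElementaryInH_of_isWitnessed hKsub fun i => hw (Sum.inl i), N, hN,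
    ⟨hNY, hskN, fun γ hγ => ?_⟩, hSk, fun x hx hxH => ?_, fun x hx hxc y hy => ?_,
    fun i => hw (Sum.inr (Sum.inr (Sum.inl i)))⟩
  · obtain ⟨hγK, hγ2⟩ := (hN _).1 hγ
    have hle : sSup (clubC π Y ∩ Set.Iio γ) < ω_ 2 :=
      (csSup_le' fun α hα => le_of_lt hα.2).trans_lt (toZFSet_mem_toZFSet_iff.1 hγ2)
    obtain ⟨y, hyK, γ', h1, rfl⟩ := hw (Sum.inr (Sum.inr (Sum.inr (Sum.inr (Sum.inr ())))))
      [γ.toZFSet] (by simpa using hγK) ⟨_, hH (toZFSet_mem_H hle), γ, rfl, rfl⟩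
    obtain rfl : γ = γ' := toZFSet_injective (List.singleton_injective h1)
    exact (hN _).2 ⟨hyK, toZFSet_mem_toZFSet_iff.2 hle⟩
  · obtain ⟨α, hα, rfl⟩ := S.bij.surjOn hxH
    obtain ⟨y, hyK, α', hα', h1, rfl⟩ := hw (Sum.inr (Sum.inr (Sum.inr (Sum.inr (Sum.inl ())))))
      [π α] (by simpa using hx) ⟨_, hH (toZFSet_mem_H hα), α, hα, rfl, rfl⟩
    obtain rfl : α = α' := S.bij.injOn hα hα' (List.singleton_injective h1)
    exact pi_mem_Sk S.bij hα (subset_Sk ((hN _).2 ⟨hyK, toZFSet_mem_toZFSet_iff.2 hα⟩))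
  · obtain ⟨n, rfl⟩ := hf x hxc y hy
    obtain ⟨y, hyK, a, h1, rfl⟩ := hw (Sum.inr (Sum.inr (Sum.inr (Sum.inl n))))
      [x] (by simpa using hx) ⟨_, mem_H_of_mem (hKsub hx) hy, x, rfl, rfl⟩
    obtain rfl : x = a := List.singleton_injective h1
    exact hyK

namespace IsSuitable

variable {θ : Cardinal.{u}} {K : Set ZFSet.{u}} {N : ZFSet.{u}} {p q r : Triple.{u}}

theorem left_mem (h : IsSuitable π Y Γ θ K N) {x y : ZFSet.{u}} (hxy : ZFSet.pair x y ∈ K) :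
    x ∈ K :=
  h.mem_of_mem _ (h.mem_of_mem _ hxy (by simp [ZFSet.pair]) {x} (by simp [ZFSet.pair])) (by simp) x
    (by simp)

theorem right_mem (h : IsSuitable π Y Γ θ K N) {x y : ZFSet.{u}} (hxy : ZFSet.pair x y ∈ K) :
    y ∈ K :=
  h.mem_of_mem _ (h.mem_of_mem _ hxy (by simp [ZFSet.pair]) {x, y} (by simp [ZFSet.pair]))
    (by simp) y (by simp)

theorem node_mem (h : IsSuitable π Y Γ θ K N) (hp : p.IsCondition π Y Γ) (hpK : p.toSet ∈ K)
    {x : ZFSet.{u}} (hx : x ∈ p.T.nodes) : x ∈ N :=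
  (h.mem_iff x).2 ⟨h.mem_of_mem _ (h.left_mem (h.left_mem hpK)) hp.tree.nodes_finite.countable x hx,
    toZFSet_subset_toZFSet_iff.2 omega_one_lt_omega_two.le (hp.tree.nodes_subset hx)⟩

theorem hull_mem (h : IsSuitable π Y Γ θ K N) (S : Standing π Y Γ) (hp : p.IsCondition π Y Γ)
    (hpK : p.toSet ∈ K) {L : ZFSet.{u}} (hL : L ∈ p.A) : L ∈ Sk π Y N :=
  h.mem_hull L (h.mem_of_mem _ (h.right_mem (h.right_mem hpK)) hp.finite.countable L hL)
    (S.mem_H (hp.adequate.1 hL).1)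

theorem val_mem (h : IsSuitable π Y Γ θ K N) (hp : p.IsCondition π Y Γ) (hpK : p.toSet ∈ K)
    {x ξ : ZFSet.{u}} (hx : ZFSet.pair x ξ ∈ p.F) : ξ ∈ N := by
  have hfin : (p.F : Set ZFSet.{u}).Finite := by
    have hmax : (p.T.maxNodes : Set ZFSet.{u}).Finite :=
      hp.tree.nodes_finite.subset fun a ha => (TreeData.mem_maxNodes.1 ha).1
    choose! g hg using fun a ha => (hp.func.2 a ha).exists
    refine (hmax.image fun a => ZFSet.pair a (g a)).subset fun z hz => ?_
    obtain ⟨a, ha, b, -, rfl⟩ := ZFSet.mem_prod.1 (hp.func.1 hz)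
    exact ⟨a, ha, by rw [hp.val_unique hz (hg a ha)]⟩
  exact (h.mem_iff ξ).2 ⟨h.right_mem (h.mem_of_mem _ (h.left_mem (h.right_mem hpK)) hfin.countable _
    hx), hp.val_mem hx⟩

/-- A condition containing the trace `N` as a model is strongly generic. -/
theorem isStronglyGeneric (h : IsSuitable π Y Γ θ K N) (S : Standing π Y Γ)
    (hX : (kurepaPoset π Y Γ).carrier ⊆ H θ) (hq : q.IsCondition π Y Γ) (hN : N ∈ q.A) :
    (kurepaPoset π Y Γ).IsStronglyGeneric K q.toSet := by
  refine ⟨⟨q, hq, rfl⟩, ?_⟩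
  rintro D ⟨hDK, hD⟩ _ ⟨r, hr, rfl⟩ ⟨r', q', h1, h2, hrq⟩
  obtain rfl := Triple.toSet_injective h1
  obtain rfl := Triple.toSet_injective h2
  obtain ⟨r', hr', hrr, hA, hmax⟩ := exists_extends_maxNodes_notMem S h.model hr
  obtain ⟨s, e, m, hs, hsK, href⟩ := exists_reflects S (N := N) hr' hX h.hull_subset h.witnessed
  -- Density of `D` is applied to the reflection `s`, which is in `K`; the extension `w` found in
  -- `D` is the one amalgamated with `r'`.
  obtain ⟨_, hwD, w, s', rfl, h3, hws⟩ := hD s.toSet ⟨hsK, s, hs, rfl⟩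
  obtain rfl := Triple.toSet_injective h3
  obtain ⟨hwK, w', hw, h4⟩ := hDK hwD
  obtain rfl := Triple.toSet_injective h4
  have ham : Amalgamable π Y Γ N r' s w e m := ⟨S, hr', hs, hw, href, hws,
    by rw [hA]; exact hrq.subset hN, hmax, fun x hx => h.node_mem hw hwK hx,
    fun x ξ hx => h.val_mem hw hwK hx, fun L hL => h.hull_mem S hw hwK hL⟩
  exact ⟨_, hwD, _, ⟨_, ham.isCondition, rfl⟩, ⟨_, _, rfl, rfl, ham.extends_w⟩,
    _, _, rfl, rfl, ham.extends_r.trans π Y Γ hr' ham.isCondition hrr⟩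

/-- A condition in `K` may be extended by adding the trace `N` as a model. -/
theorem isCondition_insert (h : IsSuitable π Y Γ θ K N) (S : Standing π Y Γ)
    (hp : p.IsCondition π Y Γ) (hpK : p.toSet ∈ K) :
    (⟨p.T, p.F, insert N p.A⟩ : Triple.{u}).IsCondition π Y Γ := by
  have hcoe : ((insert N p.A : ZFSet.{u}) : Set ZFSet.{u}) = insert N (p.A : Set ZFSet.{u}) := by
    ext x
    exact ZFSet.mem_insert_iff
  refine ⟨hp.tree, hp.func, hp.inj, ?_, ?_, ?_⟩
  · rw [hcoe]
    exact hp.finite.insert N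
  · rw [hcoe]
    exact S.isAdequate_insert hp.adequate h.model fun M hM => h.hull_mem S hp hpK hM
  · intro M hM a ha b hb hab x hx y hy hax hby c hca hcb
    rcases ZFSet.mem_insert_iff.1 hM with rfl | hM
    · exact h.node_mem hp hpK (hp.tree.left_mem hca)
    · exact hp.meet M hM a ha b hb hab x hx y hy hax hby c hca hcb

theorem exists_isStronglyGeneric (h : IsSuitable π Y Γ θ K N) (S : Standing π Y Γ)
    (hX : (kurepaPoset π Y Γ).carrier ⊆ H θ) {x : ZFSet.{u}}
    (hx : x ∈ K ∩ (kurepaPoset π Y Γ).carrier) :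
    ∃ y, (kurepaPoset π Y Γ).le y x ∧ (kurepaPoset π Y Γ).IsStronglyGeneric K y := by
  obtain ⟨hpK, p, hp, rfl⟩ := hx
  have hext := hp.extends_refl
  refine ⟨_, ⟨⟨p.T, p.F, insert N p.A⟩, p, rfl, rfl, hext.endExtends,
    fun M hM => ZFSet.mem_insert_iff.2 (Or.inr hM), hext.maximal⟩,
    h.isStronglyGeneric S hX (h.isCondition_insert S hp hpK) (ZFSet.mem_insert_iff.2 (Or.inl rfl))⟩

end IsSuitable

theorem exists_mem_gt_of_isStationary {κ : Ordinal.{u}} (hκ : Order.IsSuccLimit κ)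
    (h : IsStationary {β : Set.Iio κ | (β : Ordinal.{u}) ∈ Γ}) {α : Ordinal.{u}} (hα : α < κ) :
    ∃ β ∈ Γ, α < β := by
  have hclub : IsClub {β : Set.Iio κ | α < β} := by
    refine ⟨fun d hd hne _ a ha => ?_, fun x => ?_⟩
    · obtain ⟨b, hb⟩ := hne
      exact lt_of_lt_of_le (hd hb) (Subtype.coe_le_coe.2 (ha.1 hb))
    · refine ⟨⟨max (α + 1) x, max_lt (hκ.add_one_lt hα) x.2⟩, ?_, ?_⟩
      · exact (lt_add_one α).trans_le (le_max_left _ _)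
      · exact Subtype.coe_le_coe.1 (le_max_right (α + 1) (x : Ordinal.{u}))
  obtain ⟨β, hβ, h2⟩ := h hclub
  exact ⟨β, hβ, h2⟩

end AdequateForcing

/-- Assume `2 ^ ω₁ = ω₂`, let `π : ω₂ → H(ω₂)` be a bijection, let `𝒴 ⊆ P_{ω₁}(ω₂)` be thin,
stationary and closed under initial segments, and let `Γ ⊆ Λ` be stationary in `ω₂`. Then the
forcing poset for adding a Kurepa tree is strongly proper on a stationary set. -/
theorem proposition7p9
    (hpow : (2 : Cardinal.{u}) ^ (ℵ₁ : Cardinal.{u}) = ℵ_ 2)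
    (π : Ordinal.{u} → ZFSet.{u})
    (hπ : Set.BijOn π (Set.Iio (ω_ 2)) (AdequateForcing.H (ℵ_ 2)))
    (Y : Set ZFSet.{u})
    (hYstat : AdequateForcing.IsStationaryCountable ((ω_ 2).toZFSet : Set ZFSet.{u})
      ((fun a : ZFSet.{u} => (a : Set ZFSet.{u})) '' Y))
    (hYthin : AdequateForcing.IsThin Y)
    (hYinit : ∀ a ∈ Y, ∀ β < ω_ 2, a ∩ β.toZFSet ∈ Y)
    (Γ : Set Ordinal.{u})
    (hΓ : Γ ⊆ AdequateForcing.Lam π Y)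
    (hΓstat : IsStationary {β : Set.Iio (ω_ 2 : Ordinal.{u}) | (β : Ordinal.{u}) ∈ Γ}) :
    (AdequateForcing.kurepaPoset π Y Γ).StronglyProperOnStationarySet := by
  have hY : ∀ a ∈ Y, (a : Set ZFSet.{u}) ∈ AdequateForcing.countableSubsets
      ((ω_ 2 : Ordinal.{u}).toZFSet : Set ZFSet.{u}) := fun a ha => hYstat.1 ⟨a, ha, rfl⟩
  have S : AdequateForcing.Standing π Y Γ := ⟨hπ, fun a ha x hx => (hY a ha).1 hx,
    fun a ha => (hY a ha).2, hYthin, hYinit, hΓ, fun α hα =>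
      AdequateForcing.exists_mem_gt_of_isStationary (isSuccLimit_omega 2) hΓstat hα⟩
  -- Any `θ ≥ ω₂` suffices, because then `H(ω₂) ⊆ H(θ)`.
  refine ⟨ℵ_ 2, fun θ hθ _ hX => ⟨fun N hN => hN.1, fun D hD => ?_⟩⟩
  obtain ⟨K, hK, hel, N, hN⟩ := AdequateForcing.exists_isSuitable S hYstat hθ hD
  exact ⟨K, ⟨hD.subset hK, hel, fun p hp => hN.exists_isStronglyGeneric S hX hp⟩, hK⟩
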